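/- **Setting.** Let $V$ be a smooth four-dimensional manifold (Hausdorff, $\sigma$-compact), $\pi:T^*V\to V$ its cotangent bundle, and $(x^i,p_a)$, $i,a=1,\dots,4$, the natural local coordinates on $T^*V$. An *N-connection* is a smooth splitting $T(T^*V)=h\oplus cv$ with $cv=\ker d\pi$; it has coefficients $N_{ia}(x,p)$, N-adapted frames $e_i=\partial/\partial x^i-N_{ia}\,\partial/\partial p_a$, $e^a=\partial/\partial p_a$, and curvature $\Omega_{ija}=\partial_jN_{ia}-\partial_iN_{ja}+N_{ib}\,\partial^bN_{ja}-N_{jb}\,\partial^bN_{ia}$, where $\partial_i=\partial/\partial x^i$, $\partial^a=\partial/\partial p_a$. A *d-metric* is a smooth metric $g$ on $T^*V$ for which $h$ and $cv$ are orthogonal and which has signature $(+,+,+,-)$ on each of them; write $g_{ij}=g(e_i,e_j)$, $g^{ab}=g(e^a,e^b)$, with inverse matrices $g^{ij}$, $g_{ab}$. A *d-connection* is a linear connection on $T^*V$ that preserves $h$ and $cv$. For a linear connection $D$ let $R(X,Y)=[D_X,D_Y]-D_{[X,Y]}$, $R(e_\delta,e_\gamma)e_\beta=R^\alpha{}_{\beta\gamma\delta}e_\alpha$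 and $R_{\alpha\beta}=R^\tau{}_{\alpha\beta\tau}$, i.e. $\mathrm{Ric}(y,z)=\mathrm{tr}\big(x\mapsto R(x,z)y\big)$. Fix an N-connection, a d-metric $g$, a smooth d-connection $D$ with $Dg=0$, a constant $\varkappa$ and a finite sum $T_{\alpha\beta}$ of energy-momentum d-tensors. The *effective source* is $\Upsilon_{\alpha\beta}=\varkappa\,(T_{\alpha\beta}-\tfrac12 g_{\alpha\beta}T)$ with $T=g^{\alpha\beta}T_{\alpha\beta}$. The *modified Einstein equations* on $T^*V$ are, by definition, $$R_{\alpha\beta}[D]=\Upsilon_{\alpha\beta}.\qquad(*)$$ **Theorem.** 1. *(N-adapted form.)* $(*)$ is equivalent to the system, in all N-adapted frames, $$R^i{}_{hji}=\Upsilon_{hj},\qquad -R^i{}_{ji}{}^{a}=\Upsilon_j{}^a,\qquad R_a{}^b{}_k{}^a=\Upsilon^b{}_k,\qquad R_a{}^{bca}=\Upsilon^{bc},$$ where the sums run over the horizontal index $i$ and the covertical index $a$ respectively, and a covertical index stands for the corresponding frame vector $e^a$. 2. *(Canonical Hamilton d-connection and Levi-Civita connection.)* There is exactly one linear connection $\hat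 D$ on $T^*V$ with $\hat D_{e_k}e_j=L^i_{jk}e_i$, $\hat D_{e_k}e^b=L_a{}^b{}_k\,e^a$, $\hat D_{e^c}e_j=C^i{}_j{}^c\,e_i$, $\hat D_{e^c}e^b=C_a{}^{bc}\,e^a$ in every N-adapted frame, where $$L^i_{jk}=\tfrac12 g^{ir}(e_kg_{jr}+e_jg_{kr}-e_rg_{jk}),\qquad L_a{}^b{}_k=e^b(N_{ka})+\tfrac12 g_{ac}\big(e_kg^{bc}-g^{dc}e^b(N_{kd})-g^{db}e^c(N_{kd})\big),$$ $$C^i{}_j{}^c=\tfrac12 g^{ik}e^cg_{jk},\qquad C_a{}^{bc}=\tfrac12 g_{ad}(e^cg^{bd}+e^bg^{cd}-e^dg^{bc}).$$ It is a smooth d-connection, $\hat Dg=0$, and its purely horizontal and purely covertical torsions vanish: $T^i{}_{jk}=0$, $T_a{}^{bc}=0$. There is exactly one Levi-Civita connection $\nabla$ ($\nabla g=0$, zero torsion), and it is smooth. 3. *(Canonical form of the equations.)* There are unique type $(1,2)$ tensors $Z,\hat Z$ with $\hat D_XY=D_XY+Z(X,Y)$ and $\hat D_XY=\nabla_XY+\hat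 Z(X,Y)$, and they are smooth. One has $\mathrm{Ric}[\hat D]=\mathrm{Ric}[D]+\mathrm{Zic}[D,Z]$ and $\mathrm{Ric}[\hat D]=\mathrm{Ric}[\nabla]+\mathrm{Zic}[\nabla,\hat Z]$, where, for a connection $D$ with torsion $\mathcal T$, $\mathrm{Zic}[D,Z](y,z)$ is the trace of $x\mapsto \mathcal K(x,z)y$ with $$\mathcal K(X,Y)W=(D_XZ)(Y,W)-(D_YZ)(X,W)+Z(\mathcal T(X,Y),W)+Z(X,Z(Y,W))-Z(Y,Z(X,W)).$$ Consequently $(*)$ is equivalent to $R_{\alpha\beta}[\hat D]=\hat\Upsilon_{\alpha\beta}$ with the redefined source $\hat\Upsilon_{\alpha\beta}:=\Upsilon_{\alpha\beta}+\mathrm{Zic}_{\alpha\beta}[D,Z]$. 4. *(Extraction of Levi-Civita configurations.)* The following are equivalent: (i) the torsion of $\hat D$ vanishes; (ii) $C^i{}_j{}^b=0$, $\Omega_{ija}=0$ and $L_c{}^a{}_j=e^a(N_{jc})$ in all N-adapted frames; (iii) $\hat Z=0$; (iv) $\hat D=\nabla$. If they hold, $(*)$ is equivalent to $R_{\alpha\beta}[\nabla]=\hat\Upsilon_{\alpha\beta}$.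 -/

import Mathlib

open Bundle
open scoped Manifold ContDiff

noncomputable section

/-! ## The phase space `T*V` over a four-dimensional manifold `V` -/

/-- Model space of the four-dimensional spacetime `V`. -/
abbrev BaseModel : Type := EuclideanSpace ℝ (Fin 4)

/-- Model space of the fibres of `T*V`. -/
abbrev FibreModel : Type := BaseModel →L[ℝ] ℝ

/-- Model space of the eight-dimensional manifold `T*V`. -/
abbrev PhaseModel : Type := BaseModel × FibreModel

/-- The (boundaryless) model with corners of `T*V`. -/
abbrev PhaseI : ModelWithCorners ℝ PhaseModel (ModelProd BaseModel FibreModel) :=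
  (𝓡 4).prod 𝓘(ℝ, FibreModel)

/-- The total space `T*V` of the cotangent bundle, with Mathlib's manifold structure on the total
space of the bundle of linear forms on the tangent spaces of `V`. -/
abbrev Cotangent (V : Type*) [TopologicalSpace V] [ChartedSpace BaseModel V]
    [IsManifold (𝓡 4) ∞ V] : Type _ :=
  TotalSpace FibreModel (fun x : V => TangentSpace (𝓡 4) x →L[ℝ] ℝ)

variable {V : Type*} [TopologicalSpace V] [ChartedSpace BaseModel V] [IsManifold (𝓡 4) ∞ V]

/-- The tangent space `T_u(T*V)`. -/
abbrev PhaseTangent (u : Cotangent V) : Type := TangentSpace PhaseI u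

/-- Vector fields on `T*V` (smoothness is always required separately). -/
abbrev PhaseField (V : Type*) [TopologicalSpace V] [ChartedSpace BaseModel V]
    [IsManifold (𝓡 4) ∞ V] : Type _ :=
  (u : Cotangent V) → PhaseTangent u

/-- Fields of bilinear forms on `T*V`, i.e. tensor fields of type (0,2). -/
abbrev BilinField (V : Type*) [TopologicalSpace V] [ChartedSpace BaseModel V]
    [IsManifold (𝓡 4) ∞ V] : Type _ :=
  (u : Cotangent V) → PhaseTangent u →L[ℝ] PhaseTangent u →L[ℝ] ℝ

/-- Fields of vector-valued bilinear maps on `T*V`, i.e. tensor fields of type (1,2). -/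
abbrev DistField (V : Type*) [TopologicalSpace V] [ChartedSpace BaseModel V]
    [IsManifold (𝓡 4) ∞ V] : Type _ :=
  (u : Cotangent V) → PhaseTangent u →L[ℝ] PhaseTangent u →L[ℝ] PhaseTangent u

/-- Directional derivative `v(f)` of a function on `T*V` along a tangent vector at `u`. -/
def dirDeriv (f : Cotangent V → ℝ) {u : Cotangent V} (v : PhaseTangent u) : ℝ :=
  mvfderiv PhaseI f u v

/-! ## Natural coordinates `(x^i, p_a)`

For `u₀ : T*V` the preferred chart at `u₀` is the natural bundle chart `(x^i, p_a)` induced by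
the preferred chart of `V` at `π u₀`.  Index `Sum.inl i` stands for `i`, index `Sum.inr a` for `a`. -/

/-- Horizontal and covertical indices. -/
abbrev PhaseIndex : Type := Fin 4 ⊕ Fin 4

/-- Domain of the natural chart at `u₀`. -/
def coordDomain (u₀ : Cotangent V) : Set (Cotangent V) :=
  (chartAt (ModelProd BaseModel FibreModel) u₀).source

/-- Coordinate vector fields `∂/∂x^i`, `∂/∂p_a` of the chart at `u₀`. -/
def coordFrame (u₀ : Cotangent V) (α : PhaseIndex) : PhaseField V := fun u =>
  (trivializationAt PhaseModel (fun u : Cotangent V => PhaseTangent u) u₀).symm u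
    (Sum.elim (fun i => ((EuclideanSpace.single i (1 : ℝ), 0) : PhaseModel))
      (fun a => ((0, EuclideanSpace.proj a) : PhaseModel)) α)

/-- Coordinate differentials `dx^i`, `dp_a` of the chart at `u₀`. -/
def coordCoframe (u₀ : Cotangent V) (α : PhaseIndex) {u : Cotangent V} (v : PhaseTangent u) : ℝ :=
  let w : PhaseModel := (trivializationAt PhaseModel
    (fun u : Cotangent V => PhaseTangent u) u₀).continuousLinearMapAt ℝ u v
  Sum.elim (fun i => w.1 i) (fun a => w.2 (EuclideanSpace.single a (1 : ℝ))) α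

/-- Smoothness of a tensor field of type (0,2): its components in natural charts are smooth. -/
def BilinField.Smooth (T : BilinField V) : Prop :=
  ∀ (u₀ : Cotangent V) (α β : PhaseIndex), ContMDiffOn PhaseI 𝓘(ℝ, ℝ) ∞
    (fun u : Cotangent V => T u (coordFrame u₀ α u) (coordFrame u₀ β u)) (coordDomain u₀)

/-- Smoothness of a tensor field of type (1,2): its components in natural charts are smooth. -/
def DistField.Smooth (Z : DistField V) : Prop :=
  ∀ (u₀ : Cotangent V) (α β γ : PhaseIndex), ContMDiffOn PhaseI 𝓘(ℝ, ℝ) ∞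
    (fun u : Cotangent V => coordCoframe u₀ γ (Z u (coordFrame u₀ α u) (coordFrame u₀ β u)))
    (coordDomain u₀)

/-! ## N-connections and d-metrics -/

/-- A nonlinear connection on `T*V`: a smooth splitting `T(T*V) = h ⊕ cv`, where `cv` is the
vertical bundle (the kernel of the differential of `π : T*V → V`).  It is given by the smooth field
of projections `hor` onto the horizontal subbundle along the vertical one. -/
structure NConnection (V : Type*) [TopologicalSpace V] [ChartedSpace BaseModel V]
    [IsManifold (𝓡 4) ∞ V] where
  hor : (u : Cotangent V) → PhaseTangent u →L[ℝ] PhaseTangent u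
  idem : ∀ u v, hor u (hor u v) = hor u v
  ker_iff : ∀ u v, hor u v = 0 ↔
    mfderiv PhaseI (𝓡 4) (fun w : Cotangent V => w.proj) u v = 0
  smooth : ContMDiff PhaseI (PhaseI.prod 𝓘(ℝ, PhaseModel →L[ℝ] PhaseModel)) ∞
    (fun u : Cotangent V => TotalSpace.mk' (PhaseModel →L[ℝ] PhaseModel)
      (E := fun u : Cotangent V => PhaseTangent u →L[ℝ] PhaseTangent u) u (hor u))

/-- Covertical projection. -/
def NConnection.ver (N : NConnection V) (u : Cotangent V) : PhaseTangent u →L[ℝ] PhaseTangent u :=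
  ContinuousLinearMap.id ℝ (PhaseTangent u) - N.hor u

/-- Almost product structure `P`, equal to `1` on `h` and to `-1` on `cv`. -/
def NConnection.almostProduct (N : NConnection V) (u : Cotangent V) :
    PhaseTangent u →L[ℝ] PhaseTangent u :=
  N.hor u - N.ver u

/-- The Minkowski matrix `diag(1,1,1,-1)`. -/
def minkowski : Matrix (Fin 4) (Fin 4) ℝ := Matrix.diagonal ![1, 1, 1, -1]

/-- A d-metric on `(T*V, N)`: a smooth pseudo-Riemannian metric for which `h` and `cv` are
orthogonal, of signature `(+,+,+,-)` on `h` and on `cv` (so it is nondegenerate, of total signature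
`(+,+,+,-;+,+,+,-)`). -/
structure DMetric (N : NConnection V) where
  val : BilinField V
  smooth : val.Smooth
  symm : ∀ u v w, val u v w = val u w v
  block : ∀ u v w, val u (N.hor u v) (N.ver u w) = 0
  sig_hor : ∀ u, ∃ e : Fin 4 → PhaseTangent u, (∀ i, N.hor u (e i) = e i) ∧
    ∀ i j, val u (e i) (e j) = minkowski i j
  sig_ver : ∀ u, ∃ e : Fin 4 → PhaseTangent u, (∀ a, N.ver u (e a) = e a) ∧
    ∀ a b, val u (e a) (e b) = minkowski a b

/-! ## N-adapted frames -/

/-- Coefficients `N_{ia}` of the N-connection: the covertical part of `∂/∂x^i` is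
`∑_a N_{ia} ∂/∂p_a`. -/
def NConnection.coeff (N : NConnection V) (u₀ : Cotangent V) (i a : Fin 4) (u : Cotangent V) : ℝ :=
  coordCoframe u₀ (Sum.inr a) (N.ver u (coordFrame u₀ (Sum.inl i) u))

/-- N-adapted frame `e_i = ∂/∂x^i - N_{ia} ∂/∂p_a`, `e^a = ∂/∂p_a`. -/
def NConnection.frame (N : NConnection V) (u₀ : Cotangent V) (α : PhaseIndex) : PhaseField V :=
  fun u => Sum.elim
    (fun i => coordFrame u₀ (Sum.inl i) u
      - ∑ a, N.coeff u₀ i a u • coordFrame u₀ (Sum.inr a) u)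
    (fun a => coordFrame u₀ (Sum.inr a) u) α

/-- N-adapted coframe `e^i = dx^i`, `e_a = dp_a + N_{ia} dx^i`. -/
def NConnection.coframe (N : NConnection V) (u₀ : Cotangent V) (α : PhaseIndex) {u : Cotangent V}
    (v : PhaseTangent u) : ℝ :=
  Sum.elim (fun i => coordCoframe u₀ (Sum.inl i) v)
    (fun a => coordCoframe u₀ (Sum.inr a) v
      + ∑ i, N.coeff u₀ i a u * coordCoframe u₀ (Sum.inl i) v) α

/-- Curvature of the N-connection,
`Ω_{ija} = ∂N_{ia}/∂x^j - ∂N_{ja}/∂x^i + N_{ib} ∂N_{ja}/∂p_b - N_{jb} ∂N_{ia}/∂p_b`. -/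
def NConnection.omega (N : NConnection V) (u₀ : Cotangent V) (i j a : Fin 4)
    (u : Cotangent V) : ℝ :=
  dirDeriv (N.coeff u₀ i a) (coordFrame u₀ (Sum.inl j) u)
    - dirDeriv (N.coeff u₀ j a) (coordFrame u₀ (Sum.inl i) u)
    + ∑ b, N.coeff u₀ i b u * dirDeriv (N.coeff u₀ j a) (coordFrame u₀ (Sum.inr b) u)
    - ∑ b, N.coeff u₀ j b u * dirDeriv (N.coeff u₀ i a) (coordFrame u₀ (Sum.inr b) u)

/-! ## Linear connections, d-connections, curvature, Ricci d-tensor -/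

/-- Linear connections on `T*V`; `D Y u x` is `(D_x Y)(u)`. -/
abbrev PhaseConnection (V : Type*) [TopologicalSpace V] [ChartedSpace BaseModel V]
    [IsManifold (𝓡 4) ∞ V] : Type _ :=
  CovariantDerivative PhaseI PhaseModel (fun u : Cotangent V => PhaseTangent u)

/-- `Y` is differentiable at `u`. -/
def DiffAt (Y : PhaseField V) (u : Cotangent V) : Prop :=
  MDifferentiableAt PhaseI (PhaseI.prod 𝓘(ℝ, PhaseModel))
    (fun w : Cotangent V => TotalSpace.mk' PhaseModel
      (E := fun u : Cotangent V => PhaseTangent u) w (Y w)) u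

namespace PhaseConnection

/-- Smooth connections. -/
def Smooth (D : PhaseConnection V) : Prop :=
  ContMDiffCovariantDerivativeOn PhaseModel ∞ D.toFun Set.univ

/-- Two connections agree: they have the same values on differentiable vector fields (the values
on other fields carry no meaning). -/
def Agree (D D' : PhaseConnection V) : Prop :=
  ∀ (Y : PhaseField V) (u : Cotangent V), DiffAt Y u → D Y u = D' Y u

/-- d-connections: `DP = 0`, i.e. `D_x (P Y) = P (D_x Y)`. -/
def IsDConnection (N : NConnection V) (D : PhaseConnection V) : Prop :=
  ∀ (Y : PhaseField V) (u : Cotangent V), DiffAt Y u → ∀ x : PhaseTangent u,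
    D (fun w => N.almostProduct w (Y w)) u x = N.almostProduct u (D Y u x)

/-- Metric compatibility `Dg = 0`. -/
def IsMetric (g : BilinField V) (D : PhaseConnection V) : Prop :=
  ∀ (Y W : PhaseField V) (u : Cotangent V), DiffAt Y u → DiffAt W u → ∀ x : PhaseTangent u,
    dirDeriv (fun w => g w (Y w) (W w)) x = g u (D Y u x) (W u) + g u (Y u) (D W u x)

/-- The Levi-Civita conditions: metric compatibility and zero torsion. -/
def IsLeviCivita (g : BilinField V) (D : PhaseConnection V) : Prop :=
  D.IsMetric g ∧ CovariantDerivative.torsion D = 0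

/-- Curvature `R(X,Y)W = D_X D_Y W - D_Y D_X W - D_{[X,Y]} W`. -/
def curv (D : PhaseConnection V) (X Y W : PhaseField V) (u : Cotangent V) : PhaseTangent u :=
  D (fun w => D W w (Y w)) u (X u) - D (fun w => D W w (X w)) u (Y u)
    - D W u (VectorField.mlieBracket PhaseI X Y u)

/-- N-adapted curvature coefficients: `R(e_δ, e_γ) e_β = R^α_{βγδ} e_α`. -/
def curvCoeff (N : NConnection V) (D : PhaseConnection V) (u₀ u : Cotangent V)
    (α β γ δ : PhaseIndex) : ℝ :=
  N.coframe u₀ α (D.curv (N.frame u₀ δ) (N.frame u₀ γ) (N.frame u₀ β) u)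

end PhaseConnection

/-- The vector field around `u` that extends `v` with constant components in the natural chart
at `u`. -/
def extendVec {u : Cotangent V} (v : PhaseTangent u) : PhaseField V :=
  FiberBundle.extend PhaseModel (E := fun u : Cotangent V => PhaseTangent u) v

namespace PhaseConnection

/-- Ricci d-tensor `R_{αβ} = R^τ_{αβτ}`, that is, `Ric(y,z)` is the trace of `x ↦ R(x,z)y`. -/
def ricci (D : PhaseConnection V) (u : Cotangent V) (y z : PhaseTangent u) : ℝ :=
  ∑ τ, coordCoframe u τ (D.curv (coordFrame u τ) (extendVec z) (extendVec y) u)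

/-- `Dhat = D + Z`, i.e. `Dhat_x Y = D_x Y + Z(x, Y)`; `Z u y x` stands for `Z(x, y)`, the
differentiated vector being the first argument. -/
def IsDistortion (D Dhat : PhaseConnection V) (Z : DistField V) : Prop :=
  ∀ (Y : PhaseField V) (u : Cotangent V), DiffAt Y u → ∀ x : PhaseTangent u,
    Dhat Y u x = D Y u x + Z u (Y u) x

/-- Covariant derivative of a distortion tensor,
`(D_X Z)(Y,W) = D_X (Z(Y,W)) - Z(D_X Y, W) - Z(Y, D_X W)`. -/
def covDist (D : PhaseConnection V) (Z : DistField V) (X Y W : PhaseField V) (u : Cotangent V) :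
    PhaseTangent u :=
  D (fun w => Z w (W w) (Y w)) u (X u) - Z u (W u) (D Y u (X u)) - Z u (D W u (X u)) (Y u)

/-- Distortion of the curvature,
`(D_X Z)(Y,W) - (D_Y Z)(X,W) + Z(T(X,Y),W) + Z(X,Z(Y,W)) - Z(Y,Z(X,W))`,
with `T` the torsion of `D`. -/
def curvDistortion (D : PhaseConnection V) (Z : DistField V) (X Y W : PhaseField V)
    (u : Cotangent V) : PhaseTangent u :=
  D.covDist Z X Y W u - D.covDist Z Y X W u
    + Z u (W u) (CovariantDerivative.torsion D u (X u) (Y u))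
    + Z u (Z u (W u) (Y u)) (X u) - Z u (Z u (W u) (X u)) (Y u)

/-- Distortion `Zic[D, Z]` of the Ricci tensor: the same contraction of `curvDistortion` as the one
that defines the Ricci tensor from the curvature. -/
def ricciDistortion (D : PhaseConnection V) (Z : DistField V) (u : Cotangent V)
    (y z : PhaseTangent u) : ℝ :=
  ∑ τ, coordCoframe u τ (D.curvDistortion Z (coordFrame u τ) (extendVec z) (extendVec y) u)

end PhaseConnection

/-! ## Effective sources and the modified Einstein equations -/

/-- Trace `g^{αβ} T_{αβ}`. -/
def metricTrace (g T : BilinField V) (u : Cotangent V) : ℝ :=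
  ∑ α, ∑ β, (Matrix.of fun α β : PhaseIndex =>
      g u (coordFrame u α u) (coordFrame u β u))⁻¹ α β * T u (coordFrame u α u) (coordFrame u β u)

/-- Effective source `Υ_{αβ} = ϰ (T_{αβ} - ½ g_{αβ} T)` of the total energy-momentum d-tensor
`T_{αβ}`, with `T = g^{αβ} T_{αβ}`. -/
def effectiveSource (κ : ℝ) (g T : BilinField V) (u : Cotangent V) (y z : PhaseTangent u) : ℝ :=
  κ * (T u y z - 1 / 2 * g u y z * metricTrace g T u)

/-- The equations `R_{αβ}[D] = Υ_{αβ}` on `T*V`. -/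
def ModifiedEinstein (D : PhaseConnection V)
    (Υ : (u : Cotangent V) → PhaseTangent u → PhaseTangent u → ℝ) : Prop :=
  ∀ (u : Cotangent V) (y z : PhaseTangent u), D.ricci u y z = Υ u y z

/-- The equations in N-adapted frames, block by block:
`R_{hj} = R^i_{hji}`, `R_j^a = -P^i_{ji}^a`, `R^b_k = P_a^b_k^a`, `R^{bc} = S_a^{bca}`. -/
def NAdaptedEinstein (N : NConnection V) (D : PhaseConnection V)
    (Υ : (u : Cotangent V) → PhaseTangent u → PhaseTangent u → ℝ) : Prop :=
  ∀ u₀ : Cotangent V, ∀ u ∈ coordDomain u₀,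
    (∀ h j : Fin 4, ∑ i : Fin 4, D.curvCoeff N u₀ u (.inl i) (.inl h) (.inl j) (.inl i)
      = Υ u (N.frame u₀ (.inl h) u) (N.frame u₀ (.inl j) u)) ∧
    (∀ j a : Fin 4, -∑ i : Fin 4, D.curvCoeff N u₀ u (.inl i) (.inl j) (.inl i) (.inr a)
      = Υ u (N.frame u₀ (.inl j) u) (N.frame u₀ (.inr a) u)) ∧
    (∀ b k : Fin 4, ∑ a : Fin 4, D.curvCoeff N u₀ u (.inr a) (.inr b) (.inl k) (.inr a)
      = Υ u (N.frame u₀ (.inr b) u) (N.frame u₀ (.inl k) u)) ∧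
    (∀ b c : Fin 4, ∑ a : Fin 4, D.curvCoeff N u₀ u (.inr a) (.inr b) (.inr c) (.inr a)
      = Υ u (N.frame u₀ (.inr b) u) (N.frame u₀ (.inr c) u))

/-! ## The canonical Hamilton d-connection -/

namespace DMetric

variable {N : NConnection V}

/-- `g_{ij}`. -/
def gh (g : DMetric N) (u₀ : Cotangent V) (i j : Fin 4) (u : Cotangent V) : ℝ :=
  g.val u (N.frame u₀ (.inl i) u) (N.frame u₀ (.inl j) u)

/-- `g^{ij}`, the inverse of `g_{ij}`. -/
def ghInv (g : DMetric N) (u₀ : Cotangent V) (i j : Fin 4) (u : Cotangent V) : ℝ :=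
  (Matrix.of fun i j => g.gh u₀ i j u)⁻¹ i j

/-- `g^{ab}`, the covertical coefficients. -/
def gv (g : DMetric N) (u₀ : Cotangent V) (a b : Fin 4) (u : Cotangent V) : ℝ :=
  g.val u (N.frame u₀ (.inr a) u) (N.frame u₀ (.inr b) u)

/-- `g_{ab}`, the inverse of `g^{ab}`. -/
def gvInv (g : DMetric N) (u₀ : Cotangent V) (a b : Fin 4) (u : Cotangent V) : ℝ :=
  (Matrix.of fun a b => g.gv u₀ a b u)⁻¹ a b

/-- `L^i_{jk} = ½ g^{ir} (e_k g_{jr} + e_j g_{kr} - e_r g_{jk})`. -/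
def Lh (g : DMetric N) (u₀ : Cotangent V) (i j k : Fin 4) (u : Cotangent V) : ℝ :=
  1 / 2 * ∑ r, g.ghInv u₀ i r u *
    (dirDeriv (g.gh u₀ j r) (N.frame u₀ (.inl k) u)
      + dirDeriv (g.gh u₀ k r) (N.frame u₀ (.inl j) u)
      - dirDeriv (g.gh u₀ j k) (N.frame u₀ (.inl r) u))

/-- `L_a^b_k = e^b(N_{ka}) + ½ g_{ac} (e_k g^{bc} - g^{dc} e^b(N_{kd}) - g^{db} e^c(N_{kd}))`. -/
def Lv (g : DMetric N) (u₀ : Cotangent V) (a b k : Fin 4) (u : Cotangent V) : ℝ :=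
  dirDeriv (N.coeff u₀ k a) (N.frame u₀ (.inr b) u)
    + 1 / 2 * ∑ c, g.gvInv u₀ a c u *
      (dirDeriv (g.gv u₀ b c) (N.frame u₀ (.inl k) u)
        - ∑ d, g.gv u₀ d c u * dirDeriv (N.coeff u₀ k d) (N.frame u₀ (.inr b) u)
        - ∑ d, g.gv u₀ d b u * dirDeriv (N.coeff u₀ k d) (N.frame u₀ (.inr c) u))

/-- `C^i_j^c = ½ g^{ik} e^c g_{jk}`. -/
def Ch (g : DMetric N) (u₀ : Cotangent V) (i j c : Fin 4) (u : Cotangent V) : ℝ :=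
  1 / 2 * ∑ k, g.ghInv u₀ i k u * dirDeriv (g.gh u₀ j k) (N.frame u₀ (.inr c) u)

/-- `C_a^{bc} = ½ g_{ad} (e^c g^{bd} + e^b g^{cd} - e^d g^{bc})`. -/
def Cv (g : DMetric N) (u₀ : Cotangent V) (a b c : Fin 4) (u : Cotangent V) : ℝ :=
  1 / 2 * ∑ d, g.gvInv u₀ a d u *
    (dirDeriv (g.gv u₀ b d) (N.frame u₀ (.inr c) u)
      + dirDeriv (g.gv u₀ c d) (N.frame u₀ (.inr b) u)
      - dirDeriv (g.gv u₀ b c) (N.frame u₀ (.inr d) u))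

/-- `D` is the canonical Hamilton d-connection of `(N, g)`: in every N-adapted frame
`D_{e_k} e_j = L^i_{jk} e_i`, `D_{e_k} e^b = L_a^b_k e^a`, `D_{e^c} e_j = C^i_j^c e_i`,
`D_{e^c} e^b = C_a^{bc} e^a`. -/
def IsCanonical (g : DMetric N) (D : PhaseConnection V) : Prop :=
  ∀ u₀ : Cotangent V, ∀ u ∈ coordDomain u₀,
    (∀ j k : Fin 4, D (N.frame u₀ (.inl j)) u (N.frame u₀ (.inl k) u)
      = ∑ i, g.Lh u₀ i j k u • N.frame u₀ (.inl i) u) ∧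
    (∀ b k : Fin 4, D (N.frame u₀ (.inr b)) u (N.frame u₀ (.inl k) u)
      = ∑ a, g.Lv u₀ a b k u • N.frame u₀ (.inr a) u) ∧
    (∀ j c : Fin 4, D (N.frame u₀ (.inl j)) u (N.frame u₀ (.inr c) u)
      = ∑ i, g.Ch u₀ i j c u • N.frame u₀ (.inl i) u) ∧
    (∀ b c : Fin 4, D (N.frame u₀ (.inr b)) u (N.frame u₀ (.inr c) u)
      = ∑ a, g.Cv u₀ a b c u • N.frame u₀ (.inr a) u)

/-- The conditions `C^i_j^b = 0`, `Ω_{ija} = 0`, `L_c^a_j = e^a(N_{jc})` in all N-adapted frames. -/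
def LCConditions (g : DMetric N) : Prop :=
  ∀ u₀ : Cotangent V, ∀ u ∈ coordDomain u₀,
    (∀ i j b : Fin 4, g.Ch u₀ i j b u = 0) ∧
    (∀ i j a : Fin 4, N.omega u₀ i j a u = 0) ∧
    (∀ c a j : Fin 4, g.Lv u₀ c a j u = dirDeriv (N.coeff u₀ j c) (N.frame u₀ (.inr a) u))

end DMetric

/-- The purely horizontal torsion vanishes: `T^i_{jk} = 0`. -/
def PhaseConnection.HorTorsionFree (N : NConnection V) (D : PhaseConnection V) : Prop :=
  ∀ (u : Cotangent V) (x y : PhaseTangent u),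
    N.hor u (CovariantDerivative.torsion D u (N.hor u x) (N.hor u y)) = 0

/-- The purely covertical torsion vanishes: `T_a^{bc} = 0`. -/
def PhaseConnection.VerTorsionFree (N : NConnection V) (D : PhaseConnection V) : Prop :=
  ∀ (u : Cotangent V) (x y : PhaseTangent u),
    N.ver u (CovariantDerivative.torsion D u (N.ver u x) (N.ver u y)) = 0

end

/-!
# Modified Einstein equations on the cotangent bundle

Everything except the coordinate formulas is done without indices, on an arbitrary manifold `M`.

*Levi-Civita connection.* Koszul's expression is tensorial in two of its arguments, so a smooth
nondegenerate symmetric form determines `∇` by `2 g(∇_X Y, W) = koszul g X Y W`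
(`IsPseudoMetric.leviCivita`), and a metric torsion-free connection satisfies the same formula
(`IsPseudoMetric.eq_leviCivita`).

*Canonical d-connection.* Let `h` be the projection onto the first summand of an orthogonal
splitting and `v = 1 - h`. The connection `D_X Y = h ∇_X (hY) + v ∇_X (vY) + S(X, Y)`, with the
tensor `S` given by `2 g(S(X, Y), W) = g(vX, v[hY, hW])`, preserves the splitting and the metric and
has no torsion inside either summand (`IsBlockMetric.adaptedConnection`). Without `S`, the vertical
derivatives of horizontal fields would contain the curvature `Ω` of the splitting; the term `S`
removes it. The scalar products `g(D_{e_β} e_α, e_γ)` are then read off from Koszul's formula and the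
brackets `[e_i, e_j] = Ω_{ija} e^a`, `[e_i, e^b] = e^b(N_{ia}) e^a`, `[e^a, e^b] = 0`. Solving with the
inverse Gram matrices, which exist by the signature conditions, gives the coefficients `L` and `C`
(`isCanonical_canonicalConnection`). A connection is determined by its values on a frame
(`IsFrame.cov_eq`), so any connection with these coefficients has the same properties.

*Field equations.* The curvature of a smooth connection is a tensor (`curvature_pointwise`), hence
the Ricci tensor is a bilinear form whose trace may be taken in an N-adapted frame
(`IsFrame.trace_eq`). A d-connection preserves `h` and `cv`, so only one summand contributes to the
trace (`ricci_frame_inl`, `ricci_frame_inr`); this is the N-adapted form of the equations. The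
difference of two connections is a tensor, and expanding the curvature of `D + Z` gives the
distortion of the Ricci tensor (`curvature_add_tensor`).

*Zero torsion.* In an N-adapted frame the torsion of the canonical d-connection has the components
`-Ω_{ija}`, `-C^i_k^b` and `L_a^b_k - e^b(N_{ka})` only (`IsCanonical.torsion_eq_zero_iff`), and as the
connection is metric it is torsion-free if and only if it is the Levi-Civita connection.
-/

open Topology Filter VectorField

noncomputable section

namespace PhaseGeometry

/-! ### Smooth functions and vector fields near a point -/

section Smooth

variable {E : Type*} [NormedAddCommGroup E] [NormedSpace ℝ E]
  {H : Type*} [TopologicalSpace H] {I : ModelWithCorners ℝ E H}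
  {M : Type*} [TopologicalSpace M] [ChartedSpace H M]

variable (I) in
/-- The function `f` is smooth on some neighbourhood of `x`. -/
def SmoothFunNear (f : M → ℝ) (x : M) : Prop :=
  ∀ᶠ w in 𝓝 x, ContMDiffAt I 𝓘(ℝ, ℝ) ∞ f w

/-- The vector field `X` is smooth on some neighbourhood of `x`. -/
def SmoothVecNear [IsManifold I 1 M] (X : (x : M) → TangentSpace I x) (x : M) : Prop :=
  ∀ᶠ w in 𝓝 x, ContMDiffAt I (I.prod 𝓘(ℝ, E)) ∞
    (fun y => TotalSpace.mk' E (E := (TangentSpace I : M → Type _)) y (X y)) w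

namespace SmoothFunNear

variable {f f' : M → ℝ} {x : M}

lemma contMDiffAt (h : SmoothFunNear I f x) : ContMDiffAt I 𝓘(ℝ, ℝ) ∞ f x := h.self_of_nhds

lemma mdifferentiableAt (h : SmoothFunNear I f x) : MDifferentiableAt I 𝓘(ℝ, ℝ) f x :=
  h.contMDiffAt.mdifferentiableAt (by simp)

lemma congr (h : SmoothFunNear I f x) (hf : ∀ᶠ w in 𝓝 x, f' w = f w) : SmoothFunNear I f' x := by
  filter_upwards [h, eventually_eventually_nhds.2 hf] with w hw hw'
  exact hw.congr_of_eventuallyEq hw'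

lemma const (c : ℝ) : SmoothFunNear I (fun _ : M => c) x :=
  Eventually.of_forall fun _ => contMDiffAt_const

lemma add (h : SmoothFunNear I f x) (h' : SmoothFunNear I f' x) :
    SmoothFunNear I (fun w => f w + f' w) x := by
  filter_upwards [h, h'] with w hw hw' using hw.add hw'

lemma sub (h : SmoothFunNear I f x) (h' : SmoothFunNear I f' x) :
    SmoothFunNear I (fun w => f w - f' w) x := by
  filter_upwards [h, h'] with w hw hw' using hw.sub hw'

lemma mul (h : SmoothFunNear I f x) (h' : SmoothFunNear I f' x) :
    SmoothFunNear I (fun w => f w * f' w) x := by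
  filter_upwards [h, h'] with w hw hw' using hw.mul hw'

lemma sum {ι : Type*} {s : Finset ι} {f : ι → M → ℝ} (h : ∀ i ∈ s, SmoothFunNear I (f i) x) :
    SmoothFunNear I (fun w => ∑ i ∈ s, f i w) x := by
  classical
  induction s using Finset.induction_on with
  | empty => simpa using const 0
  | insert a s ha ih =>
    simp only [Finset.sum_insert ha]
    exact (h a (by simp)).add (ih fun i hi => h i (by simp [hi]))

lemma prod {ι : Type*} {s : Finset ι} {f : ι → M → ℝ} (h : ∀ i ∈ s, SmoothFunNear I (f i) x) :
    SmoothFunNear I (fun w => ∏ i ∈ s, f i w) x := by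
  classical
  induction s using Finset.induction_on with
  | empty => simpa using const 1
  | insert a s ha ih =>
    simp only [Finset.prod_insert ha]
    exact (h a (by simp)).mul (ih fun i hi => h i (by simp [hi]))

lemma inv (h : SmoothFunNear I f x) (h0 : f x ≠ 0) : SmoothFunNear I (fun w => (f w)⁻¹) x := by
  filter_upwards [h, h.contMDiffAt.continuousAt.eventually_ne h0] with w hw hw0
  exact hw.inv₀ hw0

end SmoothFunNear

/-- The entries of the inverse of a smooth invertible matrix are smooth, by Cramer's rule. -/
lemma SmoothFunNear.matrix_inv {ι : Type*} [Fintype ι] [DecidableEq ι]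
    {G : M → Matrix ι ι ℝ} {x : M} (h : ∀ i j, SmoothFunNear I (fun w => G w i j) x)
    (h0 : (G x).det ≠ 0) (i j : ι) : SmoothFunNear I (fun w => (G w)⁻¹ i j) x := by
  have hdet : ∀ {A : M → Matrix ι ι ℝ}, (∀ i j, SmoothFunNear I (fun w => A w i j) x) →
      SmoothFunNear I (fun w => (A w).det) x := by
    intro A hA
    simp only [Matrix.det_apply']
    exact .sum fun σ _ => (SmoothFunNear.const _).mul (.prod fun i _ => hA _ _)
  have hadj : SmoothFunNear I (fun w => (G w).adjugate i j) x := by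
    simp only [Matrix.adjugate_apply]
    refine hdet fun k l => ?_
    by_cases hk : k = j
    · subst hk
      simpa using SmoothFunNear.const _
    · simpa [Matrix.updateRow_ne hk] using h k l
  simp only [Matrix.inv_def, Ring.inverse_eq_inv', Matrix.smul_apply, smul_eq_mul]
  exact ((hdet h).inv h0).mul hadj

namespace SmoothVecNear

variable [IsManifold I ∞ M] {X Y : (x : M) → TangentSpace I x} {f : M → ℝ} {x : M}

lemma eventually (h : SmoothVecNear X x) : ∀ᶠ w in 𝓝 x, SmoothVecNear X w :=
  eventually_eventually_nhds.2 h

lemma contMDiffAt (h : SmoothVecNear X x) : ContMDiffAt I (I.prod 𝓘(ℝ, E)) ∞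
    (fun y => TotalSpace.mk' E (E := (TangentSpace I : M → Type _)) y (X y)) x :=
  h.self_of_nhds

lemma mdifferentiableAt (h : SmoothVecNear X x) : MDifferentiableAt I (I.prod 𝓘(ℝ, E))
    (fun y => TotalSpace.mk' E (E := (TangentSpace I : M → Type _)) y (X y)) x :=
  h.contMDiffAt.mdifferentiableAt (by simp)

lemma congr (h : SmoothVecNear X x) (hf : ∀ᶠ w in 𝓝 x, Y w = X w) : SmoothVecNear Y x := by
  filter_upwards [h, eventually_eventually_nhds.2 hf] with w hw hw'
  refine hw.congr_of_eventuallyEq ?_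
  filter_upwards [hw'] with y hy
  rw [hy]

lemma of_contMDiffOn {s : Set M} (hs : IsOpen s) (hx : x ∈ s)
    (h : ContMDiffOn I (I.prod 𝓘(ℝ, E)) ∞
      (fun y => TotalSpace.mk' E (E := (TangentSpace I : M → Type _)) y (X y)) s) :
    SmoothVecNear X x := by
  filter_upwards [hs.mem_nhds hx] with w hw
  exact h.contMDiffAt (hs.mem_nhds hw)

lemma zero : SmoothVecNear (I := I) (fun _ => 0) x :=
  Eventually.of_forall fun w => (contMDiff_zeroSection ℝ (TangentSpace I : M → Type _)) w

lemma add (h : SmoothVecNear X x) (h' : SmoothVecNear Y x) :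
    SmoothVecNear (fun w => X w + Y w) x := by
  filter_upwards [h, h'] with w hw hw' using hw.add_section hw'

lemma sub (h : SmoothVecNear X x) (h' : SmoothVecNear Y x) :
    SmoothVecNear (fun w => X w - Y w) x := by
  filter_upwards [h, h'] with w hw hw' using hw.sub_section hw'

lemma smul (hf : SmoothFunNear I f x) (h : SmoothVecNear X x) :
    SmoothVecNear (fun w => f w • X w) x := by
  filter_upwards [hf, h] with w hw hw' using hw.smul_section hw'

lemma sum {ι : Type*} {s : Finset ι} {X : ι → (x : M) → TangentSpace I x}
    (h : ∀ i ∈ s, SmoothVecNear (X i) x) : SmoothVecNear (fun w => ∑ i ∈ s, X i w) x := by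
  have : ∀ᶠ w in 𝓝 x, ∀ i ∈ s, ContMDiffAt I (I.prod 𝓘(ℝ, E)) ∞
      (fun y => TotalSpace.mk' E (E := (TangentSpace I : M → Type _)) y (X i y)) w :=
    (eventually_all_finset s).2 h
  filter_upwards [this] with w hw using .sum_section hw

lemma extend (v : TangentSpace I x) :
    SmoothVecNear (FiberBundle.extend E (E := (TangentSpace I : M → Type _)) v) x := by
  obtain ⟨s, hs, h⟩ := FiberBundle.exists_contMDiffOn_extend (k := ∞) I E
    (V := (TangentSpace I : M → Type _)) v
  obtain ⟨t, hts, ht, hx⟩ := mem_nhds_iff.1 hs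
  exact of_contMDiffOn ht hx (h.mono hts)

lemma lieBracket [CompleteSpace E] (h : SmoothVecNear X x) (h' : SmoothVecNear Y x) :
    SmoothVecNear (fun w => mlieBracket I X Y w) x := by
  have : IsManifold I (((⊤ : ℕ∞) : WithTop ℕ∞) + 1) M := ‹IsManifold I ∞ M›
  have : IsManifold I (minSmoothness ℝ 2) M := by
    rw [minSmoothness_of_isRCLikeNormedField]; infer_instance
  filter_upwards [h, h'] with w hw hw'
  exact ContMDiffAt.mlieBracket_vectorField (n := ⊤) (m := ⊤) hw hw' (by
    rw [minSmoothness_of_isRCLikeNormedField]; simp)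

/-- The derivative of a smooth function along a smooth vector field is smooth. -/
lemma mvfderiv (hf : SmoothFunNear I f x) (h : SmoothVecNear X x) :
    SmoothFunNear I (fun w => mvfderiv I f w (X w)) x := by
  filter_upwards [hf, h] with w hw hw'
  have h1 := hw.mfderiv_const (m := ∞) (by simp)
  have h2 := ContMDiffAt.clm_apply_of_inCoordinates (F₁ := E) (E₁ := (TangentSpace I : M → Type _))
    (F₂ := ℝ) (E₂ := (TangentSpace 𝓘(ℝ, ℝ) : ℝ → Type _)) (b₁ := id) (b₂ := f)
    (ϕ := fun m => mfderiv I 𝓘(ℝ, ℝ) f m) (v := X) h1 hw' hw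
  exact (contMDiff_snd_tangentBundle_modelSpace ℝ 𝓘(ℝ, ℝ) _).comp w h2

end SmoothVecNear

end Smooth

/-! ### Smooth frames and tensoriality -/

section Tensorial

variable {E : Type*} [NormedAddCommGroup E] [NormedSpace ℝ E] [FiniteDimensional ℝ E]
  {H : Type*} [TopologicalSpace H] {I : ModelWithCorners ℝ E H}
  {M : Type*} [TopologicalSpace M] [ChartedSpace H M] [IsManifold I ∞ M]

/-- The vector field `X` is differentiable at `x`. -/
abbrev VecDiffAt (X : (x : M) → TangentSpace I x) (x : M) : Prop :=
  MDifferentiableAt I (I.prod 𝓘(ℝ, E))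
    (fun y => TotalSpace.mk' E (E := (TangentSpace I : M → Type _)) y (X y)) x

/-- Around every point there is a smooth frame of vector fields with a smooth dual coframe. -/
lemma exists_smooth_frame (x : M) : ∃ (n : ℕ) (s : Fin n → (x : M) → TangentSpace I x)
    (c : Fin n → (x : M) → TangentSpace I x →ₗ[ℝ] ℝ),
    (∀ i, SmoothVecNear (s i) x) ∧
    (∀ᶠ w in 𝓝 x, (∀ v : TangentSpace I w, v = ∑ i, c i w v • s i w) ∧
      ∀ i j, c i w (s j w) = if i = j then 1 else 0) ∧
    (∀ i Y, SmoothVecNear Y x → SmoothFunNear I (fun w => c i w (Y w)) x) ∧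
    (∀ i Y, VecDiffAt Y x → MDifferentiableAt I 𝓘(ℝ, ℝ) (fun w => c i w (Y w)) x) := by
  set t := trivializationAt E (TangentSpace I : M → Type _) x
  have hx : x ∈ t.baseSet := FiberBundle.mem_baseSet_trivializationAt E _ x
  let b := Module.finBasis ℝ E
  have hev : ∀ᶠ w in 𝓝 x, w ∈ t.baseSet := t.open_baseSet.mem_nhds hx
  refine ⟨_, t.localFrame b, t.localFrameCoeff I b, fun i => ?_, ?_, fun i Y hY => ?_,
    fun i Y hY => ?_⟩
  · filter_upwards [hev] with w hw
    exact contMDiffAt_localFrame_of_mem ∞ _ b i hw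
  · filter_upwards [hev] with w hw
    refine ⟨fun v => ?_, fun i j => ?_⟩
    · simpa using t.eq_sum_localFrameCoeff_smul (I := I) (b := b) (x' := w)
        (s := FiberBundle.extend E (E := (TangentSpace I : M → Type _)) v) hw
    · rw [t.localFrameCoeff_apply_of_mem_baseSet b hw, t.localFrame_apply_of_mem_baseSet b hw]
      simp [Finsupp.single_apply, eq_comm]
  · filter_upwards [hev, hY] with w hw hYw
    exact contMDiffAt_localFrameCoeff b hw hYw i
  · exact mdifferentiableAt_localFrameCoeff b hx hY i

/-- An operation on vector fields is smoothly tensorial at `x` if it is additive and linear over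
germs of smooth functions on fields that are smooth near `x`. -/
structure SmoothTensorialAt {A : Type*} [AddCommGroup A] [Module ℝ A]
    (Φ : ((x : M) → TangentSpace I x) → A) (x : M) : Prop where
  add : ∀ {X Y}, SmoothVecNear X x → SmoothVecNear Y x → Φ (fun w => X w + Y w) = Φ X + Φ Y
  smul : ∀ {f : M → ℝ} {X}, SmoothFunNear I f x → SmoothVecNear X x →
    Φ (fun w => f w • X w) = f x • Φ X

namespace SmoothTensorialAt

variable {A : Type*} [AddCommGroup A] [Module ℝ A]
  {Φ : ((x : M) → TangentSpace I x) → A} {x : M} {X Y : (x : M) → TangentSpace I x}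

omit [FiniteDimensional ℝ E] in
lemma congr (h : SmoothTensorialAt Φ x) (hX : SmoothVecNear X x) (hY : SmoothVecNear Y x)
    (hXY : ∀ᶠ w in 𝓝 x, X w = Y w) : Φ X = Φ Y := by
  classical
  -- multiplying by the indicator function of the set where the fields agree makes them equal
  let ψ : M → ℝ := fun w => if X w = Y w then 1 else 0
  have hψ : SmoothFunNear I ψ x :=
    (SmoothFunNear.const 1).congr (hXY.mono fun w hw => by simp [ψ, hw])
  have hψx : ψ x = 1 := by simp [ψ, hXY.self_of_nhds]
  have : (fun w => ψ w • X w) = fun w => ψ w • Y w := by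
    ext1 w
    by_cases hw : X w = Y w
    · rw [hw]
    · simp [ψ, hw]
  have h1 := h.smul hψ hX
  have h2 := h.smul hψ hY
  rw [this, h2, hψx, one_smul, one_smul] at h1
  exact h1.symm

omit [FiniteDimensional ℝ E] in
lemma zero (h : SmoothTensorialAt Φ x) : Φ (fun _ => 0) = 0 := by
  simpa using h.smul (f := fun _ => 0) (.const 0) (SmoothVecNear.zero (x := x))

omit [FiniteDimensional ℝ E] in
lemma sum (h : SmoothTensorialAt Φ x) {ι : Type*} {s : Finset ι}
    {X : ι → (x : M) → TangentSpace I x} (hX : ∀ i ∈ s, SmoothVecNear (X i) x) :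
    Φ (fun w => ∑ i ∈ s, X i w) = ∑ i ∈ s, Φ (X i) := by
  classical
  induction s using Finset.induction_on with
  | empty => simpa using h.zero
  | insert a s ha ih =>
    simp only [Finset.sum_insert ha]
    rw [h.add (hX a (by simp)) (.sum fun i hi => hX i (by simp [hi])),
      ih fun i hi => hX i (by simp [hi])]

/-- A smoothly tensorial operation depends only on the value of the field at the point. -/
lemma pointwise (h : SmoothTensorialAt Φ x) (hX : SmoothVecNear X x) (hY : SmoothVecNear Y x)
    (hXY : X x = Y x) : Φ X = Φ Y := by
  obtain ⟨n, s, c, hs, hexp, hc, -⟩ := exists_smooth_frame (I := I) x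
  have key : ∀ {Z}, SmoothVecNear Z x → Φ Z = ∑ i, c i x (Z x) • Φ (s i) := by
    intro Z hZ
    rw [h.congr hZ (.sum fun i _ => (hs i).smul (hc i Z hZ)) (hexp.mono fun w hw => hw.1 _),
      h.sum fun i _ => (hs i).smul (hc i Z hZ)]
    exact Finset.sum_congr rfl fun i _ => h.smul (hc i Z hZ) (hs i)
  rw [key hX, key hY, hXY]

end SmoothTensorialAt

/-- A field of endomorphisms that maps smooth fields to smooth fields is a smooth section. -/
lemma contMDiffAt_hom_of_forall {A : (x : M) → TangentSpace I x →L[ℝ] TangentSpace I x} {x : M}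
    (h : ∀ X, SmoothVecNear X x → SmoothVecNear (fun w => A w (X w)) x) :
    ContMDiffAt I (I.prod 𝓘(ℝ, E →L[ℝ] E)) ∞
      (fun w => TotalSpace.mk' (E →L[ℝ] E)
        (E := fun w : M => TangentSpace I w →L[ℝ] TangentSpace I w) w (A w)) x := by
  rw [contMDiffAt_hom_bundle]
  refine ⟨contMDiffAt_id, ?_⟩
  set t := trivializationAt E (TangentSpace I : M → Type _) x
  have hx : x ∈ t.baseSet := FiberBundle.mem_baseSet_trivializationAt E _ x
  let b := Module.finBasis ℝ E
  have hb : ∀ i, ContMDiffAt I 𝓘(ℝ, E) ∞ (fun w => ContinuousLinearMap.inCoordinates E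
      (TangentSpace I : M → Type _) E (TangentSpace I : M → Type _) x w x w (A w) (b i)) x := by
    intro i
    have h1 := (h (t.localFrame b i) (by
      filter_upwards [t.open_baseSet.mem_nhds hx] with w hw
      exact contMDiffAt_localFrame_of_mem ∞ _ b i hw)).contMDiffAt
    rw [contMDiffAt_section] at h1
    refine h1.congr_of_eventuallyEq ?_
    filter_upwards [t.open_baseSet.mem_nhds hx] with w hw
    rw [ContinuousLinearMap.inCoordinates_eq hw hw]
    simp [t.localFrame_apply_of_mem_baseSet b hw, Trivialization.basisAt, t]
  have hsum : ∀ w, ContinuousLinearMap.inCoordinates E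
      (TangentSpace I : M → Type _) E (TangentSpace I : M → Type _) x w x w (A w)
      = ∑ i, ContinuousLinearMap.smulRightL ℝ E E (LinearMap.toContinuousLinearMap (b.coord i))
        (ContinuousLinearMap.inCoordinates E
      (TangentSpace I : M → Type _) E (TangentSpace I : M → Type _) x w x w (A w) (b i)) := by
    intro w
    refine ContinuousLinearMap.coe_injective (b.ext fun j => ?_)
    simp [Finsupp.single_apply]
  refine ContMDiffAt.congr_of_eventuallyEq ?_ (Eventually.of_forall hsum)
  exact .sum fun i _ => (ContinuousLinearMap.contMDiff _).contMDiffAt.comp x (hb i)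

end Tensorial

/-! ### Pseudo-Riemannian metrics and the Levi-Civita connection -/

section LeviCivita

variable {E : Type*} [NormedAddCommGroup E] [NormedSpace ℝ E] [FiniteDimensional ℝ E]
  {H : Type*} [TopologicalSpace H] {I : ModelWithCorners ℝ E H}
  {M : Type*} [TopologicalSpace M] [ChartedSpace H M] [IsManifold I ∞ M]

instance (x : M) : T2Space (TangentSpace I x) := inferInstanceAs (T2Space E)

instance (x : M) : FiniteDimensional ℝ (TangentSpace I x) := inferInstanceAs (FiniteDimensional ℝ E)

/-- A smooth pseudo-Riemannian metric: a smooth field of symmetric nondegenerate bilinear forms.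
Smoothness is expressed by smoothness of the values on smooth vector fields. -/
structure IsPseudoMetric (g : (x : M) → TangentSpace I x →L[ℝ] TangentSpace I x →L[ℝ] ℝ) :
    Prop where
  smooth : ∀ {X Y x}, SmoothVecNear X x → SmoothVecNear Y x →
    SmoothFunNear I (fun w => g w (X w) (Y w)) x
  symm : ∀ x v w, g x v w = g x w v
  nondeg : ∀ x v, (∀ w, g x v w = 0) → v = 0

/-- Koszul's expression `X g(Y,W) + Y g(X,W) - W g(X,Y) + g([X,Y],W) - g([X,W],Y) - g([Y,W],X)`. -/
def koszul (g : (x : M) → TangentSpace I x →L[ℝ] TangentSpace I x →L[ℝ] ℝ)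
    (X Y W : (x : M) → TangentSpace I x) (x : M) : ℝ :=
  mvfderiv I (fun w => g w (Y w) (W w)) x (X x) + mvfderiv I (fun w => g w (X w) (W w)) x (Y x)
    - mvfderiv I (fun w => g w (X w) (Y w)) x (W x)
    + g x (mlieBracket I X Y x) (W x) - g x (mlieBracket I X W x) (Y x)
    - g x (mlieBracket I Y W x) (X x)

namespace IsPseudoMetric

variable {g : (x : M) → TangentSpace I x →L[ℝ] TangentSpace I x →L[ℝ] ℝ}
  {X X' Y Y' W W' : (x : M) → TangentSpace I x} {f : M → ℝ} {x : M}

lemma mdifferentiableAt (hg : IsPseudoMetric g) (hX : VecDiffAt X x) (hY : VecDiffAt Y x) :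
    MDifferentiableAt I 𝓘(ℝ, ℝ) (fun w => g w (X w) (Y w)) x := by
  obtain ⟨n, s, c, hs, hexp, -, hc⟩ := exists_smooth_frame (I := I) x
  have h1 : MDifferentiableAt I 𝓘(ℝ, ℝ)
      (∑ i, ∑ j, fun w => c i w (X w) * (c j w (Y w) * g w (s i w) (s j w))) x := by
    refine .sum fun i _ => .sum fun j _ => (hc i X hX).mul ((hc j Y hY).mul ?_)
    exact (hg.smooth (hs i) (hs j)).mdifferentiableAt
  refine h1.congr_of_eventuallyEq ?_
  filter_upwards [hexp] with w hw
  conv_lhs => rw [hw.1 (X w), hw.1 (Y w)]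
  simp only [Finset.sum_apply, map_sum, sum_apply, map_smul, smul_apply, smul_eq_mul,
    Finset.mul_sum]
  rw [Finset.sum_comm]
  exact Finset.sum_congr rfl fun i _ => Finset.sum_congr rfl fun j _ => by ring

section Koszul

variable [CompleteSpace E] (hg : IsPseudoMetric g)

include hg

lemma koszul_add_left (hX : VecDiffAt X x) (hX' : VecDiffAt X' x) (hY : VecDiffAt Y x)
    (hW : VecDiffAt W x) : koszul g (X + X') Y W x = koszul g X Y W x + koszul g X' Y W x := by
  simp only [koszul, Pi.add_apply, map_add, add_apply,
    mlieBracket_add_left hX hX',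
    mvfderiv_fun_add (hg.mdifferentiableAt hX hW) (hg.mdifferentiableAt hX' hW),
    mvfderiv_fun_add (hg.mdifferentiableAt hX hY) (hg.mdifferentiableAt hX' hY)]
  ring

lemma koszul_smul_left (hf : MDifferentiableAt I 𝓘(ℝ, ℝ) f x) (hX : VecDiffAt X x)
    (hY : VecDiffAt Y x) (hW : VecDiffAt W x) :
    koszul g (f • X) Y W x = f x * koszul g X Y W x := by
  simp only [koszul, Pi.smul_apply', map_smul, smul_apply, smul_eq_mul,
    mlieBracket_smul_left hf hX, map_add, add_apply,
    mvfderiv_fun_mul hf (hg.mdifferentiableAt hX hW),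
    mvfderiv_fun_mul hf (hg.mdifferentiableAt hX hY), neg_smul, map_neg,
    neg_apply]
  ring

lemma koszul_add_right (hX : VecDiffAt X x) (hY : VecDiffAt Y x) (hW : VecDiffAt W x)
    (hW' : VecDiffAt W' x) :
    koszul g X Y (W + W') x = koszul g X Y W x + koszul g X Y W' x := by
  simp only [koszul, Pi.add_apply, map_add, add_apply,
    mlieBracket_add_right hW hW',
    mvfderiv_fun_add (hg.mdifferentiableAt hX hW) (hg.mdifferentiableAt hX hW'),
    mvfderiv_fun_add (hg.mdifferentiableAt hY hW) (hg.mdifferentiableAt hY hW')]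
  ring

lemma koszul_smul_right (hf : MDifferentiableAt I 𝓘(ℝ, ℝ) f x) (hX : VecDiffAt X x)
    (hY : VecDiffAt Y x) (hW : VecDiffAt W x) :
    koszul g X Y (f • W) x = f x * koszul g X Y W x := by
  simp only [koszul, Pi.smul_apply', map_smul, smul_apply, smul_eq_mul,
    mlieBracket_smul_right hf hW, map_add, add_apply,
    mvfderiv_fun_mul hf (hg.mdifferentiableAt hX hW),
    mvfderiv_fun_mul hf (hg.mdifferentiableAt hY hW), hg.symm x (W x) (X x),
    hg.symm x (W x) (Y x)]
  ring

lemma koszul_add_mid (hX : VecDiffAt X x) (hY : VecDiffAt Y x) (hY' : VecDiffAt Y' x)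
    (hW : VecDiffAt W x) :
    koszul g X (Y + Y') W x = koszul g X Y W x + koszul g X Y' W x := by
  simp only [koszul, Pi.add_apply, map_add, add_apply,
    mlieBracket_add_left hY hY', mlieBracket_add_right hY hY',
    mvfderiv_fun_add (hg.mdifferentiableAt hY hW) (hg.mdifferentiableAt hY' hW),
    mvfderiv_fun_add (hg.mdifferentiableAt hX hY) (hg.mdifferentiableAt hX hY')]
  ring

lemma koszul_smul_mid (hf : MDifferentiableAt I 𝓘(ℝ, ℝ) f x) (hX : VecDiffAt X x)
    (hY : VecDiffAt Y x) (hW : VecDiffAt W x) :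
    koszul g X (f • Y) W x
      = f x * koszul g X Y W x + 2 * mvfderiv I f x (X x) * g x (Y x) (W x) := by
  simp only [koszul, Pi.smul_apply', map_smul, smul_apply, smul_eq_mul,
    mlieBracket_smul_right hf hY, mlieBracket_smul_left hf hY, map_add,
    add_apply, neg_smul, map_neg, neg_apply,
    mvfderiv_fun_mul hf (hg.mdifferentiableAt hY hW),
    mvfderiv_fun_mul hf (hg.mdifferentiableAt hX hY), hg.symm x (Y x) (X x)]
  ring

/-- Koszul's expression as a bilinear form in its first and last argument, in which it is
tensorial. -/
def koszulForm (hY : VecDiffAt Y x) : TangentSpace I x →L[ℝ] TangentSpace I x →L[ℝ] ℝ :=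
  TensorialAt.mkHom₂ (I := I) (F := E) (F' := E) (V := (TangentSpace I : M → Type _))
    (V' := (TangentSpace I : M → Type _)) (fun X W => koszul g X Y W x) x
    (fun _ hW => ⟨fun hf hX => hg.koszul_smul_left hf hX hY hW,
      fun hX hX' => hg.koszul_add_left hX hX' hY hW⟩)
    (fun _ hX => ⟨fun hf hW => hg.koszul_smul_right hf hX hY hW,
      fun hW hW' => hg.koszul_add_right hX hY hW hW'⟩)

lemma koszulForm_apply (hX : VecDiffAt X x) (hY : VecDiffAt Y x) (hW : VecDiffAt W x) :
    hg.koszulForm hY (X x) (W x) = koszul g X Y W x :=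
  TensorialAt.mkHom₂_apply _ _ hX hW

omit [FiniteDimensional ℝ E] in
lemma koszul_smooth (hX : SmoothVecNear X x) (hY : SmoothVecNear Y x) (hW : SmoothVecNear W x) :
    SmoothFunNear I (koszul g X Y W) x :=
  (((((hX.mvfderiv (hg.smooth hY hW)).add (hY.mvfderiv (hg.smooth hX hW))).sub
    (hW.mvfderiv (hg.smooth hX hY))).add (hg.smooth (hX.lieBracket hY) hW)).sub
    (hg.smooth (hX.lieBracket hW) hY)).sub (hg.smooth (hY.lieBracket hW) hX)

end Koszul

/-- By nondegeneracy every linear form is represented by a vector. -/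
lemma exists_sharp (hg : IsPseudoMetric g) (x : M) :
    ∃ S : (TangentSpace I x →L[ℝ] ℝ) →L[ℝ] TangentSpace I x,
      ∀ φ w, g x (S φ) w = φ w := by
  let B : TangentSpace I x →ₗ[ℝ] (TangentSpace I x →L[ℝ] ℝ) := (g x).toLinearMap
  have hB : Function.Injective B := by
    rw [← LinearMap.ker_eq_bot, LinearMap.ker_eq_bot']
    intro v hv
    exact hg.nondeg x v fun w => congr($hv w)
  have hfin : Module.finrank ℝ (TangentSpace I x)
      = Module.finrank ℝ (TangentSpace I x →L[ℝ] ℝ) := by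
    rw [← (LinearMap.toContinuousLinearMap (𝕜 := ℝ) (E := TangentSpace I x)
      (F' := ℝ)).finrank_eq]
    exact (Subspace.dual_finrank_eq).symm
  let e := LinearEquiv.ofInjectiveOfFinrankEq B hB hfin
  refine ⟨LinearMap.toContinuousLinearMap e.symm.toLinearMap, fun φ w => ?_⟩
  have : B (e.symm φ) = φ := e.apply_symm_apply φ
  exact congr($this w)

/-- The vector that represents a linear form with respect to the metric. -/
def sharp (hg : IsPseudoMetric g) (x : M) : (TangentSpace I x →L[ℝ] ℝ) →L[ℝ] TangentSpace I x :=
  (hg.exists_sharp x).choose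

@[simp]
lemma apply_sharp (hg : IsPseudoMetric g) (x : M) (φ : TangentSpace I x →L[ℝ] ℝ)
    (w : TangentSpace I x) : g x (hg.sharp x φ) w = φ w :=
  (hg.exists_sharp x).choose_spec φ w

omit [FiniteDimensional ℝ E] in
lemma eq_of_forall (hg : IsPseudoMetric g) {v v' : TangentSpace I x}
    (h : ∀ w, g x v w = g x v' w) : v = v' := by
  rw [← sub_eq_zero]
  exact hg.nondeg x _ fun w => by simp [h w]

/-- A vector field is smooth if its products with smooth fields are. -/
lemma smoothVecNear_of_forall (hg : IsPseudoMetric g) {Z : (x : M) → TangentSpace I x}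
    (h : ∀ W, SmoothVecNear W x → SmoothFunNear I (fun w => g w (Z w) (W w)) x) :
    SmoothVecNear Z x := by
  obtain ⟨n, s, c, hs, hexp, -, -⟩ := exists_smooth_frame (I := I) x
  let G : M → Matrix (Fin n) (Fin n) ℝ := fun w => Matrix.of fun i j => g w (s i w) (s j w)
  have hG : ∀ᶠ w in 𝓝 x, (G w).det ≠ 0 := by
    filter_upwards [hexp] with w hw h0
    obtain ⟨v, hv, hv0⟩ := Matrix.exists_vecMul_eq_zero_iff.2 h0
    -- a vector in the kernel of the Gram matrix is orthogonal to the frame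
    have h1 : ∑ i, v i • s i w = 0 := by
      refine hg.nondeg w _ fun y => ?_
      rw [hw.1 y, map_sum]
      refine Finset.sum_eq_zero fun j _ => ?_
      have := congr_fun hv0 j
      simp only [Matrix.vecMul, dotProduct, G, Matrix.of_apply, Pi.zero_apply] at this
      simp [this]
    refine hv (funext fun j => ?_)
    simpa [hw.2] using congr(c j w $h1)
  refine (SmoothVecNear.sum (s := Finset.univ) fun i _ =>
    (hs i).smul (f := fun w => ∑ j, g w (Z w) (s j w) * (G w)⁻¹ j i) ?_).congr ?_
  · exact .sum fun j _ => (h _ (hs j)).mul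
      (SmoothFunNear.matrix_inv (fun k l => hg.smooth (hs k) (hs l)) hG.self_of_nhds j i)
  · filter_upwards [hexp, hG] with w hw hGw
    have h1 : Matrix.vecMul (fun i => c i w (Z w)) (G w) = fun j => g w (Z w) (s j w) := by
      ext j
      conv_rhs => rw [hw.1 (Z w)]
      simp [Matrix.vecMul, dotProduct, G]
    have h2 : (fun i => c i w (Z w))
        = Matrix.vecMul (fun j => g w (Z w) (s j w)) (G w)⁻¹ := by
      rw [← h1, Matrix.vecMul_vecMul, Matrix.mul_nonsing_inv _ (isUnit_iff_ne_zero.2 hGw),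
        Matrix.vecMul_one]
    conv_lhs => rw [hw.1 (Z w)]
    refine Finset.sum_congr rfl fun i _ => ?_
    rw [show c i w (Z w) = _ from congr_fun h2 i]
    rfl

section LeviCivita

variable [CompleteSpace E] (hg : IsPseudoMetric g)

open scoped Classical in
/-- The Levi-Civita connection as a bare map: Koszul's formula `2 g(∇_X Y, W) = K(X, Y, W)` on
differentiable fields `Y`, and zero on all other fields. -/
def leviCivitaFun (Y : (x : M) → TangentSpace I x) (x : M) :
    TangentSpace I x →L[ℝ] TangentSpace I x :=
  if hY : VecDiffAt Y x then (1 / 2 : ℝ) • (hg.sharp x).comp (hg.koszulForm hY) else 0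

lemma leviCivitaFun_apply (hX : VecDiffAt X x) (hY : VecDiffAt Y x) (hW : VecDiffAt W x) :
    g x (hg.leviCivitaFun Y x (X x)) (W x) = 1 / 2 * koszul g X Y W x := by
  rw [leviCivitaFun, dif_pos hY]
  simp [hg.koszulForm_apply hX hY hW]

lemma leviCivitaFun_ext {v : TangentSpace I x → TangentSpace I x} (hY : VecDiffAt Y x)
    (h : ∀ X W, VecDiffAt X x → VecDiffAt W x →
      1 / 2 * koszul g X Y W x = g x (v (X x)) (W x)) (z : TangentSpace I x) :
    hg.leviCivitaFun Y x z = v z := by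
  refine hg.eq_of_forall fun w => ?_
  have hz := FiberBundle.mdifferentiableAt_extend I E (V := (TangentSpace I : M → Type _)) z
  have hw := FiberBundle.mdifferentiableAt_extend I E (V := (TangentSpace I : M → Type _)) w
  have h1 := hg.leviCivitaFun_apply hz hY hw
  rw [h _ _ hz hw] at h1
  simpa using h1

/-- The Levi-Civita connection of a pseudo-Riemannian metric. -/
def leviCivita : CovariantDerivative I E (TangentSpace I : M → Type _) where
  toFun := hg.leviCivitaFun
  isCovariantDerivativeOnUniv :=
    { add := fun {Y Y' x} hY hY' _ => ContinuousLinearMap.ext fun z => by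
        refine hg.leviCivitaFun_ext (v := fun z => _) (mdifferentiableAt_add_section hY hY')
          (fun X W hX hW => ?_) z
        rw [hg.koszul_add_mid hX hY hY' hW, add_apply, map_add, add_apply,
          hg.leviCivitaFun_apply hX hY hW, hg.leviCivitaFun_apply hX hY' hW]
        ring
      leibniz := fun {Y f x} hY hf _ => ContinuousLinearMap.ext fun z => by
        refine hg.leviCivitaFun_ext (v := fun z => _) (hf.smul_section hY) (fun X W hX hW => ?_) z
        rw [hg.koszul_smul_mid hf hX hY hW]
        simp only [add_apply, map_add, smul_apply, map_smul, smul_eq_mul,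
          hg.leviCivitaFun_apply hX hY hW, ContinuousLinearMap.smulRight_apply]
        ring }

lemma leviCivita_apply (hX : VecDiffAt X x) (hY : VecDiffAt Y x) (hW : VecDiffAt W x) :
    g x (hg.leviCivita Y x (X x)) (W x) = 1 / 2 * koszul g X Y W x :=
  hg.leviCivitaFun_apply hX hY hW

lemma leviCivita_metric (hX : VecDiffAt X x) (hY : VecDiffAt Y x) (hW : VecDiffAt W x) :
    mvfderiv I (fun w => g w (Y w) (W w)) x (X x)
      = g x (hg.leviCivita Y x (X x)) (W x) + g x (Y x) (hg.leviCivita W x (X x)) := by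
  rw [hg.leviCivita_apply hX hY hW, hg.symm x (Y x), hg.leviCivita_apply hX hW hY]
  simp only [koszul, hg.symm _ (W _) (Y _), mlieBracket_swap_apply (V := W) (W := Y), map_neg,
    neg_apply]
  ring

lemma leviCivita_torsion : hg.leviCivita.torsion = 0 := by
  rw [CovariantDerivative.torsion_eq_zero_iff]
  intro X Y x hX hY
  refine hg.eq_of_forall fun w => ?_
  have hw := FiberBundle.mdifferentiableAt_extend I E (V := (TangentSpace I : M → Type _)) w
  have h1 := hg.leviCivita_apply hX hY hw
  have h2 := hg.leviCivita_apply hY hX hw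
  simp only [koszul, hg.symm _ (Y _) (X _), mlieBracket_swap_apply (V := Y) (W := X), map_neg,
    neg_apply, FiberBundle.extend_apply_self] at h1 h2
  simp only [map_sub, sub_apply, h1, h2]
  ring

include hg in
/-- A metric torsion-free connection satisfies Koszul's formula. -/
lemma eq_koszul (D : CovariantDerivative I E (TangentSpace I : M → Type _))
    (hm : ∀ (Y W : (x : M) → TangentSpace I x) (x : M), VecDiffAt Y x → VecDiffAt W x → ∀ v,
      mvfderiv I (fun w => g w (Y w) (W w)) x v = g x (D Y x v) (W x) + g x (Y x) (D W x v))
    (ht : D.torsion = 0) (hX : VecDiffAt X x) (hY : VecDiffAt Y x) (hW : VecDiffAt W x) :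
    g x (D Y x (X x)) (W x) = 1 / 2 * koszul g X Y W x := by
  have ht' := fun {A B} => (CovariantDerivative.torsion_eq_zero_iff D).1 ht (X := A) (Y := B)
    (x := x)
  rw [koszul, hm _ _ _ hY hW, hm _ _ _ hX hW, hm _ _ _ hX hY, ← ht' hX hY, ← ht' hX hW,
    ← ht' hY hW]
  simp only [map_sub, sub_apply, hg.symm x (Y x), hg.symm x (X x)]
  ring

/-- Metric torsion-free connections agree with the Levi-Civita connection. -/
lemma eq_leviCivita (D : CovariantDerivative I E (TangentSpace I : M → Type _))
    (hm : ∀ (Y W : (x : M) → TangentSpace I x) (x : M), VecDiffAt Y x → VecDiffAt W x → ∀ v,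
      mvfderiv I (fun w => g w (Y w) (W w)) x v = g x (D Y x v) (W x) + g x (Y x) (D W x v))
    (ht : D.torsion = 0) (hY : VecDiffAt Y x) : D Y x = hg.leviCivita Y x := by
  refine ContinuousLinearMap.ext fun z => (hg.leviCivitaFun_ext (v := D Y x) hY
    (fun X W hX hW => ?_) z).symm
  exact (hg.eq_koszul D hm ht hX hY hW).symm

lemma leviCivita_smoothVecNear (hX : SmoothVecNear X x) (hY : SmoothVecNear Y x) :
    SmoothVecNear (fun w => hg.leviCivita Y w (X w)) x := by
  refine hg.smoothVecNear_of_forall fun W hW => ?_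
  refine ((SmoothFunNear.const (1 / 2)).mul (hg.koszul_smooth hX hY hW)).congr ?_
  filter_upwards [hX.eventually, hY.eventually, hW.eventually] with w h1 h2 h3
  exact hg.leviCivita_apply h1.mdifferentiableAt h2.mdifferentiableAt h3.mdifferentiableAt

end LeviCivita

end IsPseudoMetric

end LeviCivita

/-! ### Smooth connections and their curvature -/

section Connections

variable {E : Type*} [NormedAddCommGroup E] [NormedSpace ℝ E]
  {H : Type*} [TopologicalSpace H] {I : ModelWithCorners ℝ E H}
  {M : Type*} [TopologicalSpace M] [ChartedSpace H M] [IsManifold I ∞ M]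
  {X Y W : (x : M) → TangentSpace I x} {f : M → ℝ} {x : M}

/-- A field that is smooth near a point coincides near that point with a globally smooth field. -/
lemma SmoothVecNear.exists_contMDiff [FiniteDimensional ℝ E] [T2Space M] (hX : SmoothVecNear X x) :
    ∃ X' : (x : M) → TangentSpace I x, ContMDiff I (I.prod 𝓘(ℝ, E)) ∞
      (fun y => TotalSpace.mk' E (E := (TangentSpace I : M → Type _)) y (X' y)) ∧
      ∀ᶠ w in 𝓝 x, X' w = X w := by
  obtain ⟨U, hU, hUo, hxU⟩ := mem_nhds_iff.1 hX
  obtain ⟨b, -, hb⟩ := (SmoothBumpFunction.nhds_basis_tsupport (I := I) x).mem_iff.1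
    (hUo.mem_nhds hxU)
  refine ⟨fun w => b w • X w, ?_, ?_⟩
  · exact ContMDiffOn.smul_section_of_tsupport b.contMDiff.contMDiffOn hUo hb
      fun w hw => (hU hw).contMDiffWithinAt
  · filter_upwards [b.eventuallyEq_one] with w hw
    simp [hw]

section SmoothConnection

variable {D : CovariantDerivative I E (TangentSpace I : M → Type _)}

lemma cov_congr (hX : VecDiffAt X x) (hY : VecDiffAt Y x) (hXY : ∀ᶠ w in 𝓝 x, X w = Y w) :
    D X x = D Y x :=
  D.isCovariantDerivativeOnUniv.congr_of_eventuallyEq hX hY univ_mem hXY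

lemma cov_add (hX : VecDiffAt X x) (hY : VecDiffAt Y x) :
    D (fun w => X w + Y w) x = D X x + D Y x :=
  D.isCovariantDerivativeOnUniv.add hX hY

lemma cov_smul (hf : MDifferentiableAt I 𝓘(ℝ, ℝ) f x) (hX : VecDiffAt X x)
    (v : TangentSpace I x) :
    D (fun w => f w • X w) x v = f x • D X x v + mvfderiv I f x v • X x := by
  have := congr($(D.isCovariantDerivativeOnUniv.leibniz hX hf) v)
  simpa using! this

/-- A connection is smooth if it maps pairs of smooth fields to smooth fields. -/
lemma contMDiffCovariantDerivativeOn_of_forall [FiniteDimensional ℝ E]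
    (h : ∀ {X Y x}, SmoothVecNear X x → SmoothVecNear Y x →
      SmoothVecNear (fun w => D Y w (X w)) x) :
    ContMDiffCovariantDerivativeOn E ∞ D.toFun Set.univ where
  contMDiff := fun {Y} hY x _ => by
    have hY' : SmoothVecNear Y x := Eventually.of_forall fun w =>
      (hY.of_le (by simp)).contMDiffAt univ_mem
    exact (contMDiffAt_hom_of_forall fun X hX => h hX hY').contMDiffWithinAt

variable [FiniteDimensional ℝ E] [T2Space M]
  (hD : ContMDiffCovariantDerivativeOn E ∞ D.toFun Set.univ)

include hD

lemma cov_smoothVecNear (hX : SmoothVecNear X x) (hY : SmoothVecNear Y x) :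
    SmoothVecNear (fun w => D Y w (X w)) x := by
  obtain ⟨Y', hY', hYY'⟩ := hY.exists_contMDiff
  have h1 := hD.contMDiff (σ := Y') (by simpa using hY'.contMDiffOn)
  filter_upwards [hX, hY.eventually, eventually_eventually_nhds.2 hYY'] with w hXw hYw hYY'w
  have h2 := ((h1.contMDiffAt univ_mem).clm_bundle_apply hXw :)
  refine h2.congr_of_eventuallyEq ?_
  filter_upwards [hYY'w.eventually_nhds, hYw.eventually] with z hz hYz
  rw [cov_congr (D := D) hYz.mdifferentiableAt
    ((hY' z).mdifferentiableAt (by simp)) (hz.mono fun _ h => h.symm)]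

end SmoothConnection

/-- The commutator of two vector fields acts on functions as their Lie bracket.  This is the
Jacobi identity for `X`, `Y` and `f W`. -/
lemma mvfderiv_commutator_smul [CompleteSpace E] (hX : SmoothVecNear X x) (hY : SmoothVecNear Y x)
    (hW : SmoothVecNear W x) (hf : SmoothFunNear I f x) :
    (mvfderiv I (fun w => mvfderiv I f w (Y w)) x (X x)
      - mvfderiv I (fun w => mvfderiv I f w (X w)) x (Y x)
      - mvfderiv I f x (mlieBracket I X Y x)) • W x = 0 := by
  have : IsManifold I (minSmoothness ℝ 3) M := by
    rw [minSmoothness_of_isRCLikeNormedField]; infer_instance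
  have h2 : minSmoothness ℝ 2 ≤ (∞ : WithTop ℕ∞) := by
    rw [minSmoothness_of_isRCLikeNormedField]; exact ENat.LEInfty.out
  have key := leibniz_identity_mlieBracket_apply (I := I) (x := x) (hX.contMDiffAt.of_le h2)
    (hY.contMDiffAt.of_le h2) ((hW.smul hf).contMDiffAt.of_le h2)
  have key' := leibniz_identity_mlieBracket_apply (I := I) (x := x) (hX.contMDiffAt.of_le h2)
    (hY.contMDiffAt.of_le h2) (hW.contMDiffAt.of_le h2)
  have expand : ∀ {A}, SmoothVecNear A x → ∀ᶠ w in 𝓝 x, mlieBracket I A (fun w => f w • W w) w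
      = mvfderiv I f w (A w) • W w + f w • mlieBracket I A W w := by
    intro A hA
    filter_upwards [hf, hW] with w hfw hWw
    exact mlieBracket_smul_right (hfw.mdifferentiableAt (by simp))
      (hWw.mdifferentiableAt (by simp))
  have expand₂ : ∀ {A B}, SmoothVecNear A x → SmoothVecNear B x →
      mlieBracket I A (mlieBracket I B (fun w => f w • W w)) x
      = mvfderiv I (fun w => mvfderiv I f w (B w)) x (A x) • W x
        + mvfderiv I f x (B x) • mlieBracket I A W x
        + mvfderiv I f x (A x) • mlieBracket I B W x
        + f x • mlieBracket I A (mlieBracket I B W) x := by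
    intro A B hA hB
    have h1 := mlieBracket_smul_right (V := A) (hB.mvfderiv hf).mdifferentiableAt
      hW.mdifferentiableAt
    have h2 := mlieBracket_smul_right (V := A) hf.mdifferentiableAt
      (hB.lieBracket hW).mdifferentiableAt
    have h3 := mlieBracket_add_right (V := A) (hW.smul (hB.mvfderiv hf)).mdifferentiableAt
      ((hB.lieBracket hW).smul hf).mdifferentiableAt
    rw [EventuallyEq.mlieBracket_vectorField_eq (EventuallyEq.refl _ A) (expand hB)]
    refine h3.trans ?_
    rw [show mlieBracket I A (fun w => mvfderiv I f w (B w) • W w) x = _ from h1,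
      show mlieBracket I A (fun w => f w • mlieBracket I B W w) x = _ from h2]
    module
  rw [expand₂ hX hY, expand₂ hY hX, (expand (hX.lieBracket hY)).self_of_nhds, key'] at key
  rw [← sub_eq_zero] at key
  refine Eq.trans ?_ key
  module

/-- Curvature `R(X,Y)W = D_X D_Y W - D_Y D_X W - D_{[X,Y]} W` of a connection on the tangent
bundle. -/
def curvature (D : CovariantDerivative I E (TangentSpace I : M → Type _))
    (X Y W : (x : M) → TangentSpace I x) (x : M) : TangentSpace I x :=
  D (fun w => D W w (Y w)) x (X x) - D (fun w => D W w (X w)) x (Y x)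
    - D W x (mlieBracket I X Y x)

section Curvature

variable {D : CovariantDerivative I E (TangentSpace I : M → Type _)}

lemma curvature_swap : curvature D X Y W x = - curvature D Y X W x := by
  simp only [curvature, mlieBracket_swap_apply (V := X) (W := Y), map_neg]
  abel

variable [FiniteDimensional ℝ E] [CompleteSpace E] [T2Space M]
  (hD : ContMDiffCovariantDerivativeOn E ∞ D.toFun Set.univ)

include hD

lemma curvature_tensorial_left (hW : SmoothVecNear W x) :
    SmoothTensorialAt (fun X => curvature D X Y W x) x where
  add := fun {X X'} hX hX' => by
    have h1 := mlieBracket_add_left (W := Y) hX.mdifferentiableAt hX'.mdifferentiableAt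
    simp only [curvature, map_add, cov_add (D := D) (cov_smoothVecNear hD hX hW).mdifferentiableAt
      (cov_smoothVecNear hD hX' hW).mdifferentiableAt, add_apply,
      show mlieBracket I (fun w => X w + X' w) Y x = _ from h1]
    abel
  smul := fun {f X} hf hX => by
    have h1 := mlieBracket_smul_left (W := Y) hf.mdifferentiableAt hX.mdifferentiableAt
    simp only [curvature, map_smul, cov_smul (D := D) hf.mdifferentiableAt
      (cov_smoothVecNear hD hX hW).mdifferentiableAt,
      show mlieBracket I (fun w => f w • X w) Y x = _ from h1, map_add, neg_smul, map_neg]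
    module

lemma curvature_tensorial_mid (hW : SmoothVecNear W x) :
    SmoothTensorialAt (fun Y => curvature D X Y W x) x where
  add := fun hY hY' => by
    simp only [curvature_swap (X := X), (curvature_tensorial_left hD hW).add hY hY', neg_add]
  smul := fun hf hY => by
    simp only [curvature_swap (X := X), (curvature_tensorial_left hD hW).smul hf hY, smul_neg]

lemma curvature_tensorial_right (hX : SmoothVecNear X x) (hY : SmoothVecNear Y x) :
    SmoothTensorialAt (fun W => curvature D X Y W x) x where
  add := fun {W W'} hW hW' => by
    have h1 : ∀ {A : (x : M) → TangentSpace I x}, SmoothVecNear A x →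
        D (fun w => D (fun w => W w + W' w) w (A w)) x
          = D (fun w => D W w (A w)) x + D (fun w => D W' w (A w)) x := by
      intro A hA
      rw [← cov_add (D := D) (cov_smoothVecNear hD hA hW).mdifferentiableAt
        (cov_smoothVecNear hD hA hW').mdifferentiableAt]
      refine cov_congr (cov_smoothVecNear hD hA (hW.add hW')).mdifferentiableAt
        ((cov_smoothVecNear hD hA hW).add (cov_smoothVecNear hD hA hW')).mdifferentiableAt ?_
      filter_upwards [hW.eventually, hW'.eventually] with w h h'
      rw [cov_add (D := D) h.mdifferentiableAt h'.mdifferentiableAt, add_apply]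
    simp only [curvature, h1 hX, h1 hY,
      cov_add (D := D) hW.mdifferentiableAt hW'.mdifferentiableAt, add_apply]
    abel
  smul := fun {f W} hf hW => by
    have h1 : ∀ {A : (x : M) → TangentSpace I x}, SmoothVecNear A x → ∀ v,
        D (fun w => D (fun w => f w • W w) w (A w)) x v
          = f x • D (fun w => D W w (A w)) x v + mvfderiv I f x v • D W x (A x)
            + (mvfderiv I f x (A x) • D W x v
              + mvfderiv I (fun w => mvfderiv I f w (A w)) x v • W x) := by
      intro A hA v
      have hA' := cov_smoothVecNear hD hA hW
      rw [← cov_smul (D := D) hf.mdifferentiableAt hA'.mdifferentiableAt,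
        ← cov_smul (D := D) (hA.mvfderiv hf).mdifferentiableAt hW.mdifferentiableAt,
        ← add_apply, ← cov_add (D := D) (hA'.smul hf).mdifferentiableAt
          (hW.smul (hA.mvfderiv hf)).mdifferentiableAt]
      congr 1
      refine cov_congr (cov_smoothVecNear hD hA (hW.smul hf)).mdifferentiableAt
        ((hA'.smul hf).add (hW.smul (hA.mvfderiv hf))).mdifferentiableAt ?_
      filter_upwards [hW, hf] with w h h'
      exact cov_smul (D := D) (h'.mdifferentiableAt (by simp)) (h.mdifferentiableAt (by simp)) _
    have h2 := mvfderiv_commutator_smul hX hY hW hf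
    simp only [curvature, h1 hX, h1 hY, cov_smul (D := D) hf.mdifferentiableAt hW.mdifferentiableAt]
    rw [← sub_eq_zero]
    refine Eq.trans ?_ h2
    module

/-- The curvature at a point depends only on the values of the three fields there. -/
lemma curvature_pointwise {X' Y' W' : (x : M) → TangentSpace I x}
    (hX : SmoothVecNear X x) (hX' : SmoothVecNear X' x) (hXX' : X x = X' x)
    (hY : SmoothVecNear Y x) (hY' : SmoothVecNear Y' x) (hYY' : Y x = Y' x)
    (hW : SmoothVecNear W x) (hW' : SmoothVecNear W' x) (hWW' : W x = W' x) :
    curvature D X Y W x = curvature D X' Y' W' x :=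
  ((curvature_tensorial_left hD hW).pointwise hX hX' hXX').trans <|
    ((curvature_tensorial_mid hD hW).pointwise hY hY' hYY').trans <|
      (curvature_tensorial_right hD hX' hY').pointwise hW hW' hWW'

end Curvature

end Connections

/-! ### Connections adapted to a splitting -/

section Adapted

variable {E : Type*} [NormedAddCommGroup E] [NormedSpace ℝ E]
  {H : Type*} [TopologicalSpace H] {I : ModelWithCorners ℝ E H}
  {M : Type*} [TopologicalSpace M] [ChartedSpace H M] [IsManifold I ∞ M]

/-- A smooth splitting of the tangent bundle, given by the field of projections onto the first
summand along the second one. -/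
structure IsSplitting (h : (x : M) → TangentSpace I x →L[ℝ] TangentSpace I x) : Prop where
  idem : ∀ x v, h x (h x v) = h x v
  smooth : ∀ {X x}, SmoothVecNear X x → SmoothVecNear (fun w => h w (X w)) x
  diff : ∀ {X x}, VecDiffAt X x → VecDiffAt (fun w => h w (X w)) x

namespace IsSplitting

variable {h : (x : M) → TangentSpace I x →L[ℝ] TangentSpace I x} (hh : IsSplitting h)
  {X Y W : (x : M) → TangentSpace I x} {f : M → ℝ} {x : M}

include hh

lemma diff' (hX : VecDiffAt X x) : VecDiffAt (fun w => X w - h w (X w)) x :=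
  mdifferentiableAt_sub_section hX (hh.diff hX)

lemma smooth' (hX : SmoothVecNear X x) : SmoothVecNear (fun w => X w - h w (X w)) x :=
  hX.sub (hh.smooth hX)

variable [FiniteDimensional ℝ E] [CompleteSpace E]

/-- The curvature `(Y, W) ↦ v[hY, hW]` of the first summand, with values in the second one. -/
def horCurvature (x : M) : TangentSpace I x →L[ℝ] TangentSpace I x →L[ℝ] TangentSpace I x :=
  TensorialAt.mkHom₂ (I := I) (F := E) (F' := E) (V := (TangentSpace I : M → Type _))
    (V' := (TangentSpace I : M → Type _))
    (fun Y W => mlieBracket I (fun w => h w (Y w)) (fun w => h w (W w)) x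
      - h x (mlieBracket I (fun w => h w (Y w)) (fun w => h w (W w)) x)) x
    (fun W hW =>
      { smul := fun {f Y} hf hY => by
          have h1 := mlieBracket_smul_left (W := fun w => h w (W w)) hf (hh.diff hY)
          rw [show (fun w => h w ((f • Y) w)) = f • fun w => h w (Y w) by ext; simp, h1]
          simp only [map_add, map_smul, hh.idem, smul_sub]
          abel
        add := fun {Y Y'} hY hY' => by
          have h1 := mlieBracket_add_left (W := fun w => h w (W w)) (hh.diff hY) (hh.diff hY')
          rw [show (fun w => h w ((Y + Y') w)) = (fun w => h w (Y w)) + fun w => h w (Y' w) by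
            ext; simp, h1]
          simp only [map_add]
          abel })
    (fun Y hY =>
      { smul := fun {f W} hf hW => by
          have h1 := mlieBracket_smul_right (V := fun w => h w (Y w)) hf (hh.diff hW)
          rw [show (fun w => h w ((f • W) w)) = f • fun w => h w (W w) by ext; simp, h1]
          simp only [map_add, map_smul, hh.idem, smul_sub]
          abel
        add := fun {W W'} hW hW' => by
          have h1 := mlieBracket_add_right (V := fun w => h w (Y w)) (hh.diff hW) (hh.diff hW')
          rw [show (fun w => h w ((W + W') w)) = (fun w => h w (W w)) + fun w => h w (W' w) by
            ext; simp, h1]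
          simp only [map_add]
          abel })

lemma horCurvature_apply (hY : VecDiffAt Y x) (hW : VecDiffAt W x) :
    hh.horCurvature x (Y x) (W x) = mlieBracket I (fun w => h w (Y w)) (fun w => h w (W w)) x
      - h x (mlieBracket I (fun w => h w (Y w)) (fun w => h w (W w)) x) :=
  TensorialAt.mkHom₂_apply _ _ hY hW

omit [FiniteDimensional ℝ E] [CompleteSpace E] hh in
lemma exists_field (v : TangentSpace I x) :
    ∃ X : (x : M) → TangentSpace I x, SmoothVecNear X x ∧ X x = v :=
  ⟨_, SmoothVecNear.extend v, FiberBundle.extend_apply_self _ _⟩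

lemma horCurvature_hor (y w : TangentSpace I x) :
    hh.horCurvature x (h x y) (h x w) = hh.horCurvature x y w := by
  obtain ⟨Y, hY, rfl⟩ := exists_field y
  obtain ⟨W, hW, rfl⟩ := exists_field w
  rw [hh.horCurvature_apply hY.mdifferentiableAt hW.mdifferentiableAt]
  have := hh.horCurvature_apply (hh.smooth hY).mdifferentiableAt (hh.smooth hW).mdifferentiableAt
  simpa only [hh.idem] using this

lemma horCurvature_antisymm (y w : TangentSpace I x) :
    hh.horCurvature x y w = - hh.horCurvature x w y := by
  obtain ⟨Y, hY, rfl⟩ := exists_field y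
  obtain ⟨W, hW, rfl⟩ := exists_field w
  rw [hh.horCurvature_apply hY.mdifferentiableAt hW.mdifferentiableAt,
    hh.horCurvature_apply hW.mdifferentiableAt hY.mdifferentiableAt,
    mlieBracket_swap_apply (V := fun w => h w (Y w)), map_neg]
  abel

end IsSplitting

variable {h : (x : M) → TangentSpace I x →L[ℝ] TangentSpace I x} {hh : IsSplitting h}
  {g : (x : M) → TangentSpace I x →L[ℝ] TangentSpace I x →L[ℝ] ℝ}
  {X Y W : (x : M) → TangentSpace I x} {f : M → ℝ} {x : M}

/-- A pseudo-Riemannian metric for which the two summands of a splitting are orthogonal, that is,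
the projection onto the first summand is self-adjoint. -/
structure IsBlockMetric (h : (x : M) → TangentSpace I x →L[ℝ] TangentSpace I x)
    (g : (x : M) → TangentSpace I x →L[ℝ] TangentSpace I x →L[ℝ] ℝ) : Prop where
  split : IsSplitting h
  metric : IsPseudoMetric g
  adjoint : ∀ x v w, g x v (h x w) = g x (h x v) w

namespace IsBlockMetric

variable [FiniteDimensional ℝ E] [CompleteSpace E] (hg : IsBlockMetric h g)

/-- The tensor `S` with `2 g(S(x, y), w) = g(v x, v[h y, h w])`; here `y` is the first argument. -/
def correction (x : M) : TangentSpace I x →L[ℝ] TangentSpace I x →L[ℝ] TangentSpace I x :=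
  LinearMap.toContinuousBilinearMap <| LinearMap.mk₂ ℝ
    (fun y z => hg.metric.sharp x
      ((1 / 2 : ℝ) • (g x (z - h x z)).comp (hg.split.horCurvature x y)))
    (fun y y' z => by
      refine Eq.trans ?_ (map_add (hg.metric.sharp x) _ _)
      congr 1; ext w; simp)
    (fun c y z => by
      refine Eq.trans ?_ (map_smul (hg.metric.sharp x) c _)
      congr 1; ext w; simp; ring)
    (fun y z z' => by
      refine Eq.trans ?_ (map_add (hg.metric.sharp x) _ _)
      congr 1; ext w; simp; ring)
    (fun c y z => by
      refine Eq.trans ?_ (map_smul (hg.metric.sharp x) c _)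
      congr 1; ext w; simp; ring)

lemma correction_apply (y z w : TangentSpace I x) :
    g x (hg.correction x y z) w = 1 / 2 * g x (z - h x z) (hg.split.horCurvature x y w) := by
  change g x (hg.metric.sharp x _) w = _
  simp

/-- The d-connection built from the Levi-Civita connection: its parts along the two summands,
corrected by a tensor that makes its mixed part symmetric. -/
def adaptedConnection : CovariantDerivative I E (TangentSpace I : M → Type _) :=
  CovariantDerivative.addOneForm
    { toFun := fun Y x => (h x).comp (hg.metric.leviCivita (fun w => h w (Y w)) x)
        + (ContinuousLinearMap.id ℝ (TangentSpace I x) - h x).comp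
          (hg.metric.leviCivita (fun w => Y w - h w (Y w)) x)
      isCovariantDerivativeOnUniv :=
        { add := fun {Y Y' x} hY hY' _ => by
            have h1 := cov_add (D := hg.metric.leviCivita) (hg.split.diff hY) (hg.split.diff hY')
            have h2 := cov_add (D := hg.metric.leviCivita) (hg.split.diff' hY)
              (hg.split.diff' hY')
            rw [show (fun w => h w ((Y + Y') w)) = fun w => h w (Y w) + h w (Y' w) by
              ext; simp, h1, show (fun w => (Y + Y') w - h w ((Y + Y') w))
                = fun w => (Y w - h w (Y w)) + (Y' w - h w (Y' w)) by
                  ext; simp only [Pi.add_apply, map_add]; abel, h2]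
            simp only [ContinuousLinearMap.comp_add]
            abel
          leibniz := fun {Y f x} hY hf _ => by
            ext z
            have h1 := cov_smul (D := hg.metric.leviCivita) hf (hg.split.diff hY) z
            have h2 := cov_smul (D := hg.metric.leviCivita) hf (hg.split.diff' hY) z
            simp only [Pi.smul_apply', map_smul, ← smul_sub, add_apply,
              ContinuousLinearMap.comp_apply, h1, h2, map_add, sub_apply, map_sub,
              ContinuousLinearMap.id_apply, smul_apply, ContinuousLinearMap.smulRight_apply,
              hg.split.idem]
            module } }
    hg.correction

lemma adaptedConnection_apply (Y : (x : M) → TangentSpace I x) (x : M) (z : TangentSpace I x) :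
    hg.adaptedConnection Y x z = h x (hg.metric.leviCivita (fun w => h w (Y w)) x z)
      + (hg.metric.leviCivita (fun w => Y w - h w (Y w)) x z
        - h x (hg.metric.leviCivita (fun w => Y w - h w (Y w)) x z))
      + hg.correction x (Y x) z := rfl

lemma hor_correction (y z : TangentSpace I x) :
    h x (hg.correction x y z) = hg.correction x y z := by
  refine hg.metric.eq_of_forall fun w => ?_
  rw [← hg.adjoint, hg.correction_apply, hg.correction_apply,
    ← hg.split.horCurvature_hor y w, ← hg.split.horCurvature_hor y (h x w), hg.split.idem]

lemma correction_hor (y z : TangentSpace I x) :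
    hg.correction x (h x y) z = hg.correction x y z := by
  refine hg.metric.eq_of_forall fun w => ?_
  rw [hg.correction_apply, hg.correction_apply,
    ← hg.split.horCurvature_hor y w, ← hg.split.horCurvature_hor (h x y) w, hg.split.idem]

lemma correction_of_hor {y z : TangentSpace I x} (hz : h x z = z) :
    hg.correction x y z = 0 := by
  refine hg.metric.eq_of_forall fun w => ?_
  rw [hg.correction_apply, hz]
  simp

/-- The splitting is parallel for the adapted connection. -/
lemma adaptedConnection_hor (Y : (x : M) → TangentSpace I x) (z : TangentSpace I x) :
    hg.adaptedConnection (fun w => h w (Y w)) x z = h x (hg.adaptedConnection Y x z) := by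
  simp only [adaptedConnection_apply, hg.split.idem, sub_self, hg.correction_hor, map_add, map_sub,
    hg.hor_correction]
  have h0 : hg.metric.leviCivita (fun _ => 0) x = 0 := congr_fun hg.metric.leviCivita.zero x
  simp [h0]

lemma adaptedConnection_metric (hX : VecDiffAt X x) (hY : VecDiffAt Y x) (hW : VecDiffAt W x) :
    mvfderiv I (fun w => g w (Y w) (W w)) x (X x)
      = g x (hg.adaptedConnection Y x (X x)) (W x) + g x (Y x) (hg.adaptedConnection W x (X x)) := by
  have h1 := hg.metric.leviCivita_metric hX (hg.split.diff hY) (hg.split.diff hW)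
  have h2 := hg.metric.leviCivita_metric hX (hg.split.diff' hY) (hg.split.diff' hW)
  have h3 : (fun w => g w (Y w) (W w)) = fun w => g w (h w (Y w)) (h w (W w))
      + g w (Y w - h w (Y w)) (W w - h w (W w)) := by
    ext w
    simp only [map_sub, sub_apply, hg.adjoint, hg.split.idem]
    ring
  have h4 : g x (hg.correction x (Y x) (X x)) (W x)
      + g x (Y x) (hg.correction x (W x) (X x)) = 0 := by
    rw [hg.metric.symm x (Y x), hg.correction_apply, hg.correction_apply,
      hg.split.horCurvature_antisymm, map_neg]
    ring
  rw [h3, mvfderiv_fun_add (hg.metric.mdifferentiableAt (hg.split.diff hY) (hg.split.diff hW))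
    (hg.metric.mdifferentiableAt (hg.split.diff' hY) (hg.split.diff' hW)), add_apply, h1, h2,
    adaptedConnection_apply, adaptedConnection_apply]
  simp only [map_add, map_sub, add_apply, sub_apply, hg.adjoint]
  linear_combination -h4

lemma hor_torsion (hX : VecDiffAt X x) (hY : VecDiffAt Y x) :
    h x (hg.adaptedConnection.torsion x (h x (X x)) (h x (Y x))) = 0 := by
  have h1 := (CovariantDerivative.torsion_eq_zero_iff _).1 hg.metric.leviCivita_torsion
    (hg.split.diff hX) (hg.split.diff hY)
  have h2 := hg.adaptedConnection.torsion_apply (hg.split.diff hX) (hg.split.diff hY)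
  rw [h2, ← h1]
  simp [adaptedConnection_apply, hg.split.idem, hg.correction_of_hor]

lemma ver_torsion (hX : VecDiffAt X x) (hY : VecDiffAt Y x) :
    hg.adaptedConnection.torsion x (X x - h x (X x)) (Y x - h x (Y x))
      = h x (hg.adaptedConnection.torsion x (X x - h x (X x)) (Y x - h x (Y x))) := by
  have h1 := (CovariantDerivative.torsion_eq_zero_iff _).1 hg.metric.leviCivita_torsion
    (hg.split.diff' hX) (hg.split.diff' hY)
  have h2 := hg.adaptedConnection.torsion_apply (hg.split.diff' hX) (hg.split.diff' hY)
  have h0 : hg.metric.leviCivita (fun _ => 0) x = 0 := congr_fun hg.metric.leviCivita.zero x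
  have h3 : ∀ y z, hg.correction x (y - h x y) z = 0 := by
    intro y z
    rw [← hg.correction_hor, map_sub, hg.split.idem, sub_self, map_zero, zero_apply]
  rw [h2, ← h1]
  simp only [adaptedConnection_apply, h3]
  simp only [map_sub, map_add, hg.split.idem, sub_self, sub_zero, h0, zero_apply, map_zero]
  abel

lemma adaptedConnection_smoothVecNear (hX : SmoothVecNear X x) (hY : SmoothVecNear Y x) :
    SmoothVecNear (fun w => hg.adaptedConnection Y w (X w)) x := by
  have h1 := hg.metric.leviCivita_smoothVecNear hX (hg.split.smooth hY)
  have h2 := hg.metric.leviCivita_smoothVecNear hX (hg.split.smooth' hY)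
  refine ((hg.split.smooth h1).add (hg.split.smooth' h2)).add ?_
  refine hg.metric.smoothVecNear_of_forall fun W hW => ?_
  have h3 := (hg.split.smooth hY).lieBracket (hg.split.smooth hW)
  refine ((SmoothFunNear.const (1 / 2)).mul
    (hg.metric.smooth (hg.split.smooth' hX) (hg.split.smooth' h3))).congr ?_
  filter_upwards [hY.eventually, hW.eventually] with w hYw hWw
  refine (hg.correction_apply _ _ _).trans ?_
  rw [hg.split.horCurvature_apply hYw.mdifferentiableAt hWw.mdifferentiableAt]

/-- A Koszul formula for the adapted connection. -/
lemma adaptedConnection_koszul (hX : VecDiffAt X x) (hY : VecDiffAt Y x) (hW : VecDiffAt W x) :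
    2 * g x (hg.adaptedConnection Y x (X x)) (W x)
      = koszul g X (fun w => h w (Y w)) (fun w => h w (W w)) x
        + koszul g X (fun w => Y w - h w (Y w)) (fun w => W w - h w (W w)) x
        + g x (X x - h x (X x)) (mlieBracket I (fun w => h w (Y w)) (fun w => h w (W w)) x) := by
  have h1 := hg.metric.leviCivita_apply hX (hg.split.diff hY) (hg.split.diff hW)
  have h2 := hg.metric.leviCivita_apply hX (hg.split.diff' hY) (hg.split.diff' hW)
  have h3 := hg.correction_apply (Y x) (X x) (W x)
  rw [hg.split.horCurvature_apply hY hW] at h3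
  rw [adaptedConnection_apply]
  simp only [map_add, map_sub, add_apply, sub_apply, hg.adjoint, hg.split.idem] at h1 h2 h3 ⊢
  linear_combination 2 * h1 + 2 * h2 + 2 * h3

end IsBlockMetric

end Adapted

/-! ### Frames and natural coordinates on the cotangent bundle -/

section Frames

variable {E : Type*} [NormedAddCommGroup E] [NormedSpace ℝ E]
  {H : Type*} [TopologicalSpace H] {I : ModelWithCorners ℝ E H}
  {M : Type*} [TopologicalSpace M] [ChartedSpace H M] [IsManifold I ∞ M]

/-- Coordinate vector fields commute: they are pullbacks of constant vector fields. -/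
lemma mlieBracket_symm_trivializationAt [CompleteSpace E] {x₀ x : M}
    (hx : x ∈ (chartAt H x₀).source) (v w : E) :
    mlieBracket I (fun y => (trivializationAt E (TangentSpace I : M → Type _) x₀).symm y v)
      (fun y => (trivializationAt E (TangentSpace I : M → Type _) x₀).symm y w) x = 0 := by
  have key : ∀ v : E, ∀ᶠ y in 𝓝 x,
      (trivializationAt E (TangentSpace I : M → Type _) x₀).symm y v
        = mpullback I 𝓘(ℝ, E) (extChartAt I x₀) (fun _ => v) y := by
    intro v
    filter_upwards [(chartAt H x₀).open_source.mem_nhds hx] with y hy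
    have hy' : y ∈ (trivializationAt E (TangentSpace I : M → Type _) x₀).baseSet := by
      simpa using hy
    have h1 := TangentBundle.continuousLinearMapAt_trivializationAt (I := I) hy
    set e := (trivializationAt E (TangentSpace I : M → Type _) x₀).continuousLinearEquivAt ℝ y hy'
    have h2 : (mfderiv I 𝓘(ℝ, E) (extChartAt I x₀) y : TangentSpace I y →L[ℝ] E)
        = (e : TangentSpace I y →L[ℝ] E) := by
      rw [← h1]
      ext v
      simp [e, Trivialization.coe_linearMapAt_of_mem _ hy']
    have h3 : ContinuousLinearMap.inverse
        (mfderiv I 𝓘(ℝ, E) (extChartAt I x₀) y : TangentSpace I y →L[ℝ] E)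
          = (e.symm : E →L[ℝ] TangentSpace I y) :=
      (congrArg ContinuousLinearMap.inverse h2).trans (ContinuousLinearMap.inverse_equiv e)
    exact (congrArg (fun B : E →L[ℝ] TangentSpace I y => B v) h3).symm
  have : IsManifold I (minSmoothness ℝ 2) M := by
    rw [minSmoothness_of_isRCLikeNormedField]; infer_instance
  have : IsManifold I (minSmoothness ℝ 3) M := by
    rw [minSmoothness_of_isRCLikeNormedField]; infer_instance
  have hc : ∀ v : E, MDifferentiableAt 𝓘(ℝ, E) (𝓘(ℝ, E).prod 𝓘(ℝ, E))
      (fun y => TotalSpace.mk' E (E := (TangentSpace 𝓘(ℝ, E) : E → Type _)) y v)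
      (extChartAt I x₀ x) := by
    intro v
    refine (mdifferentiableAt_section (E := (TangentSpace 𝓘(ℝ, E) : E → Type _)) _ _).2 ?_
    simpa using! mdifferentiableAt_const
  rw [Filter.EventuallyEq.mlieBracket_vectorField_eq (key v) (key w),
    ← mpullback_mlieBracket (hc v) (hc w) (contMDiffAt_extChartAt' (n := ∞) (by simpa using hx)) (by
      rw [minSmoothness_of_isRCLikeNormedField]; exact ENat.LEInfty.out)]
  have h0 := congrFun (mlieBracketWithin_eq_lieBracketWithin (𝕜 := ℝ) (V := fun _ : E => v)
    (W := fun _ : E => w) (s := Set.univ)) (extChartAt I x₀ x)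
  have h1 := (congrFun (mlieBracketWithin_univ (I := 𝓘(ℝ, E)) (V := fun _ : E => v)
    (W := fun _ : E => w)).symm _).trans (h0.trans (by simp [lieBracketWithin] : _ = (0 : E)))
  exact (congrArg (mfderiv I 𝓘(ℝ, E) (extChartAt I x₀) x).inverse h1).trans (map_zero _)

/-- A smooth frame `s` of the tangent bundle over the open set `U`, with dual coframe `c`. -/
structure IsFrame {ι : Type*} [Fintype ι] [DecidableEq ι] (s : ι → (x : M) → TangentSpace I x)
    (c : ι → (x : M) → TangentSpace I x →ₗ[ℝ] ℝ) (U : Set M) : Prop where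
  isOpen : IsOpen U
  smooth : ∀ i {x}, x ∈ U → SmoothVecNear (s i) x
  coeff_smooth : ∀ i {X x}, x ∈ U → SmoothVecNear X x → SmoothFunNear I (fun w => c i w (X w)) x
  coeff_diff : ∀ i {X x}, x ∈ U → VecDiffAt X x →
    MDifferentiableAt I 𝓘(ℝ, ℝ) (fun w => c i w (X w)) x
  expand : ∀ {x}, x ∈ U → ∀ v : TangentSpace I x, v = ∑ i, c i x v • s i x
  dual : ∀ {x}, x ∈ U → ∀ i j, c i x (s j x) = if i = j then 1 else 0

namespace IsFrame

variable {ι : Type*} [Fintype ι] [DecidableEq ι] {s s' : ι → (x : M) → TangentSpace I x}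
  {c c' : ι → (x : M) → TangentSpace I x →ₗ[ℝ] ℝ} {U U' : Set M} {x : M}
  {X : (x : M) → TangentSpace I x}

lemma mem_nhds (hs : IsFrame s c U) (hx : x ∈ U) : ∀ᶠ w in 𝓝 x, w ∈ U :=
  hs.isOpen.mem_nhds hx

/-- Traces may be computed in any frame. -/
lemma trace_eq (hs : IsFrame s c U) (hs' : IsFrame s' c' U') (hx : x ∈ U) (hx' : x ∈ U')
    (A : TangentSpace I x →ₗ[ℝ] TangentSpace I x) :
    ∑ i, c i x (A (s i x)) = ∑ i, c' i x (A (s' i x)) := by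
  calc ∑ i, c i x (A (s i x)) = ∑ i, ∑ j, c' j x (s i x) * c i x (A (s' j x)) := by
        refine Finset.sum_congr rfl fun i _ => ?_
        conv_lhs => rw [hs'.expand hx' (s i x)]
        simp
    _ = ∑ j, c' j x (∑ i, c i x (A (s' j x)) • s i x) := by
        rw [Finset.sum_comm]
        simp [mul_comm]
    _ = _ := by simp only [← hs.expand hx]

end IsFrame

/-- The coordinate frame of a preferred chart, with respect to a basis of the model space. -/
lemma isFrame_trivializationAt [FiniteDimensional ℝ E] {ι : Type*} [Fintype ι] [DecidableEq ι]
    (b : Module.Basis ι ℝ E) (x₀ : M) :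
    IsFrame (I := I)
      (fun i x => (trivializationAt E (TangentSpace I : M → Type _) x₀).symm x (b i))
      (fun i x => b.coord i ∘ₗ ((trivializationAt E (TangentSpace I : M → Type _)
        x₀).continuousLinearMapAt ℝ x : TangentSpace I x →ₗ[ℝ] E))
      (chartAt H x₀).source := by
  set t := trivializationAt E (TangentSpace I : M → Type _) x₀ with ht
  have hbase : ∀ {x}, x ∈ (chartAt H x₀).source → x ∈ t.baseSet := by
    intro x hx
    rwa [ht, TangentBundle.trivializationAt_baseSet]
  have hopen : IsOpen (chartAt H x₀).source := (chartAt _ x₀).open_source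
  have hfr : ∀ i {x}, x ∈ (chartAt H x₀).source → t.symm x (b i) = t.localFrame b i x := by
    intro i x hx
    simp [t.localFrame_apply_of_mem_baseSet _ (hbase hx), Trivialization.basisAt]
  have hco : ∀ i {x}, x ∈ (chartAt H x₀).source → ∀ v : TangentSpace I x,
      b.coord i (t.continuousLinearMapAt ℝ x v) = t.localFrameCoeff I b i x v := by
    intro i x hx v
    have h1 := t.localFrameCoeff_apply_of_mem_baseSet (I := I) b (hbase hx)
      (FiberBundle.extend E (E := (TangentSpace I : M → Type _)) v) i
    rw [FiberBundle.extend_apply_self] at h1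
    rw [h1]
    simp [Trivialization.basisAt, t.coe_linearMapAt_of_mem (hbase hx)]
  refine ⟨hopen, fun i x hx => ?_, fun i X x hx hX => ?_, fun i X x hx hX => ?_,
    fun {x} hx v => ?_, fun {x} hx i j => ?_⟩
  · refine SmoothVecNear.congr (X := t.localFrame b i) ?_ ?_
    · filter_upwards [hopen.mem_nhds hx] with w hw
      exact contMDiffAt_localFrame_of_mem ∞ _ b i (hbase hw)
    · filter_upwards [hopen.mem_nhds hx] with w hw using hfr i hw
  · refine SmoothFunNear.congr (f := fun w => t.localFrameCoeff I b i w (X w)) ?_ ?_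
    · filter_upwards [hopen.mem_nhds hx, hX] with w hw hXw
      exact contMDiffAt_localFrameCoeff b (hbase hw) hXw i
    · filter_upwards [hopen.mem_nhds hx] with w hw using hco i hw _
  · refine (mdifferentiableAt_localFrameCoeff b (hbase hx) hX i).congr_of_eventuallyEq ?_
    filter_upwards [hopen.mem_nhds hx] with w hw using hco i hw _
  · have h1 := t.eq_sum_localFrameCoeff_smul (I := I) (b := b) (x' := x)
      (s := FiberBundle.extend E (E := (TangentSpace I : M → Type _)) v) (hbase hx)
    rw [FiberBundle.extend_apply_self] at h1
    refine h1.trans (Finset.sum_congr rfl fun i _ => ?_)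
    rw [← hfr i hx, ← hco i hx]
    rfl
  · have h1 := t.continuousLinearMapAt_symmL (R := ℝ) (hbase hx) (b j)
    rw [Trivialization.symmL_apply _ (hbase hx)] at h1
    refine (congrArg (b.coord i) h1).trans ?_
    simp [Finsupp.single_apply, eq_comm]

end Frames

-- Shortcuts for the instance search on the cotangent bundle.
local instance : CompleteSpace PhaseModel := inferInstance

local instance : FiniteDimensional ℝ PhaseModel := inferInstance

local instance {V : Type*} [TopologicalSpace V] [ChartedSpace BaseModel V]
    [IsManifold (𝓡 4) ∞ V] : TopologicalSpace (Cotangent V) := inferInstance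

local instance {V : Type*} [TopologicalSpace V] [ChartedSpace BaseModel V]
    [IsManifold (𝓡 4) ∞ V] : IsManifold PhaseI ∞ (Cotangent V) := inferInstance

local instance {V : Type*} [TopologicalSpace V] [ChartedSpace BaseModel V]
    [IsManifold (𝓡 4) ∞ V] : IsManifold PhaseI 1 (Cotangent V) := inferInstance

section Coordinates

variable {V : Type*} [TopologicalSpace V] [ChartedSpace BaseModel V] [IsManifold (𝓡 4) ∞ V]

/-- The cotangent bundle of a Hausdorff manifold is Hausdorff. -/
instance [T2Space V] : T2Space (Cotangent V) := by
  refine ⟨fun u w huw => ?_⟩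
  by_cases h : u.proj = w.proj
  · let t := trivializationAt FibreModel (fun x : V => TangentSpace (𝓡 4) x →L[ℝ] ℝ) u.proj
    have hu : u ∈ t.source := FiberBundle.mem_trivializationAt_proj_source
    have hw : w ∈ t.source := by
      rw [t.mem_source, ← h]
      exact FiberBundle.mem_baseSet_trivializationAt _ _ _
    have hne : t u ≠ t w := fun h => huw (t.injOn hu hw h)
    obtain ⟨A, B, hA, hB, huA, hwB, hAB⟩ := t2_separation hne
    exact ⟨_, _, t.toOpenPartialHomeomorph.isOpen_inter_preimage hA,
      t.toOpenPartialHomeomorph.isOpen_inter_preimage hB, ⟨hu, huA⟩, ⟨hw, hwB⟩,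
      (hAB.preimage _).mono Set.inter_subset_right Set.inter_subset_right⟩
  · have hc : Continuous (fun w : Cotangent V => w.proj) := FiberBundle.continuous_proj _ _
    obtain ⟨A, B, hA, hB, hu, hw, hAB⟩ := t2_separation h
    exact ⟨_, _, hA.preimage hc, hB.preimage hc, hu, hw, hAB.preimage _⟩

/-- The basis of the model space underlying the coordinate frames. -/
def modelBasis : Module.Basis PhaseIndex ℝ PhaseModel :=
  (EuclideanSpace.basisFun (Fin 4) ℝ).toBasis.prod
    ((EuclideanSpace.basisFun (Fin 4) ℝ).toBasis.dualBasis.map LinearMap.toContinuousLinearMap)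

lemma modelBasis_inl (i : Fin 4) :
    modelBasis (Sum.inl i) = ((EuclideanSpace.single i (1 : ℝ), 0) : PhaseModel) := by
  simp [modelBasis]

lemma modelBasis_inr (a : Fin 4) :
    modelBasis (Sum.inr a) = ((0, EuclideanSpace.proj a) : PhaseModel) := by
  ext
  · simp [modelBasis]
  · simp [modelBasis, -Module.Basis.coe_dualBasis, Module.Basis.dualBasis_apply]

lemma modelBasis_repr_inl (w : PhaseModel) (i : Fin 4) :
    modelBasis.repr w (Sum.inl i) = w.1 i := by
  simp [modelBasis]

lemma modelBasis_repr_inr (w : PhaseModel) (a : Fin 4) :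
    modelBasis.repr w (Sum.inr a) = w.2 (EuclideanSpace.single a (1 : ℝ)) := by
  simp [modelBasis]

/-- The coordinate differentials as linear forms. -/
def coordForm (u₀ : Cotangent V) (α : PhaseIndex) (u : Cotangent V) : PhaseTangent u →ₗ[ℝ] ℝ :=
  modelBasis.coord α ∘ₗ ((trivializationAt PhaseModel (fun u : Cotangent V => PhaseTangent u)
    u₀).continuousLinearMapAt ℝ u : PhaseTangent u →ₗ[ℝ] PhaseModel)

lemma coordForm_apply (u₀ : Cotangent V) (α : PhaseIndex) (u : Cotangent V) (v : PhaseTangent u) :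
    coordForm u₀ α u v = coordCoframe u₀ α v := by
  rcases α with i | a
  · exact modelBasis_repr_inl _ _
  · exact modelBasis_repr_inr _ _

lemma mem_coordDomain_self (u : Cotangent V) : u ∈ coordDomain u := mem_chart_source _ u

lemma coordFrame_eq (u₀ : Cotangent V) (α : PhaseIndex) :
    coordFrame u₀ α = fun u => (trivializationAt PhaseModel
      (fun u : Cotangent V => PhaseTangent u) u₀).symm u (modelBasis α) := by
  rcases α with i | a
  · rw [modelBasis_inl]; rfl
  · rw [modelBasis_inr]; rfl

lemma isFrame_coordFrame (u₀ : Cotangent V) :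
    IsFrame (coordFrame u₀) (coordForm u₀) (coordDomain u₀) := by
  have h := isFrame_trivializationAt (I := PhaseI) modelBasis u₀
  rwa [← funext (coordFrame_eq u₀)] at h

lemma mlieBracket_coordFrame {u₀ u : Cotangent V} (hu : u ∈ coordDomain u₀) (α β : PhaseIndex) :
    mlieBracket PhaseI (coordFrame u₀ α) (coordFrame u₀ β) u = 0 :=
  mlieBracket_symm_trivializationAt hu _ _

/-- A tangent vector is vertical if and only if the differentials `dx^i` vanish on it. -/
lemma mfderiv_proj_eq_zero_iff {u₀ u : Cotangent V} (hu : u ∈ coordDomain u₀)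
    (v : PhaseTangent u) :
    mfderiv PhaseI (𝓡 4) (fun w : Cotangent V => w.proj) u v = 0
      ↔ ∀ i, coordCoframe u₀ (Sum.inl i) v = 0 := by
  have h1 := TangentBundle.continuousLinearMapAt_trivializationAt (I := PhaseI) hu
  have hproj : u.proj ∈ (chartAt BaseModel u₀.proj).source := by
    have := hu
    simp only [coordDomain, FiberBundle.chartedSpace_chartAt, mfld_simps] at this
    exact this.2
  have hfst : (fun w : Cotangent V => (extChartAt PhaseI u₀ w).1)
      =ᶠ[𝓝 u] fun w => extChartAt (𝓡 4) u₀.proj w.proj := by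
    refine Eventually.of_forall fun w => ?_
    rw [FiberBundle.extChartAt]
    rfl
  have hproj' : u.proj ∈ (extChartAt (𝓡 4) u₀.proj).source := by simpa using hproj
  have hd : MDifferentiableAt PhaseI (𝓡 4) (fun w : Cotangent V => w.proj) u :=
    mdifferentiableAt_proj _
  have hd' : MDifferentiableAt (𝓡 4) 𝓘(ℝ, BaseModel) (extChartAt (𝓡 4) u₀.proj) u.proj :=
    mdifferentiableAt_extChartAt hproj
  let ψ : BaseModel := mfderiv (𝓡 4) 𝓘(ℝ, BaseModel) (extChartAt (𝓡 4) u₀.proj) u.proj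
    (mfderiv PhaseI (𝓡 4) (fun w : Cotangent V => w.proj) u v)
  have h2 : ∀ i, coordCoframe u₀ (Sum.inl i) v = ψ i := by
    intro i
    have h3 : coordCoframe u₀ (Sum.inl i) v
      = (((trivializationAt PhaseModel (TangentSpace PhaseI : Cotangent V → Type _)
        u₀).continuousLinearMapAt ℝ u v : PhaseModel).1) i := rfl
    have h4 : MDifferentiableAt PhaseI 𝓘(ℝ, PhaseModel) (extChartAt PhaseI u₀) u :=
      mdifferentiableAt_extChartAt hu
    have h5 : HasMFDerivAt 𝓘(ℝ, PhaseModel) 𝓘(ℝ, BaseModel) Prod.fst (extChartAt PhaseI u₀ u)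
        (ContinuousLinearMap.fst ℝ BaseModel FibreModel) :=
      (ContinuousLinearMap.fst ℝ BaseModel FibreModel).hasFDerivAt.hasMFDerivAt
    have h6 := h5.comp u h4.hasMFDerivAt
    have h7 := hasMFDerivAt_unique (h6.congr_of_eventuallyEq hfst.symm)
      (hd'.hasMFDerivAt.comp u hd.hasMFDerivAt)
    rw [h3, h1]
    exact congrArg (fun w : BaseModel => w i) (congrArg (fun A => A v) h7)
  have h6 : ψ = 0 ↔ mfderiv PhaseI (𝓡 4) (fun w : Cotangent V => w.proj) u v = 0 := by
    refine ⟨fun h => ?_, fun h => ?_⟩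
    · refine (isInvertible_mfderiv_extChartAt (I := 𝓡 4) hproj').injective ?_
      rw [map_zero]
      exact h
    · change mfderiv (𝓡 4) 𝓘(ℝ, BaseModel) (extChartAt (𝓡 4) u₀.proj) u.proj _ = _
      rw [h, map_zero]
      rfl
  simp only [← h6, h2]
  exact ⟨fun h i => by rw [h]; rfl, fun h => PiLp.ext h⟩

end Coordinates

/-! ### N-adapted frames, their brackets and Gram matrices -/

section Brackets

variable {E : Type*} [NormedAddCommGroup E] [NormedSpace ℝ E] [CompleteSpace E]
  {H : Type*} [TopologicalSpace H] {I : ModelWithCorners ℝ E H}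
  {M : Type*} [TopologicalSpace M] [ChartedSpace H M] [IsManifold I ∞ M]
  {X Y W : (x : M) → TangentSpace I x} {x : M}

lemma mlieBracket_sum_smul_right {ι : Type*} (s : Finset ι) {f : ι → M → ℝ}
    {Y : ι → (x : M) → TangentSpace I x}
    (hf : ∀ a, MDifferentiableAt I 𝓘(ℝ, ℝ) (f a) x) (hY : ∀ a, VecDiffAt (Y a) x) :
    VecDiffAt (fun w => ∑ a ∈ s, f a w • Y a w) x ∧
    mlieBracket I X (fun w => ∑ a ∈ s, f a w • Y a w) x
      = ∑ a ∈ s, (mvfderiv I (f a) x (X x) • Y a x + f a x • mlieBracket I X (Y a) x) := by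
  classical
  induction s using Finset.induction_on with
  | empty =>
    simp only [Finset.sum_empty]
    exact ⟨(SmoothVecNear.zero (x := x)).mdifferentiableAt,
      congrFun (mlieBracket_zero_right (I := I) (W := X)) x⟩
  | insert a s ha ih =>
    simp only [Finset.sum_insert ha]
    have h1 := (hf a).smul_section (hY a)
    refine ⟨mdifferentiableAt_add_section h1 ih.1, ?_⟩
    have h2 := mlieBracket_add_right (V := X) h1 ih.1
    have h3 := mlieBracket_smul_right (V := X) (hf a) (hY a)
    refine h2.trans ?_
    rw [ih.2]
    exact congrArg₂ _ h3 rfl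

lemma mlieBracket_sub_right (hY : VecDiffAt Y x) (hW : VecDiffAt W x) :
    mlieBracket I X (fun w => Y w - W w) x = mlieBracket I X Y x - mlieBracket I X W x := by
  have h1 := mlieBracket_const_smul_right (V := X) (c := (-1 : ℝ)) hW
  have h2 := mlieBracket_add_right (V := X) (W := Y) (W₁ := (-1 : ℝ) • W) hY
    ((mdifferentiableAt_const (c := (-1 : ℝ))).smul_section hW)
  rw [h1, show Y + (-1 : ℝ) • W = fun w => Y w - W w by ext w; simp [sub_eq_add_neg]] at h2
  rw [h2]
  module

omit [CompleteSpace E] [IsManifold I ∞ M] in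
lemma clm_sum_smul {F : Type*} [AddCommGroup F] [Module ℝ F] [TopologicalSpace F]
    (A : TangentSpace I x →L[ℝ] F) {ι : Type*} (s : Finset ι) (f : ι → ℝ)
    (v : ι → TangentSpace I x) : A (∑ i ∈ s, f i • v i) = ∑ i ∈ s, f i • A (v i) := by
  simp

end Brackets

section Gram

variable {T : Type*} [AddCommGroup T] [Module ℝ T] [TopologicalSpace T] {ι : Type*} [Fintype ι]
  [DecidableEq ι] {B : T →L[ℝ] T →L[ℝ] ℝ} {f : ι → T}

lemma gram_det_ne_zero {A η : Matrix ι ι ℝ} (hη : η.det ≠ 0)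
    (h : ∀ i j, B (∑ k, A i k • f k) (∑ l, A j l • f l) = η i j) :
    (Matrix.of fun i j => B (f i) (f j)).det ≠ 0 := by
  have h1 : A * (Matrix.of fun i j => B (f i) (f j)) * A.transpose = η := by
    ext i j
    rw [← h]
    simp only [Matrix.mul_apply, map_sum, map_smul, sum_apply, smul_apply,
      smul_eq_mul, Matrix.of_apply, Matrix.transpose_apply, Finset.sum_mul, Finset.mul_sum]
    exact Finset.sum_congr rfl fun k _ => Finset.sum_congr rfl fun l _ => by ring
  intro h0
  rw [← h1, Matrix.det_mul, Matrix.det_mul, h0] at hη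
  simp at hη

/-- Coefficients with respect to a basis with invertible Gram matrix. -/
lemma eq_sum_gram_inv (hB : ∀ v w, B v w = B w v)
    (hG : (Matrix.of fun i j => B (f i) (f j)).det ≠ 0) (a : ι → ℝ) {v : T}
    (hv : v = ∑ k, a k • f k) :
    v = ∑ i, (∑ r, (Matrix.of fun i j => B (f i) (f j))⁻¹ i r * B v (f r)) • f i := by
  have h1 := Matrix.nonsing_inv_mul _ (isUnit_iff_ne_zero.2 hG)
  have h2 : ∀ i, ∑ r, (Matrix.of fun i j => B (f i) (f j))⁻¹ i r * B v (f r) = a i := by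
    intro i
    calc _ = ∑ k, a k * ∑ r, (Matrix.of fun i j => B (f i) (f j))⁻¹ i r * B (f r) (f k) := by
          simp only [hv, map_sum, map_smul, sum_apply, smul_apply,
            smul_eq_mul, Finset.mul_sum]
          rw [Finset.sum_comm]
          refine Finset.sum_congr rfl fun k _ => Finset.sum_congr rfl fun r _ => ?_
          rw [hB (f k)]
          ring
      _ = ∑ k, a k * (1 : Matrix ι ι ℝ) i k := by
          simp only [← h1, Matrix.mul_apply, Matrix.of_apply]
      _ = a i := by simp [Matrix.one_apply]
  simp only [h2]
  exact hv

end Gram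

lemma det_minkowski_ne_zero : minkowski.det ≠ 0 := by
  simp [minkowski, Matrix.det_diagonal, Fin.prod_univ_succ]

section NConnections

variable {V : Type*} [TopologicalSpace V] [ChartedSpace BaseModel V] [IsManifold (𝓡 4) ∞ V]
  (N : NConnection V) {u₀ u : Cotangent V}

lemma isSplitting_hor : IsSplitting N.hor where
  idem := N.idem
  smooth := fun {X u} hX => by
    filter_upwards [hX] with w hw
    exact (N.smooth w).clm_bundle_apply hw
  diff := fun {X u} hX => ((N.smooth u).mdifferentiableAt (by simp)).clm_bundle_apply hX

lemma ver_apply (v : PhaseTangent u) : N.ver u v = v - N.hor u v := rfl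

lemma hor_ver (v : PhaseTangent u) : N.hor u (N.ver u v) = 0 := by
  rw [ver_apply, (N.hor u).map_sub, N.idem, sub_self]

lemma hor_eq_zero_iff (hu : u ∈ coordDomain u₀) (v : PhaseTangent u) :
    N.hor u v = 0 ↔ ∀ i, coordForm u₀ (Sum.inl i) u v = 0 := by
  simp only [N.ker_iff, mfderiv_proj_eq_zero_iff hu, coordForm_apply]

lemma coordForm_hor_inl (hu : u ∈ coordDomain u₀) (i : Fin 4) (v : PhaseTangent u) :
    coordForm u₀ (Sum.inl i) u (N.hor u v) = coordForm u₀ (Sum.inl i) u v := by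
  have h := (hor_eq_zero_iff N hu _).1 (hor_ver N v) i
  rw [ver_apply, map_sub, sub_eq_zero] at h
  exact h.symm

lemma frame_inr (a : Fin 4) : N.frame u₀ (Sum.inr a) = coordFrame u₀ (Sum.inr a) := rfl

lemma frame_inl_apply (i : Fin 4) : N.frame u₀ (Sum.inl i) u = coordFrame u₀ (Sum.inl i) u
    - ∑ a, N.coeff u₀ i a u • coordFrame u₀ (Sum.inr a) u := rfl

lemma hor_frame_inr (hu : u ∈ coordDomain u₀) (a : Fin 4) :
    N.hor u (N.frame u₀ (Sum.inr a) u) = 0 := by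
  rw [hor_eq_zero_iff N hu, frame_inr]
  intro i
  simp [(isFrame_coordFrame u₀).dual hu]

/-- The vectors `e_i` are the horizontal lifts of the coordinate vectors `∂/∂x^i`. -/
lemma frame_inl_eq_hor (hu : u ∈ coordDomain u₀) (i : Fin 4) :
    N.frame u₀ (Sum.inl i) u = N.hor u (coordFrame u₀ (Sum.inl i) u) := by
  have h1 := (isFrame_coordFrame u₀).expand hu (N.ver u (coordFrame u₀ (Sum.inl i) u))
  rw [Fintype.sum_sum_type] at h1
  have h2 := (hor_eq_zero_iff N hu _).1 (hor_ver N (coordFrame u₀ (Sum.inl i) u))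
  simp only [h2, zero_smul, Finset.sum_const_zero, zero_add] at h1
  rw [frame_inl_apply]
  refine (sub_eq_iff_eq_add).2 ?_
  simp only [NConnection.coeff, ← coordForm_apply]
  rw [← h1, ver_apply]
  abel

lemma hor_frame_inl (hu : u ∈ coordDomain u₀) (i : Fin 4) :
    N.hor u (N.frame u₀ (Sum.inl i) u) = N.frame u₀ (Sum.inl i) u := by
  rw [frame_inl_eq_hor N hu, N.idem]

lemma coeff_smoothFunNear (hu : u ∈ coordDomain u₀) (i a : Fin 4) :
    SmoothFunNear PhaseI (N.coeff u₀ i a) u := by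
  have h1 := (isSplitting_hor N).smooth' ((isFrame_coordFrame u₀).smooth (Sum.inl i) hu)
  refine ((isFrame_coordFrame u₀).coeff_smooth (Sum.inr a) hu h1).congr ?_
  exact Eventually.of_forall fun w => by
    rw [coordForm_apply]
    rfl

/-- The N-adapted coframe as linear forms. -/
def frameForm (u₀ : Cotangent V) (α : PhaseIndex) (u : Cotangent V) : PhaseTangent u →ₗ[ℝ] ℝ :=
  Sum.elim (fun i => coordForm u₀ (Sum.inl i) u) (fun a => coordForm u₀ (Sum.inr a) u
    + ∑ i, N.coeff u₀ i a u • coordForm u₀ (Sum.inl i) u) α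

lemma frameForm_apply (u₀ : Cotangent V) (α : PhaseIndex) (u : Cotangent V) (v : PhaseTangent u) :
    frameForm N u₀ α u v = N.coframe u₀ α v := by
  rcases α with i | a <;> simp [frameForm, NConnection.coframe, coordForm_apply]

lemma isFrame_frame (u₀ : Cotangent V) :
    IsFrame (N.frame u₀) (frameForm N u₀) (coordDomain u₀) where
  isOpen := (isFrame_coordFrame u₀).isOpen
  smooth := by
    intro α u hu
    rcases α with i | a
    · exact ((isFrame_coordFrame u₀).smooth _ hu).sub (.sum fun a _ =>
        ((isFrame_coordFrame u₀).smooth _ hu).smul (coeff_smoothFunNear N hu i a))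
    · exact (isFrame_coordFrame u₀).smooth _ hu
  coeff_smooth := by
    intro α X u hu hX
    have h := fun β => (isFrame_coordFrame u₀).coeff_smooth β hu hX
    rcases α with i | a
    · exact h _
    · refine ((h (Sum.inr a)).add (.sum (s := Finset.univ) fun i _ =>
        (coeff_smoothFunNear N hu i a).mul (h (Sum.inl i)))).congr ?_
      exact Eventually.of_forall fun w => by simp [frameForm]
  coeff_diff := by
    intro α X u hu hX
    have h := fun β => (isFrame_coordFrame u₀).coeff_diff β hu hX
    rcases α with i | a
    · exact h _
    · have h1 : MDifferentiableAt PhaseI 𝓘(ℝ, ℝ) (∑ i, fun w => N.coeff u₀ i a w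
          * coordForm u₀ (Sum.inl i) w (X w)) u :=
        .sum fun i _ => (coeff_smoothFunNear N hu i a).mdifferentiableAt.mul (h (Sum.inl i))
      refine ((h (Sum.inr a)).add h1).congr_of_eventuallyEq (Eventually.of_forall fun w => ?_)
      simp [frameForm]
  expand := by
    intro u hu v
    have h1 := (isFrame_coordFrame u₀).expand hu v
    rw [Fintype.sum_sum_type] at h1 ⊢
    simp only [frameForm, Sum.elim_inl, Sum.elim_inr, frame_inr, frame_inl_apply, smul_sub,
      LinearMap.add_apply, LinearMap.sum_apply, LinearMap.smul_apply, add_smul, Finset.sum_smul,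
      Finset.smul_sum, Finset.sum_sub_distrib, Finset.sum_add_distrib, smul_smul, smul_eq_mul]
    conv_lhs => rw [h1]
    rw [Finset.sum_comm (f := fun i a => (coordForm u₀ (Sum.inl i) u v * N.coeff u₀ i a u) •
      coordFrame u₀ (Sum.inr a) u)]
    simp only [mul_comm (N.coeff _ _ _ _)]
    abel
  dual := by
    intro u hu α β
    have h := (isFrame_coordFrame u₀).dual hu
    rcases α with i | a <;> rcases β with j | b <;>
      simp [frameForm, frame_inr, frame_inl_apply, h, Finset.sum_ite_eq]

lemma frameForm_inl_hor (hu : u ∈ coordDomain u₀) (i : Fin 4) (v : PhaseTangent u) :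
    frameForm N u₀ (Sum.inl i) u (N.hor u v) = frameForm N u₀ (Sum.inl i) u v :=
  coordForm_hor_inl N hu i v

lemma hor_eq_sum (hu : u ∈ coordDomain u₀) (v : PhaseTangent u) :
    N.hor u v = ∑ i, frameForm N u₀ (Sum.inl i) u v • N.frame u₀ (Sum.inl i) u := by
  conv_lhs => rw [(isFrame_frame N u₀).expand hu v, Fintype.sum_sum_type]
  rw [(N.hor u).map_add, clm_sum_smul, clm_sum_smul]
  simp only [hor_frame_inl N hu, hor_frame_inr N hu, smul_zero, Finset.sum_const_zero, add_zero]

lemma ver_eq_sum (hu : u ∈ coordDomain u₀) (v : PhaseTangent u) :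
    N.ver u v = ∑ a, frameForm N u₀ (Sum.inr a) u v • N.frame u₀ (Sum.inr a) u := by
  rw [ver_apply, hor_eq_sum N hu]
  conv_lhs => enter [1]; rw [(isFrame_frame N u₀).expand hu v, Fintype.sum_sum_type]
  abel

lemma frameForm_inr_hor (hu : u ∈ coordDomain u₀) (a : Fin 4) (v : PhaseTangent u) :
    frameForm N u₀ (Sum.inr a) u (N.hor u v) = 0 := by
  simp [hor_eq_sum N hu, (isFrame_frame N u₀).dual hu]

/-- The brackets `[e_i, ∂_β]` of the N-adapted frame with the coordinate frame. -/
lemma mlieBracket_frame_coordFrame (hu : u ∈ coordDomain u₀) (i : Fin 4) (β : PhaseIndex) :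
    mlieBracket PhaseI (N.frame u₀ (Sum.inl i)) (coordFrame u₀ β) u
      = ∑ a, dirDeriv (N.coeff u₀ i a) (coordFrame u₀ β u) • N.frame u₀ (Sum.inr a) u := by
  have hs := fun γ => ((isFrame_coordFrame u₀).smooth γ hu).mdifferentiableAt
  have hN := fun a => (coeff_smoothFunNear N hu i a).mdifferentiableAt
  have h1 := mlieBracket_sum_smul_right (X := coordFrame u₀ β) Finset.univ hN
    (fun a => hs (Sum.inr a))
  rw [mlieBracket_swap_apply, show N.frame u₀ (Sum.inl i) = fun w => coordFrame u₀ (Sum.inl i) w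
    - ∑ a, N.coeff u₀ i a w • coordFrame u₀ (Sum.inr a) w from rfl,
    mlieBracket_sub_right (hs _) h1.1, h1.2, mlieBracket_coordFrame hu]
  simp [mlieBracket_coordFrame hu, dirDeriv, frame_inr]

lemma mlieBracket_frame_inl_inr (hu : u ∈ coordDomain u₀) (i b : Fin 4) :
    mlieBracket PhaseI (N.frame u₀ (Sum.inl i)) (N.frame u₀ (Sum.inr b)) u
      = ∑ a, dirDeriv (N.coeff u₀ i a) (N.frame u₀ (Sum.inr b) u) • N.frame u₀ (Sum.inr a) u :=
  mlieBracket_frame_coordFrame N hu i _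

lemma mlieBracket_frame_inr_inr (hu : u ∈ coordDomain u₀) (a b : Fin 4) :
    mlieBracket PhaseI (N.frame u₀ (Sum.inr a)) (N.frame u₀ (Sum.inr b)) u = 0 :=
  mlieBracket_coordFrame hu _ _

lemma mlieBracket_frame_inl_inl (hu : u ∈ coordDomain u₀) (i j : Fin 4) :
    mlieBracket PhaseI (N.frame u₀ (Sum.inl i)) (N.frame u₀ (Sum.inl j)) u
      = ∑ a, N.omega u₀ i j a u • N.frame u₀ (Sum.inr a) u := by
  have hs := fun γ => ((isFrame_coordFrame u₀).smooth γ hu).mdifferentiableAt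
  have hN := fun a => (coeff_smoothFunNear N hu j a).mdifferentiableAt
  have h1 := mlieBracket_sum_smul_right (X := N.frame u₀ (Sum.inl i)) Finset.univ hN
    (fun a => hs (Sum.inr a))
  rw [show N.frame u₀ (Sum.inl j) = fun w => coordFrame u₀ (Sum.inl j) w
    - ∑ a, N.coeff u₀ j a w • coordFrame u₀ (Sum.inr a) w from rfl,
    mlieBracket_sub_right (hs _) h1.1, h1.2]
  simp only [mlieBracket_frame_coordFrame N hu, frame_inl_apply, map_sub, map_sum, map_smul,
    smul_eq_mul, NConnection.omega, dirDeriv, frame_inr, Finset.smul_sum, smul_smul,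
    Finset.sum_add_distrib, sub_smul, add_smul, Finset.sum_smul, Finset.sum_sub_distrib]
  rw [Finset.sum_comm (f := fun x y => (N.coeff u₀ j x u * _) • coordFrame u₀ (Sum.inr y) u)]
  abel

end NConnections

/-! ### Derivatives of adapted fields and comparison of connections -/

section AdaptedFields

variable {E : Type*} [NormedAddCommGroup E] [NormedSpace ℝ E]
  {H : Type*} [TopologicalSpace H] {I : ModelWithCorners ℝ E H}
  {M : Type*} [TopologicalSpace M] [ChartedSpace H M] [IsManifold I ∞ M]
  {h : (x : M) → TangentSpace I x →L[ℝ] TangentSpace I x}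
  {g : (x : M) → TangentSpace I x →L[ℝ] TangentSpace I x →L[ℝ] ℝ}
  {X Y W X' Y' W' : (x : M) → TangentSpace I x} {x : M}

omit [IsManifold I ∞ M] in
lemma bilin_sum_smul {F : Type*} [AddCommGroup F] [Module ℝ F] [TopologicalSpace F]
    [IsTopologicalAddGroup F] [ContinuousConstSMul ℝ F]
    (B : TangentSpace I x →L[ℝ] TangentSpace I x →L[ℝ] F) {ι : Type*} (s : Finset ι) (f : ι → ℝ)
    (v : ι → TangentSpace I x) (w : TangentSpace I x) :
    B (∑ i ∈ s, f i • v i) w = ∑ i ∈ s, f i • B (v i) w := by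
  simp

omit [IsManifold I ∞ M] in
lemma mvfderiv_congr {f f' : M → ℝ} (hf : ∀ᶠ w in 𝓝 x, f w = f' w) :
    mvfderiv I f x = mvfderiv I f' x := by
  have h1 := Filter.EventuallyEq.mfderiv_eq (I := I) (I' := 𝓘(ℝ, ℝ)) hf
  ext v
  exact congrArg (fun A : E →L[ℝ] ℝ => A v) h1

omit [IsManifold I ∞ M] in
lemma koszul_congr (hX : ∀ᶠ w in 𝓝 x, X w = X' w) (hY : ∀ᶠ w in 𝓝 x, Y w = Y' w)
    (hW : ∀ᶠ w in 𝓝 x, W w = W' w) : koszul g X Y W x = koszul g X' Y' W' x := by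
  have h1 : ∀ {A A' B B' : (x : M) → TangentSpace I x}, (∀ᶠ w in 𝓝 x, A w = A' w) →
      (∀ᶠ w in 𝓝 x, B w = B' w) → mvfderiv I (fun w => g w (A w) (B w)) x
        = mvfderiv I (fun w => g w (A' w) (B' w)) x := by
    intro A A' B B' hA hB
    refine mvfderiv_congr ?_
    filter_upwards [hA, hB] with w hAw hBw
    rw [hAw, hBw]
  simp only [koszul, h1 hX hY, h1 hX hW, h1 hY hW, hX.self_of_nhds, hY.self_of_nhds,
    hW.self_of_nhds, Filter.EventuallyEq.mlieBracket_vectorField_eq hX hY,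
    Filter.EventuallyEq.mlieBracket_vectorField_eq hX hW,
    Filter.EventuallyEq.mlieBracket_vectorField_eq hY hW]

namespace IsBlockMetric

variable [FiniteDimensional ℝ E] [CompleteSpace E] (hg : IsBlockMetric h g)

include hg

omit [FiniteDimensional ℝ E] [CompleteSpace E] in
lemma apply_eq_zero {v w : TangentSpace I x} (hv : h x v = v) (hw : h x w = 0) : g x v w = 0 := by
  rw [← hv, ← hg.adjoint, hw, map_zero]

omit [FiniteDimensional ℝ E] [CompleteSpace E] in
lemma apply_eq_zero' {v w : TangentSpace I x} (hv : h x v = 0) (hw : h x w = w) :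
    g x v w = 0 := by
  rw [hg.metric.symm, hg.apply_eq_zero hw hv]

omit [FiniteDimensional ℝ E] [CompleteSpace E] in
lemma mvfderiv_eq_zero (hY : ∀ᶠ w in 𝓝 x, h w (Y w) = Y w) (hW : ∀ᶠ w in 𝓝 x, h w (W w) = 0) :
    mvfderiv I (fun w => g w (Y w) (W w)) x = 0 ∧
      mvfderiv I (fun w => g w (W w) (Y w)) x = 0 := by
  constructor
  · refine (mvfderiv_congr (f' := fun _ => 0) ?_).trans (mvfderiv_const 0)
    filter_upwards [hY, hW] with w hYw hWw using hg.apply_eq_zero hYw hWw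
  · refine (mvfderiv_congr (f' := fun _ => 0) ?_).trans (mvfderiv_const 0)
    filter_upwards [hY, hW] with w hYw hWw using hg.apply_eq_zero' hWw hYw

omit [CompleteSpace E] in
lemma koszul_zero (hX : VecDiffAt X x) : koszul g X (fun _ => 0) (fun _ => 0) x = 0 := by
  have h0 : VecDiffAt (I := I) (fun _ => 0) x := (SmoothVecNear.zero (x := x)).mdifferentiableAt
  have := hg.metric.koszul_smul_right (f := fun _ => 0) mdifferentiableAt_const hX h0 h0
  have h1 : ((fun _ => 0 : M → ℝ) • fun x : M => (0 : TangentSpace I x)) = fun _ => 0 :=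
    funext fun w => smul_zero _
  rw [h1] at this
  exact this.trans (zero_mul _)

/-- The Koszul formula for derivatives of horizontal fields. -/
lemma koszul_of_hor (hX : VecDiffAt X x) (hY : VecDiffAt Y x) (hW : VecDiffAt W x)
    (hYh : ∀ᶠ w in 𝓝 x, h w (Y w) = Y w) (hWh : ∀ᶠ w in 𝓝 x, h w (W w) = W w) :
    2 * g x (hg.adaptedConnection Y x (X x)) (W x)
      = koszul g X Y W x + g x (X x - h x (X x)) (mlieBracket I Y W x) := by
  rw [hg.adaptedConnection_koszul hX hY hW, koszul_congr (Eventually.of_forall fun _ => rfl) hYh hWh,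
    Filter.EventuallyEq.mlieBracket_vectorField_eq hYh hWh,
    koszul_congr (Eventually.of_forall fun _ => rfl)
      (hYh.mono fun w hw => (sub_eq_zero.2 hw.symm : Y w - h w (Y w) = (fun _ => 0) w))
      (hWh.mono fun w hw => (sub_eq_zero.2 hw.symm : W w - h w (W w) = (fun _ => 0) w)),
    hg.koszul_zero hX, add_zero]

/-- The Koszul formula for derivatives of vertical fields. -/
lemma koszul_of_ver (hX : VecDiffAt X x) (hY : VecDiffAt Y x) (hW : VecDiffAt W x)
    (hYv : ∀ᶠ w in 𝓝 x, h w (Y w) = 0) (hWv : ∀ᶠ w in 𝓝 x, h w (W w) = 0) :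
    2 * g x (hg.adaptedConnection Y x (X x)) (W x) = koszul g X Y W x := by
  have h0 : mlieBracket I (fun w => h w (Y w)) (fun w => h w (W w)) x = 0 := by
    rw [Filter.EventuallyEq.mlieBracket_vectorField_eq (W₁ := fun w => h w (W w)) (W := 0)
      (V₁ := fun w => h w (Y w)) (V := 0) hYv hWv]
    simp
  rw [hg.adaptedConnection_koszul hX hY hW, h0, map_zero, add_zero,
    koszul_congr (Y' := fun _ => 0) (W' := fun _ => 0) (Eventually.of_forall fun _ => rfl) hYv hWv,
    hg.koszul_zero hX, zero_add]
  refine koszul_congr (Eventually.of_forall fun _ => rfl) ?_ ?_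
  · filter_upwards [hYv] with w hw using by rw [hw, sub_zero]
  · filter_upwards [hWv] with w hw using by rw [hw, sub_zero]

lemma adaptedConnection_hor_hor_hor (hX : VecDiffAt X x) (hY : VecDiffAt Y x)
    (hW : VecDiffAt W x) (hXh : ∀ᶠ w in 𝓝 x, h w (X w) = X w)
    (hYh : ∀ᶠ w in 𝓝 x, h w (Y w) = Y w) (hWh : ∀ᶠ w in 𝓝 x, h w (W w) = W w)
    (hXY : h x (mlieBracket I X Y x) = 0) (hXW : h x (mlieBracket I X W x) = 0)
    (hYW : h x (mlieBracket I Y W x) = 0) :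
    2 * g x (hg.adaptedConnection Y x (X x)) (W x)
      = mvfderiv I (fun w => g w (Y w) (W w)) x (X x)
        + mvfderiv I (fun w => g w (X w) (W w)) x (Y x)
        - mvfderiv I (fun w => g w (X w) (Y w)) x (W x) := by
  rw [hg.koszul_of_hor hX hY hW hYh hWh, koszul, hXh.self_of_nhds,
    hg.apply_eq_zero' hXY hWh.self_of_nhds, hg.apply_eq_zero' hXW hYh.self_of_nhds,
    hg.apply_eq_zero' hYW hXh.self_of_nhds]
  simp

lemma adaptedConnection_ver_hor_hor (hX : VecDiffAt X x) (hY : VecDiffAt Y x)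
    (hW : VecDiffAt W x) (hXv : ∀ᶠ w in 𝓝 x, h w (X w) = 0)
    (hYh : ∀ᶠ w in 𝓝 x, h w (Y w) = Y w) (hWh : ∀ᶠ w in 𝓝 x, h w (W w) = W w)
    (hXY : h x (mlieBracket I X Y x) = 0) (hXW : h x (mlieBracket I X W x) = 0) :
    2 * g x (hg.adaptedConnection Y x (X x)) (W x)
      = mvfderiv I (fun w => g w (Y w) (W w)) x (X x) := by
  rw [hg.koszul_of_hor hX hY hW hYh hWh, koszul, hXv.self_of_nhds,
    hg.apply_eq_zero' hXY hWh.self_of_nhds, hg.apply_eq_zero' hXW hYh.self_of_nhds,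
    (hg.mvfderiv_eq_zero hYh hXv).2, (hg.mvfderiv_eq_zero hWh hXv).2,
    hg.metric.symm x (X x - 0)]
  simp

lemma adaptedConnection_hor_ver_ver (hX : VecDiffAt X x) (hY : VecDiffAt Y x)
    (hW : VecDiffAt W x) (hXh : ∀ᶠ w in 𝓝 x, h w (X w) = X w)
    (hYv : ∀ᶠ w in 𝓝 x, h w (Y w) = 0) (hWv : ∀ᶠ w in 𝓝 x, h w (W w) = 0)
    (hYW : h x (mlieBracket I Y W x) = 0) :
    2 * g x (hg.adaptedConnection Y x (X x)) (W x)
      = mvfderiv I (fun w => g w (Y w) (W w)) x (X x)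
        + g x (mlieBracket I X Y x) (W x) - g x (mlieBracket I X W x) (Y x) := by
  rw [hg.koszul_of_ver hX hY hW hYv hWv, koszul,
    hg.apply_eq_zero' hYW hXh.self_of_nhds, (hg.mvfderiv_eq_zero hXh hYv).1,
    (hg.mvfderiv_eq_zero hXh hWv).1]
  simp

lemma adaptedConnection_ver_ver_ver (hX : VecDiffAt X x) (hY : VecDiffAt Y x)
    (hW : VecDiffAt W x) (hYv : ∀ᶠ w in 𝓝 x, h w (Y w) = 0) (hWv : ∀ᶠ w in 𝓝 x, h w (W w) = 0)
    (hXY : mlieBracket I X Y x = 0) (hXW : mlieBracket I X W x = 0)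
    (hYW : mlieBracket I Y W x = 0) :
    2 * g x (hg.adaptedConnection Y x (X x)) (W x)
      = mvfderiv I (fun w => g w (Y w) (W w)) x (X x)
        + mvfderiv I (fun w => g w (X w) (W w)) x (Y x)
        - mvfderiv I (fun w => g w (X w) (Y w)) x (W x) := by
  rw [hg.koszul_of_ver hX hY hW hYv hWv, koszul, hXY, hXW, hYW]
  simp

end IsBlockMetric

/-- Two connections that agree on a frame agree on all differentiable fields. -/
lemma IsFrame.cov_eq [FiniteDimensional ℝ E] {ι : Type*} [Fintype ι] [DecidableEq ι]
    {s : ι → (x : M) → TangentSpace I x} {c : ι → (x : M) → TangentSpace I x →ₗ[ℝ] ℝ} {U : Set M}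
    (hs : IsFrame s c U) (hx : x ∈ U)
    {D D' : CovariantDerivative I E (TangentSpace I : M → Type _)}
    (h : ∀ i j, D (s i) x (s j x) = D' (s i) x (s j x)) (hY : VecDiffAt Y x) :
    D Y x = D' Y x := by
  have key : ∀ {Y : (x : M) → TangentSpace I x}, VecDiffAt Y x →
      IsCovariantDerivativeOn.difference D.isCovariantDerivativeOnUniv
        D'.isCovariantDerivativeOnUniv x (Y x) = D Y x - D' Y x :=
    fun hY => IsCovariantDerivativeOn.difference_apply _ _ (Set.mem_univ x) hY
  have hfr : ∀ i, D (s i) x = D' (s i) x := by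
    intro i
    ext v
    rw [hs.expand hx v, map_sum, map_sum]
    simp only [map_smul, h]
  rw [← sub_eq_zero, ← key hY, hs.expand hx (Y x), map_sum]
  refine Finset.sum_eq_zero fun i _ => ?_
  rw [map_smul, key (hs.smooth i hx).mdifferentiableAt, hfr, sub_self, smul_zero]

end AdaptedFields

/-! ### The canonical Hamilton d-connection -/

section PhaseMetric

variable {V : Type*} [TopologicalSpace V] [ChartedSpace BaseModel V] [IsManifold (𝓡 4) ∞ V]

lemma smoothFunNear_of_contMDiffOn {u₀ u : Cotangent V} (hu : u ∈ coordDomain u₀)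
    {f : Cotangent V → ℝ} (hf : ContMDiffOn PhaseI 𝓘(ℝ, ℝ) ∞ f (coordDomain u₀)) :
    SmoothFunNear PhaseI f u := by
  filter_upwards [(isFrame_coordFrame u₀).isOpen.mem_nhds hu] with w hw
  exact hf.contMDiffAt ((isFrame_coordFrame u₀).isOpen.mem_nhds hw)

/-- A field of bilinear forms with smooth components has smooth values on smooth fields. -/
lemma smoothFunNear_bilin {T : BilinField V} (hT : T.Smooth) {X Y : PhaseField V}
    {u : Cotangent V} (hX : SmoothVecNear X u) (hY : SmoothVecNear Y u) :
    SmoothFunNear PhaseI (fun w => T w (X w) (Y w)) u := by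
  have hs := isFrame_coordFrame u
  have hu := mem_coordDomain_self u
  refine (SmoothFunNear.sum (s := Finset.univ) fun α _ =>
    (SmoothFunNear.sum (s := Finset.univ) fun β _ =>
      ((hs.coeff_smooth α hu hX).mul (hs.coeff_smooth β hu hY)).mul
        (smoothFunNear_of_contMDiffOn hu (hT u α β)))).congr ?_
  filter_upwards [hs.mem_nhds hu] with w hw
  conv_lhs => rw [hs.expand hw (X w), hs.expand hw (Y w), bilin_sum_smul]
  refine Finset.sum_congr rfl fun α _ => ?_
  rw [clm_sum_smul, Finset.smul_sum]
  exact Finset.sum_congr rfl fun β _ => by simp only [smul_eq_mul]; ring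

variable {N : NConnection V} (g : DMetric N) {u₀ u : Cotangent V}

lemma val_hor_right (v w : PhaseTangent u) :
    g.val u v (N.hor u w) = g.val u (N.hor u v) (N.hor u w) := by
  have h1 := g.block u w v
  rw [g.symm, ver_apply, (g.val u).map_sub, sub_apply] at h1
  linarith

lemma val_adjoint (v w : PhaseTangent u) :
    g.val u v (N.hor u w) = g.val u (N.hor u v) w := by
  rw [val_hor_right, g.symm u (N.hor u v) w, val_hor_right g w v, g.symm]

lemma gh_det_ne_zero (hu : u ∈ coordDomain u₀) :
    (Matrix.of fun i j => g.gh u₀ i j u).det ≠ 0 := by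
  obtain ⟨e, he, hη⟩ := g.sig_hor u
  refine gram_det_ne_zero (B := g.val u) (f := fun i => N.frame u₀ (Sum.inl i) u)
    (A := Matrix.of fun i k => frameForm N u₀ (Sum.inl k) u (e i)) det_minkowski_ne_zero ?_
  intro i j
  simp only [Matrix.of_apply, ← hor_eq_sum N hu, he, hη]

lemma gv_det_ne_zero (hu : u ∈ coordDomain u₀) :
    (Matrix.of fun a b => g.gv u₀ a b u).det ≠ 0 := by
  obtain ⟨e, he, hη⟩ := g.sig_ver u
  refine gram_det_ne_zero (B := g.val u) (f := fun a => N.frame u₀ (Sum.inr a) u)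
    (A := Matrix.of fun a b => frameForm N u₀ (Sum.inr b) u (e a)) det_minkowski_ne_zero ?_
  intro i j
  simp only [Matrix.of_apply, ← ver_eq_sum N hu, he, hη]

/-- A horizontal vector in terms of its scalar products with the vectors `e_i`. -/
lemma eq_sum_ghInv (hu : u ∈ coordDomain u₀) {v : PhaseTangent u} (hv : N.hor u v = v) :
    v = ∑ i, (∑ r, g.ghInv u₀ i r u * g.val u v (N.frame u₀ (Sum.inl r) u))
      • N.frame u₀ (Sum.inl i) u :=
  eq_sum_gram_inv (g.symm u) (gh_det_ne_zero g hu) _ (hv.symm.trans (hor_eq_sum N hu v))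

/-- A covertical vector in terms of its scalar products with the vectors `e^a`. -/
lemma eq_sum_gvInv (hu : u ∈ coordDomain u₀) {v : PhaseTangent u} (hv : N.hor u v = 0) :
    v = ∑ a, (∑ c, g.gvInv u₀ a c u * g.val u v (N.frame u₀ (Sum.inr c) u))
      • N.frame u₀ (Sum.inr a) u := by
  refine eq_sum_gram_inv (g.symm u) (gv_det_ne_zero g hu) _ (Eq.trans ?_ (ver_eq_sum N hu v))
  rw [ver_apply, hv, sub_zero]

lemma isPseudoMetric_val : IsPseudoMetric g.val where
  smooth := smoothFunNear_bilin g.smooth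
  symm := g.symm
  nondeg := by
    intro u v hv
    have h1 : N.hor u v = 0 := by
      have hu := mem_coordDomain_self u
      rw [eq_sum_ghInv g hu (N.idem u v)]
      simp only [← val_adjoint, hv, mul_zero, Finset.sum_const_zero, zero_smul]
    have hu := mem_coordDomain_self u
    rw [eq_sum_gvInv g hu h1]
    simp only [hv, mul_zero, Finset.sum_const_zero, zero_smul]

lemma isBlockMetric_val : IsBlockMetric N.hor g.val where
  split := isSplitting_hor N
  metric := isPseudoMetric_val g
  adjoint _ := val_adjoint g

/-- The canonical Hamilton d-connection. -/
def canonicalConnection : PhaseConnection V := (isBlockMetric_val g).adaptedConnection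

variable {g}

lemma frame_vecDiffAt (hu : u ∈ coordDomain u₀) (α : PhaseIndex) :
    VecDiffAt (N.frame u₀ α) u :=
  ((isFrame_frame N u₀).smooth α hu).mdifferentiableAt

lemma eventually_hor_frame_inl (hu : u ∈ coordDomain u₀) (i : Fin 4) :
    ∀ᶠ w in 𝓝 u, N.hor w (N.frame u₀ (Sum.inl i) w) = N.frame u₀ (Sum.inl i) w :=
  ((isFrame_frame N u₀).mem_nhds hu).mono fun _ hw => hor_frame_inl N hw i

lemma eventually_hor_frame_inr (hu : u ∈ coordDomain u₀) (a : Fin 4) :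
    ∀ᶠ w in 𝓝 u, N.hor w (N.frame u₀ (Sum.inr a) w) = 0 :=
  ((isFrame_frame N u₀).mem_nhds hu).mono fun _ hw => hor_frame_inr N hw a

lemma hor_sum_frame_inr (hu : u ∈ coordDomain u₀) (f : Fin 4 → ℝ) :
    N.hor u (∑ a, f a • N.frame u₀ (Sum.inr a) u) = 0 := by
  rw [clm_sum_smul]
  simp only [hor_frame_inr N hu, smul_zero, Finset.sum_const_zero]

lemma hor_mlieBracket_inl_inl (hu : u ∈ coordDomain u₀) (i j : Fin 4) :
    N.hor u (mlieBracket PhaseI (N.frame u₀ (Sum.inl i)) (N.frame u₀ (Sum.inl j)) u) = 0 := by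
  rw [mlieBracket_frame_inl_inl N hu, hor_sum_frame_inr hu]

lemma hor_mlieBracket_inl_inr (hu : u ∈ coordDomain u₀) (i b : Fin 4) :
    N.hor u (mlieBracket PhaseI (N.frame u₀ (Sum.inl i)) (N.frame u₀ (Sum.inr b)) u) = 0 := by
  rw [mlieBracket_frame_inl_inr N hu, hor_sum_frame_inr hu]

lemma hor_mlieBracket_inr_inl (hu : u ∈ coordDomain u₀) (b i : Fin 4) :
    N.hor u (mlieBracket PhaseI (N.frame u₀ (Sum.inr b)) (N.frame u₀ (Sum.inl i)) u) = 0 := by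
  rw [mlieBracket_swap_apply, (N.hor u).map_neg, hor_mlieBracket_inl_inr hu, neg_zero]

lemma gh_comm (i j : Fin 4) : g.gh u₀ i j = g.gh u₀ j i := funext fun w => g.symm w _ _

lemma gv_comm (a b : Fin 4) : g.gv u₀ a b = g.gv u₀ b a := funext fun w => g.symm w _ _

lemma canonicalConnection_hor {Y : PhaseField V} (hY : VecDiffAt Y u)
    (hYh : ∀ᶠ w in 𝓝 u, N.hor w (Y w) = Y w) (x : PhaseTangent u) :
    N.hor u (canonicalConnection g Y u x) = canonicalConnection g Y u x := by
  have h1 := (isBlockMetric_val g).adaptedConnection_hor Y x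
  have h2 := cov_congr (D := canonicalConnection g) ((isSplitting_hor N).diff hY) hY hYh
  exact h1.symm.trans (congrArg (fun A => A x) h2)

lemma canonicalConnection_ver {Y : PhaseField V} (hY : VecDiffAt Y u)
    (hYv : ∀ᶠ w in 𝓝 u, N.hor w (Y w) = 0) (x : PhaseTangent u) :
    N.hor u (canonicalConnection g Y u x) = 0 := by
  have h1 := (isBlockMetric_val g).adaptedConnection_hor Y x
  have h2 := cov_congr (D := canonicalConnection g) (Y := 0) ((isSplitting_hor N).diff hY)
    (SmoothVecNear.zero (x := u)).mdifferentiableAt hYv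
  have h3 := h2.trans (congr_fun (canonicalConnection g).zero u)
  exact h1.symm.trans (congrArg (fun A => A x) h3)

lemma mvfderiv_gh (i j : Fin 4) (v : PhaseTangent u) :
    mvfderiv PhaseI (fun w => g.val w (N.frame u₀ (Sum.inl i) w) (N.frame u₀ (Sum.inl j) w)) u v
      = dirDeriv (g.gh u₀ i j) v := rfl

lemma mvfderiv_gv (a b : Fin 4) (v : PhaseTangent u) :
    mvfderiv PhaseI (fun w => g.val w (N.frame u₀ (Sum.inr a) w) (N.frame u₀ (Sum.inr b) w)) u v
      = dirDeriv (g.gv u₀ a b) v := rfl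

lemma canonicalConnection_inl_inl (hu : u ∈ coordDomain u₀) (j k : Fin 4) :
    canonicalConnection g (N.frame u₀ (Sum.inl j)) u (N.frame u₀ (Sum.inl k) u)
      = ∑ i, g.Lh u₀ i j k u • N.frame u₀ (Sum.inl i) u := by
  have hd := fun α => frame_vecDiffAt (N := N) hu α
  have hh := fun i => eventually_hor_frame_inl (N := N) hu i
  rw [eq_sum_ghInv g hu (canonicalConnection_hor (hd (Sum.inl j)) (hh j) _)]
  refine Finset.sum_congr rfl fun i _ => congrArg (· • _) ?_
  rw [DMetric.Lh, Finset.mul_sum]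
  refine Finset.sum_congr rfl fun r _ => ?_
  have h1 : 2 * g.val u (canonicalConnection g (N.frame u₀ (Sum.inl j)) u
      (N.frame u₀ (Sum.inl k) u)) (N.frame u₀ (Sum.inl r) u) = _ :=
    (isBlockMetric_val g).adaptedConnection_hor_hor_hor (hd (Sum.inl k)) (hd (Sum.inl j))
      (hd (Sum.inl r)) (hh k) (hh j) (hh r) (hor_mlieBracket_inl_inl hu _ _)
      (hor_mlieBracket_inl_inl hu _ _) (hor_mlieBracket_inl_inl hu _ _)
  rw [mvfderiv_gh, mvfderiv_gh, mvfderiv_gh, gh_comm k j] at h1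
  linear_combination (1 / 2 * g.ghInv u₀ i r u) * h1

lemma val_mlieBracket_inl_inr (hu : u ∈ coordDomain u₀) (k b c : Fin 4) :
    g.val u (mlieBracket PhaseI (N.frame u₀ (Sum.inl k)) (N.frame u₀ (Sum.inr b)) u)
        (N.frame u₀ (Sum.inr c) u)
      = ∑ d, g.gv u₀ d c u * dirDeriv (N.coeff u₀ k d) (N.frame u₀ (Sum.inr b) u) := by
  rw [mlieBracket_frame_inl_inr N hu, bilin_sum_smul]
  exact Finset.sum_congr rfl fun d _ => mul_comm _ _

lemma canonicalConnection_inr_inl (hu : u ∈ coordDomain u₀) (b k : Fin 4) :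
    canonicalConnection g (N.frame u₀ (Sum.inr b)) u (N.frame u₀ (Sum.inl k) u)
      = ∑ a, g.Lv u₀ a b k u • N.frame u₀ (Sum.inr a) u := by
  have hd := fun α => frame_vecDiffAt (N := N) hu α
  have hv := fun a => eventually_hor_frame_inr (N := N) hu a
  -- the term `e^b(N_{ka}) e^a` of the coefficient is the bracket `[e_k, e^b]`
  set n := mlieBracket PhaseI (N.frame u₀ (Sum.inl k)) (N.frame u₀ (Sum.inr b)) u with hn
  have hD : N.hor u (canonicalConnection g (N.frame u₀ (Sum.inr b)) u
      (N.frame u₀ (Sum.inl k) u) - n) = 0 := by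
    rw [(N.hor u).map_sub, canonicalConnection_ver (hd (Sum.inr b)) (hv b), hn,
      hor_mlieBracket_inl_inr hu, sub_zero]
  refine (sub_eq_iff_eq_add.1 (eq_sum_gvInv g hu hD)).trans ?_
  have hn' := mlieBracket_frame_inl_inr N hu k b
  rw [← hn] at hn'
  conv_lhs => enter [2]; rw [hn']
  rw [← Finset.sum_add_distrib]
  refine Finset.sum_congr rfl fun a _ => ?_
  rw [← add_smul]
  refine congrArg (· • _) ?_
  rw [DMetric.Lv, add_comm, Finset.mul_sum]
  refine congrArg (_ + ·) (Finset.sum_congr rfl fun c _ => ?_)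
  have h1 : 2 * g.val u (canonicalConnection g (N.frame u₀ (Sum.inr b)) u
      (N.frame u₀ (Sum.inl k) u)) (N.frame u₀ (Sum.inr c) u) = _ :=
    (isBlockMetric_val g).adaptedConnection_hor_ver_ver (hd (Sum.inl k)) (hd (Sum.inr b))
      (hd (Sum.inr c)) (eventually_hor_frame_inl hu k) (hv b) (hv c)
      (by rw [mlieBracket_frame_inr_inr N hu, (N.hor u).map_zero])
  have h4 := val_mlieBracket_inl_inr (g := g) hu k b c
  rw [val_mlieBracket_inl_inr hu, val_mlieBracket_inl_inr hu, mvfderiv_gv] at h1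
  rw [(g.val u).map_sub, sub_apply, hn, h4]
  linear_combination (1 / 2 * g.gvInv u₀ a c u) * h1

lemma canonicalConnection_inl_inr (hu : u ∈ coordDomain u₀) (j c : Fin 4) :
    canonicalConnection g (N.frame u₀ (Sum.inl j)) u (N.frame u₀ (Sum.inr c) u)
      = ∑ i, g.Ch u₀ i j c u • N.frame u₀ (Sum.inl i) u := by
  have hd := fun α => frame_vecDiffAt (N := N) hu α
  have hh := fun i => eventually_hor_frame_inl (N := N) hu i
  rw [eq_sum_ghInv g hu (canonicalConnection_hor (hd (Sum.inl j)) (hh j) _)]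
  refine Finset.sum_congr rfl fun i _ => congrArg (· • _) ?_
  rw [DMetric.Ch, Finset.mul_sum]
  refine Finset.sum_congr rfl fun r _ => ?_
  have h1 : 2 * g.val u (canonicalConnection g (N.frame u₀ (Sum.inl j)) u
      (N.frame u₀ (Sum.inr c) u)) (N.frame u₀ (Sum.inl r) u) = _ :=
    (isBlockMetric_val g).adaptedConnection_ver_hor_hor (hd (Sum.inr c)) (hd (Sum.inl j))
      (hd (Sum.inl r)) (eventually_hor_frame_inr hu c) (hh j) (hh r)
      (hor_mlieBracket_inr_inl hu _ _) (hor_mlieBracket_inr_inl hu _ _)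
  rw [mvfderiv_gh] at h1
  linear_combination (1 / 2 * g.ghInv u₀ i r u) * h1

lemma canonicalConnection_inr_inr (hu : u ∈ coordDomain u₀) (b c : Fin 4) :
    canonicalConnection g (N.frame u₀ (Sum.inr b)) u (N.frame u₀ (Sum.inr c) u)
      = ∑ a, g.Cv u₀ a b c u • N.frame u₀ (Sum.inr a) u := by
  have hd := fun α => frame_vecDiffAt (N := N) hu α
  have hv := fun a => eventually_hor_frame_inr (N := N) hu a
  rw [eq_sum_gvInv g hu (canonicalConnection_ver (hd (Sum.inr b)) (hv b) _)]
  refine Finset.sum_congr rfl fun a _ => congrArg (· • _) ?_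
  rw [DMetric.Cv, Finset.mul_sum]
  refine Finset.sum_congr rfl fun d _ => ?_
  have h1 : 2 * g.val u (canonicalConnection g (N.frame u₀ (Sum.inr b)) u
      (N.frame u₀ (Sum.inr c) u)) (N.frame u₀ (Sum.inr d) u) = _ :=
    (isBlockMetric_val g).adaptedConnection_ver_ver_ver (hd (Sum.inr c)) (hd (Sum.inr b))
      (hd (Sum.inr d)) (hv b) (hv d) (mlieBracket_frame_inr_inr N hu _ _)
      (mlieBracket_frame_inr_inr N hu _ _) (mlieBracket_frame_inr_inr N hu _ _)
  rw [mvfderiv_gv, mvfderiv_gv, mvfderiv_gv, gv_comm c b] at h1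
  linear_combination (1 / 2 * g.gvInv u₀ a d u) * h1

variable (g) in
lemma isCanonical_canonicalConnection : g.IsCanonical (canonicalConnection g) :=
  fun _ _ hu => ⟨canonicalConnection_inl_inl hu, canonicalConnection_inr_inl hu,
    canonicalConnection_inl_inr hu, canonicalConnection_inr_inr hu⟩

/-- The coefficients determine the connection. -/
lemma IsCanonical.agree {D D' : PhaseConnection V} (hD : g.IsCanonical D)
    (hD' : g.IsCanonical D') : D.Agree D' := by
  intro Y u hY
  have hu := mem_coordDomain_self u
  refine (isFrame_frame N u).cov_eq hu (fun α β => ?_) hY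
  obtain ⟨h1, h2, h3, h4⟩ := hD u u hu
  obtain ⟨h1', h2', h3', h4'⟩ := hD' u u hu
  rcases α with j | b <;> rcases β with k | c
  · rw [h1, h1']
  · rw [h3, h3']
  · rw [h2, h2']
  · rw [h4, h4']

end PhaseMetric

/-! ### The curvature tensor and its distortion -/

section CurvatureTensor

variable {E : Type*} [NormedAddCommGroup E] [NormedSpace ℝ E] [FiniteDimensional ℝ E]
  [CompleteSpace E] {H : Type*} [TopologicalSpace H] {I : ModelWithCorners ℝ E H}
  {M : Type*} [TopologicalSpace M] [ChartedSpace H M] [IsManifold I ∞ M] [T2Space M]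
  {D D' : CovariantDerivative I E (TangentSpace I : M → Type _)}
  {X Y W : (x : M) → TangentSpace I x} {x : M}

/-- The curvatures of two connections that differ by a tensor `Z`; here `Z x y v` stands for
`Z(v, y)`, the differentiated vector being `y`. -/
lemma curvature_add_tensor (hD : ContMDiffCovariantDerivativeOn E ∞ D.toFun Set.univ)
    (hD' : ContMDiffCovariantDerivativeOn E ∞ D'.toFun Set.univ)
    {Z : (x : M) → TangentSpace I x →L[ℝ] TangentSpace I x →L[ℝ] TangentSpace I x}
    (hZ : ∀ {Y : (x : M) → TangentSpace I x} {x : M}, VecDiffAt Y x → ∀ v,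
      D' Y x v = D Y x v + Z x (Y x) v)
    (hX : SmoothVecNear X x) (hY : SmoothVecNear Y x) (hW : SmoothVecNear W x) :
    curvature D' X Y W x = curvature D X Y W x
      + ((D (fun w => Z w (W w) (Y w)) x (X x) - Z x (W x) (D Y x (X x)) - Z x (D W x (X x)) (Y x))
        - (D (fun w => Z w (W w) (X w)) x (Y x) - Z x (W x) (D X x (Y x))
          - Z x (D W x (Y x)) (X x))
        + Z x (W x) (D.torsion x (X x) (Y x))
        + Z x (Z x (W x) (Y x)) (X x) - Z x (Z x (W x) (X x)) (Y x)) := by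
  have key : ∀ {Y : (x : M) → TangentSpace I x}, SmoothVecNear Y x → ∀ v,
      D' (fun w => D' W w (Y w)) x v = D (fun w => D W w (Y w)) x v
        + D (fun w => Z w (W w) (Y w)) x v + Z x (D W x (Y x)) v + Z x (Z x (W x) (Y x)) v := by
    intro Y hY v
    have h1 := cov_smoothVecNear hD hY hW
    have hA := cov_smoothVecNear hD' hY hW
    have hev : ∀ᶠ w in 𝓝 x, D' W w (Y w) = D W w (Y w) + Z w (W w) (Y w) :=
      hW.eventually.mono fun w hw => hZ hw.mdifferentiableAt _
    have h2 : SmoothVecNear (fun w => Z w (W w) (Y w)) x := by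
      refine (hA.sub h1).congr (hev.mono fun w hw => ?_)
      rw [hw, add_sub_cancel_left]
    rw [hZ hA.mdifferentiableAt, cov_congr hA.mdifferentiableAt (h1.add h2).mdifferentiableAt hev,
      cov_add h1.mdifferentiableAt h2.mdifferentiableAt, hev.self_of_nhds]
    simp only [add_apply, map_add]
    abel
  rw [curvature, key hY, key hX, hZ hW.mdifferentiableAt,
    D.torsion_apply hX.mdifferentiableAt hY.mdifferentiableAt, curvature]
  simp only [map_sub]
  abel

variable (D) in
/-- The value of the curvature on tangent vectors. -/
def curvatureAt (x : M) (v z y : TangentSpace I x) : TangentSpace I x :=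
  curvature D (FiberBundle.extend E (E := (TangentSpace I : M → Type _)) v)
    (FiberBundle.extend E (E := (TangentSpace I : M → Type _)) z)
    (FiberBundle.extend E (E := (TangentSpace I : M → Type _)) y) x

variable (hD : ContMDiffCovariantDerivativeOn E ∞ D.toFun Set.univ)

include hD

lemma curvatureAt_eq (hX : SmoothVecNear X x) (hY : SmoothVecNear Y x) (hW : SmoothVecNear W x) :
    curvatureAt D x (X x) (Y x) (W x) = curvature D X Y W x :=
  curvature_pointwise hD (.extend _) hX (FiberBundle.extend_apply_self _ _) (.extend _) hY
    (FiberBundle.extend_apply_self _ _) (.extend _) hW (FiberBundle.extend_apply_self _ _)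

/-- The curvature as a linear map in the first argument. -/
def curvatureLeft (x : M) (z y : TangentSpace I x) : TangentSpace I x →ₗ[ℝ] TangentSpace I x where
  toFun v := curvatureAt D x v z y
  map_add' v w := by
    obtain ⟨X, hX, rfl⟩ := IsSplitting.exists_field v
    obtain ⟨X', hX', rfl⟩ := IsSplitting.exists_field w
    obtain ⟨Y, hY, rfl⟩ := IsSplitting.exists_field z
    obtain ⟨W, hW, rfl⟩ := IsSplitting.exists_field y
    rw [curvatureAt_eq hD hX hY hW, curvatureAt_eq hD hX' hY hW]
    exact (curvatureAt_eq hD (hX.add hX') hY hW).trans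
      ((curvature_tensorial_left hD hW).add hX hX')
  map_smul' r v := by
    obtain ⟨X, hX, rfl⟩ := IsSplitting.exists_field v
    obtain ⟨Y, hY, rfl⟩ := IsSplitting.exists_field z
    obtain ⟨W, hW, rfl⟩ := IsSplitting.exists_field y
    rw [curvatureAt_eq hD hX hY hW]
    exact (curvatureAt_eq hD (hX.smul (.const r)) hY hW).trans
      ((curvature_tensorial_left hD hW).smul (.const r) hX)

/-- The contraction of the curvature with a linear form and a vector in the first argument, as a
bilinear form. -/
def curvatureContraction (x : M) (c : TangentSpace I x →ₗ[ℝ] ℝ) (v : TangentSpace I x) :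
    TangentSpace I x →ₗ[ℝ] TangentSpace I x →ₗ[ℝ] ℝ :=
  LinearMap.mk₂ ℝ (fun y z => c (curvatureAt D x v z y))
    (fun y y' z => by
      obtain ⟨X, hX, rfl⟩ := IsSplitting.exists_field v
      obtain ⟨Y, hY, rfl⟩ := IsSplitting.exists_field z
      obtain ⟨W, hW, rfl⟩ := IsSplitting.exists_field y
      obtain ⟨W', hW', rfl⟩ := IsSplitting.exists_field y'
      rw [← map_add, curvatureAt_eq hD hX hY hW, curvatureAt_eq hD hX hY hW']
      exact congrArg c ((curvatureAt_eq hD hX hY (hW.add hW')).trans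
        ((curvature_tensorial_right hD hX hY).add hW hW')))
    (fun r y z => by
      obtain ⟨X, hX, rfl⟩ := IsSplitting.exists_field v
      obtain ⟨Y, hY, rfl⟩ := IsSplitting.exists_field z
      obtain ⟨W, hW, rfl⟩ := IsSplitting.exists_field y
      rw [← map_smul, curvatureAt_eq hD hX hY hW]
      exact congrArg c ((curvatureAt_eq hD hX hY (hW.smul (.const r))).trans
        ((curvature_tensorial_right hD hX hY).smul (.const r) hW)))
    (fun y z z' => by
      obtain ⟨X, hX, rfl⟩ := IsSplitting.exists_field v
      obtain ⟨Y, hY, rfl⟩ := IsSplitting.exists_field z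
      obtain ⟨Y', hY', rfl⟩ := IsSplitting.exists_field z'
      obtain ⟨W, hW, rfl⟩ := IsSplitting.exists_field y
      rw [← map_add, curvatureAt_eq hD hX hY hW, curvatureAt_eq hD hX hY' hW]
      exact congrArg c ((curvatureAt_eq hD hX (hY.add hY') hW).trans
        ((curvature_tensorial_mid hD hW).add hY hY')))
    (fun r y z => by
      obtain ⟨X, hX, rfl⟩ := IsSplitting.exists_field v
      obtain ⟨Y, hY, rfl⟩ := IsSplitting.exists_field z
      obtain ⟨W, hW, rfl⟩ := IsSplitting.exists_field y
      rw [← map_smul, curvatureAt_eq hD hX hY hW]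
      exact congrArg c ((curvatureAt_eq hD hX (hY.smul (.const r)) hW).trans
        ((curvature_tensorial_mid hD hW).smul (.const r) hY)))

omit [CompleteSpace E] in
/-- The curvature of a connection commutes with parallel endomorphisms: if a field is fixed by the
projection `h` and `h` is parallel, then the curvature maps it to the image of `h`. -/
lemma map_curvature_of_parallel {h : (x : M) → TangentSpace I x →L[ℝ] TangentSpace I x}
    (hDh : ∀ {Y : (x : M) → TangentSpace I x} {x : M}, VecDiffAt Y x →
      (∀ᶠ w in 𝓝 x, h w (Y w) = Y w) → ∀ v, h x (D Y x v) = D Y x v)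
    (hX : SmoothVecNear X x) (hY : SmoothVecNear Y x) (hW : SmoothVecNear W x)
    (hWh : ∀ᶠ w in 𝓝 x, h w (W w) = W w) :
    h x (curvature D X Y W x) = curvature D X Y W x := by
  have h1 : ∀ {Y : (x : M) → TangentSpace I x}, SmoothVecNear Y x → ∀ v,
      h x (D (fun w => D W w (Y w)) x v) = D (fun w => D W w (Y w)) x v := by
    intro Y hY v
    refine hDh (cov_smoothVecNear hD hY hW).mdifferentiableAt ?_ v
    filter_upwards [hW.eventually, eventually_eventually_nhds.2 hWh] with w hw hw'
      using hDh hw.mdifferentiableAt hw' _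
  rw [curvature, map_sub, map_sub, h1 hY, h1 hX, hDh hW.mdifferentiableAt hWh]

end CurvatureTensor

/-! ### Connections that agree, Levi-Civita connection and distortion tensors -/

section Reflections

variable {E : Type*} [NormedAddCommGroup E] [NormedSpace ℝ E]
  {H : Type*} [TopologicalSpace H] {I : ModelWithCorners ℝ E H}
  {M : Type*} [TopologicalSpace M] [ChartedSpace H M] [IsManifold I ∞ M]
  {D : CovariantDerivative I E (TangentSpace I : M → Type _)}
  {Y : (x : M) → TangentSpace I x} {x : M}
  {h : (x : M) → TangentSpace I x →L[ℝ] TangentSpace I x}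

/-- The derivative of the reflection of a field in the second summand of a splitting. -/
lemma IsSplitting.cov_reflection (hh : IsSplitting h) (hY : VecDiffAt Y x)
    (v : TangentSpace I x) :
    D (fun w => h w (Y w) - (Y w - h w (Y w))) x v
      = (2 : ℝ) • D (fun w => h w (Y w)) x v - D Y x v := by
  have h1 := cov_smul (D := D) (f := fun _ => (2 : ℝ)) mdifferentiableAt_const (hh.diff hY) v
  have h2 := cov_smul (D := D) (f := fun _ => (-1 : ℝ)) mdifferentiableAt_const hY v
  have h3 := cov_add (D := D)
    ((mdifferentiableAt_const (c := (2 : ℝ))).smul_section (hh.diff hY))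
    ((mdifferentiableAt_const (c := (-1 : ℝ))).smul_section hY)
  rw [show (fun w => h w (Y w) - (Y w - h w (Y w)))
    = fun w => (2 : ℝ) • h w (Y w) + (-1 : ℝ) • Y w by ext1 w; module]
  refine (congrArg (fun A => A v) h3).trans ((congrArg₂ (· + ·) h1 h2).trans ?_)
  rw [mvfderiv_const, mvfderiv_const]
  simp only [zero_apply, zero_smul, add_zero]
  module

end Reflections

section PhaseConnections

variable {V : Type*} [TopologicalSpace V] [ChartedSpace BaseModel V] [IsManifold (𝓡 4) ∞ V]
  {N : NConnection V} {g : DMetric N} {D D' : PhaseConnection V} {X Y W : PhaseField V}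
  {u : Cotangent V}

lemma exists_phaseField (v : PhaseTangent u) : ∃ X : PhaseField V, SmoothVecNear X u ∧ X u = v :=
  IsSplitting.exists_field v

lemma smoothVecNear_extendVec (v : PhaseTangent u) : SmoothVecNear (extendVec v) u :=
  SmoothVecNear.extend v

lemma extendVec_apply_self (v : PhaseTangent u) : extendVec v u = v :=
  FiberBundle.extend_apply_self _ _

lemma curv_eq (D : PhaseConnection V) : D.curv X Y W u = curvature D X Y W u := rfl

/-- The torsion on fields. -/
lemma torsion_apply_field (D : PhaseConnection V) (hX : VecDiffAt X u) (hY : VecDiffAt Y u) :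
    CovariantDerivative.torsion D u (X u) (Y u)
      = D Y u (X u) - D X u (Y u) - mlieBracket PhaseI X Y u :=
  D.torsion_apply hX hY

namespace Agree

variable (h : D.Agree D')

include h

lemma smoothVecNear [T2Space V] (hD' : D'.Smooth) (hX : SmoothVecNear X u)
    (hY : SmoothVecNear Y u) : SmoothVecNear (fun w => D Y w (X w)) u :=
  (cov_smoothVecNear hD' hX hY).congr <|
    hY.eventually.mono fun w hw => by rw [h Y w hw.mdifferentiableAt]

lemma smooth [T2Space V] (hD' : D'.Smooth) : D.Smooth :=
  contMDiffCovariantDerivativeOn_of_forall fun hX hY => smoothVecNear h hD' hX hY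

lemma isDConnection (hD' : D'.IsDConnection N) : D.IsDConnection N := by
  intro Y u hY x
  have h1 : VecDiffAt (fun w => N.almostProduct w (Y w)) u :=
    mdifferentiableAt_sub_section ((isSplitting_hor N).diff hY) ((isSplitting_hor N).diff' hY)
  rw [h _ u h1, h Y u hY, hD' Y u hY]

lemma isMetric {b : BilinField V} (hD' : D'.IsMetric b) : D.IsMetric b := by
  intro Y W u hY hW x
  rw [h Y u hY, h W u hW, hD' Y W u hY hW]

lemma torsion_eq : CovariantDerivative.torsion D = CovariantDerivative.torsion D' := by
  ext u x y
  obtain ⟨X, hX, rfl⟩ := exists_phaseField x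
  obtain ⟨Y, hY, rfl⟩ := exists_phaseField y
  rw [torsion_apply_field D hX.mdifferentiableAt hY.mdifferentiableAt,
    torsion_apply_field D' hX.mdifferentiableAt hY.mdifferentiableAt,
    h X u hX.mdifferentiableAt, h Y u hY.mdifferentiableAt]

lemma curv_eq [T2Space V] (hD' : D'.Smooth) (hX : SmoothVecNear X u) (hY : SmoothVecNear Y u)
    (hW : SmoothVecNear W u) : D.curv X Y W u = D'.curv X Y W u := by
  have key : ∀ {Y : PhaseField V}, SmoothVecNear Y u →
      D (fun w => D W w (Y w)) u = D' (fun w => D' W w (Y w)) u := by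
    intro Y hY
    have h1 := smoothVecNear h hD' hY hW
    have h2 := cov_smoothVecNear hD' hY hW
    rw [h _ u h1.mdifferentiableAt]
    exact cov_congr h1.mdifferentiableAt h2.mdifferentiableAt
      (hW.eventually.mono fun w hw => by rw [h W w hw.mdifferentiableAt])
  rw [PhaseConnection.curv, key hX, key hY, h W u hW.mdifferentiableAt, PhaseConnection.curv]

lemma ricci_eq [T2Space V] (hD' : D'.Smooth) (y z : PhaseTangent u) :
    D.ricci u y z = D'.ricci u y z :=
  Finset.sum_congr rfl fun τ _ => congrArg _ <| curv_eq h hD'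
    ((isFrame_coordFrame u).smooth τ (mem_coordDomain_self u)) (smoothVecNear_extendVec z) (smoothVecNear_extendVec y)

end Agree

section Canonical

variable (g)

lemma canonicalConnection_smooth : (canonicalConnection g).Smooth :=
  contMDiffCovariantDerivativeOn_of_forall fun hX hY =>
    (isBlockMetric_val g).adaptedConnection_smoothVecNear hX hY

lemma canonicalConnection_isDConnection : (canonicalConnection g).IsDConnection N := by
  intro Y u hY x
  have h1 : canonicalConnection g (fun w => N.hor w (Y w)) u x
      = N.hor u (canonicalConnection g Y u x) := (isBlockMetric_val g).adaptedConnection_hor Y x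
  have h2 := (isSplitting_hor N).cov_reflection (D := canonicalConnection g) hY x
  refine h2.trans ?_
  rw [h1, two_smul, add_sub_assoc, ← neg_sub, ← sub_eq_add_neg]
  rfl

lemma canonicalConnection_isMetric : (canonicalConnection g).IsMetric g.val := by
  intro Y W u hY hW x
  obtain ⟨X, hX, rfl⟩ := exists_phaseField x
  exact (isBlockMetric_val g).adaptedConnection_metric hX.mdifferentiableAt hY hW

lemma canonicalConnection_horTorsionFree : (canonicalConnection g).HorTorsionFree N := by
  intro u x y
  obtain ⟨X, hX, rfl⟩ := exists_phaseField x
  obtain ⟨Y, hY, rfl⟩ := exists_phaseField y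
  exact (isBlockMetric_val g).hor_torsion hX.mdifferentiableAt hY.mdifferentiableAt

lemma canonicalConnection_verTorsionFree : (canonicalConnection g).VerTorsionFree N := by
  intro u x y
  obtain ⟨X, hX, rfl⟩ := exists_phaseField x
  obtain ⟨Y, hY, rfl⟩ := exists_phaseField y
  rw [ver_apply]
  exact sub_eq_zero.2
    ((isBlockMetric_val g).ver_torsion hX.mdifferentiableAt hY.mdifferentiableAt)

/-- The canonical Hamilton d-connection is a smooth metric d-connection without purely horizontal
and purely covertical torsion. -/
lemma IsCanonical.properties [T2Space V] (hD : g.IsCanonical D) :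
    D.Smooth ∧ D.IsDConnection N ∧ D.IsMetric g.val ∧ D.HorTorsionFree N ∧ D.VerTorsionFree N := by
  have h := IsCanonical.agree hD (isCanonical_canonicalConnection g)
  refine ⟨Agree.smooth h (canonicalConnection_smooth g),
    Agree.isDConnection h (canonicalConnection_isDConnection g),
    Agree.isMetric h (canonicalConnection_isMetric g), ?_, ?_⟩
  · intro u x y
    rw [Agree.torsion_eq h]
    exact canonicalConnection_horTorsionFree g u x y
  · intro u x y
    rw [Agree.torsion_eq h]
    exact canonicalConnection_verTorsionFree g u x y

end Canonical

section LeviCivita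

variable (g)

lemma leviCivita_smooth : PhaseConnection.Smooth (isPseudoMetric_val g).leviCivita :=
  contMDiffCovariantDerivativeOn_of_forall fun hX hY =>
    (isPseudoMetric_val g).leviCivita_smoothVecNear hX hY

lemma isLeviCivita_leviCivita :
    PhaseConnection.IsLeviCivita g.val (isPseudoMetric_val g).leviCivita := by
  refine ⟨fun Y W u hY hW x => ?_, (isPseudoMetric_val g).leviCivita_torsion⟩
  obtain ⟨X, hX, rfl⟩ := exists_phaseField x
  exact (isPseudoMetric_val g).leviCivita_metric hX.mdifferentiableAt hY hW

lemma agree_leviCivita (hD : D.IsLeviCivita g.val) : D.Agree (isPseudoMetric_val g).leviCivita :=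
  fun _ _ hY => (isPseudoMetric_val g).eq_leviCivita D hD.1 hD.2 hY

end LeviCivita

section Distortion

variable (D D') in
/-- The tensor `Z` with `D' = D + Z`. -/
def distortion : DistField V :=
  CovariantDerivative.difference D' D

lemma isDistortion_distortion (D D' : PhaseConnection V) :
    PhaseConnection.IsDistortion D D' (distortion D D') := by
  intro Y u hY x
  have h1 : distortion D D' u (Y u) = D' Y u - D Y u :=
    IsCovariantDerivativeOn.difference_apply D'.isCovariantDerivativeOnUniv
      D.isCovariantDerivativeOnUniv (Set.mem_univ u) hY
  rw [h1, sub_apply, add_sub_cancel]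

lemma IsDistortion.unique {Z Z' : DistField V} (h : PhaseConnection.IsDistortion D D' Z)
    (h' : PhaseConnection.IsDistortion D D' Z') : Z' = Z := by
  ext u y x
  obtain ⟨Y, hY, rfl⟩ := exists_phaseField y
  have h1 := h Y u hY.mdifferentiableAt x
  rw [h' Y u hY.mdifferentiableAt x] at h1
  exact add_left_cancel h1

lemma IsDistortion.smooth [T2Space V] {Z : DistField V} (h : PhaseConnection.IsDistortion D D' Z)
    (hD : D.Smooth) (hD' : D'.Smooth) : Z.Smooth := by
  intro u₀ α β γ u hu
  have hs := isFrame_coordFrame u₀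
  have h1 := (cov_smoothVecNear hD' (hs.smooth β hu) (hs.smooth α hu)).sub
    (cov_smoothVecNear hD (hs.smooth β hu) (hs.smooth α hu))
  refine ((hs.coeff_smooth γ hu h1).congr ?_).contMDiffAt.contMDiffWithinAt
  filter_upwards [hs.mem_nhds hu] with w hw
  rw [coordForm_apply, h _ w (hs.smooth α hw).mdifferentiableAt, add_sub_cancel_left]

lemma IsDistortion.curv_eq [T2Space V] {Z : DistField V}
    (h : PhaseConnection.IsDistortion D D' Z) (hD : D.Smooth) (hD' : D'.Smooth)
    (hX : SmoothVecNear X u) (hY : SmoothVecNear Y u) (hW : SmoothVecNear W u) :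
    D'.curv X Y W u = D.curv X Y W u + D.curvDistortion Z X Y W u :=
  curvature_add_tensor hD hD' (fun hY v => h _ _ hY v) hX hY hW

lemma IsDistortion.ricci_eq [T2Space V] {Z : DistField V}
    (h : PhaseConnection.IsDistortion D D' Z) (hD : D.Smooth) (hD' : D'.Smooth)
    (y z : PhaseTangent u) :
    D'.ricci u y z = D.ricci u y z + D.ricciDistortion Z u y z := by
  rw [PhaseConnection.ricci, PhaseConnection.ricci, PhaseConnection.ricciDistortion,
    ← Finset.sum_add_distrib]
  refine Finset.sum_congr rfl fun τ _ => ?_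
  rw [IsDistortion.curv_eq h hD hD' ((isFrame_coordFrame u).smooth τ (mem_coordDomain_self u))
    (smoothVecNear_extendVec z) (smoothVecNear_extendVec y)]
  simp only [← coordForm_apply, map_add]

end Distortion

end PhaseConnections

/-! ### Field equations and zero torsion constraints -/

section Components

variable {E : Type*} [NormedAddCommGroup E] [NormedSpace ℝ E]
  {H : Type*} [TopologicalSpace H] {I : ModelWithCorners ℝ E H}
  {M : Type*} [TopologicalSpace M] [ChartedSpace H M] [IsManifold I ∞ M]
  {ι κ : Type*} [Fintype ι] [DecidableEq ι] [Fintype κ] [DecidableEq κ]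
  {s : ι → (x : M) → TangentSpace I x} {c : ι → (x : M) → TangentSpace I x →ₗ[ℝ] ℝ} {U : Set M}
  {x : M}

lemma IsFrame.coeff_sum (hs : IsFrame s c U) (hx : x ∈ U) {e : κ → ι}
    (he : Function.Injective e) (f : κ → ℝ) (k : κ) :
    c (e k) x (∑ a, f a • s (e a) x) = f k := by
  simp [hs.dual hx, he.eq_iff]

omit [DecidableEq κ] in
lemma IsFrame.coeff_sum_of_ne (hs : IsFrame s c U) (hx : x ∈ U) {e : κ → ι} {i : ι}
    (he : ∀ a, i ≠ e a) (f : κ → ℝ) : c i x (∑ a, f a • s (e a) x) = 0 := by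
  simp [hs.dual hx, he]

end Components

section FieldEquations

variable {V : Type*} [TopologicalSpace V] [ChartedSpace BaseModel V] [IsManifold (𝓡 4) ∞ V]
  {N : NConnection V} {g : DMetric N} {D : PhaseConnection V} {X Y W : PhaseField V}
  {u₀ u : Cotangent V}

/-- A d-connection maps horizontal fields to horizontal vectors. -/
lemma IsDConnection.hor (hD : D.IsDConnection N) (hY : VecDiffAt Y u)
    (hYh : ∀ᶠ w in 𝓝 u, N.hor w (Y w) = Y w) (v : PhaseTangent u) :
    N.hor u (D Y u v) = D Y u v := by
  have hsp := isSplitting_hor N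
  have h1 : (2 : ℝ) • D (fun w => N.hor w (Y w)) u v - D Y u v
      = N.hor u (D Y u v) - (D Y u v - N.hor u (D Y u v)) :=
    (hsp.cov_reflection hY v).symm.trans (hD Y u hY v)
  rw [cov_congr (hsp.diff hY) hY hYh] at h1
  generalize D Y u v = a at h1 ⊢
  have h2 : (2 : ℝ) • N.hor u a = (2 : ℝ) • a := by
    calc (2 : ℝ) • N.hor u a = (N.hor u a - (a - N.hor u a)) + a := by module
      _ = _ := by rw [← h1, sub_add_cancel]
  exact smul_right_injective _ two_ne_zero h2

/-- A d-connection maps covertical fields to covertical vectors. -/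
lemma IsDConnection.ver (hD : D.IsDConnection N) (hY : VecDiffAt Y u)
    (hYv : ∀ᶠ w in 𝓝 u, N.ver w (Y w) = Y w) (v : PhaseTangent u) :
    N.ver u (D Y u v) = D Y u v := by
  have hsp := isSplitting_hor N
  have h1 : (2 : ℝ) • D (fun w => N.hor w (Y w)) u v - D Y u v
      = N.hor u (D Y u v) - (D Y u v - N.hor u (D Y u v)) :=
    (hsp.cov_reflection hY v).symm.trans (hD Y u hY v)
  have h0 := cov_congr (D := D) (Y := 0) (hsp.diff hY)
    (SmoothVecNear.zero (x := u)).mdifferentiableAt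
    (hYv.mono fun w hw => by rw [← hw, hor_ver]; rfl)
  rw [h0, congr_fun D.zero u] at h1
  rw [ver_apply]
  generalize D Y u v = a at h1 ⊢
  have h2 : (2 : ℝ) • N.hor u a = (2 : ℝ) • (0 : PhaseTangent u) := by
    have h3 : (2 : ℝ) • (0 : PhaseTangent u) - a = N.hor u a - (a - N.hor u a) := h1
    calc (2 : ℝ) • N.hor u a = (N.hor u a - (a - N.hor u a)) + a := by module
      _ = _ := by rw [← h3, sub_add_cancel]
  rw [smul_right_injective _ two_ne_zero h2, sub_zero]

variable [T2Space V] (hD : D.Smooth)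

include hD

lemma curvatureAt_frame (hu : u ∈ coordDomain u₀) (α β γ : PhaseIndex) :
    curvatureAt D u (N.frame u₀ α u) (N.frame u₀ β u) (N.frame u₀ γ u)
      = D.curv (N.frame u₀ α) (N.frame u₀ β) (N.frame u₀ γ) u :=
  curvatureAt_eq hD ((isFrame_frame N u₀).smooth α hu) ((isFrame_frame N u₀).smooth β hu)
    ((isFrame_frame N u₀).smooth γ hu)

/-- The Ricci tensor as a trace over an N-adapted frame. -/
lemma ricci_eq_sum_frame (N : NConnection V) (hu : u ∈ coordDomain u₀) (y z : PhaseTangent u) :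
    D.ricci u y z = ∑ τ, frameForm N u₀ τ u (curvatureAt D u (N.frame u₀ τ u) z y) := by
  have h1 := (isFrame_coordFrame u).trace_eq (isFrame_frame N u₀) (mem_coordDomain_self u) hu
    (curvatureLeft hD u z y)
  refine Eq.trans (Finset.sum_congr rfl fun τ _ => ?_) h1
  rw [← coordForm_apply]
  refine congrArg _ ?_
  have h2 := curvatureAt_eq hD ((isFrame_coordFrame u).smooth τ (mem_coordDomain_self u))
    (smoothVecNear_extendVec z) (smoothVecNear_extendVec y)
  rw [extendVec_apply_self, extendVec_apply_self] at h2
  exact h2.symm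

/-- The Ricci tensor as a bilinear form. -/
def ricciForm (u : Cotangent V) : PhaseTangent u →ₗ[ℝ] PhaseTangent u →ₗ[ℝ] ℝ :=
  ∑ τ, curvatureContraction hD u (coordForm u τ u) (coordFrame u τ u)

lemma ricciForm_apply (y z : PhaseTangent u) : ricciForm hD u y z = D.ricci u y z := by
  rw [ricciForm, LinearMap.sum_apply, LinearMap.sum_apply]
  refine Finset.sum_congr rfl fun τ _ => ?_
  have h2 := curvatureAt_eq hD ((isFrame_coordFrame u).smooth τ (mem_coordDomain_self u))
    (smoothVecNear_extendVec z) (smoothVecNear_extendVec y)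
  rw [extendVec_apply_self, extendVec_apply_self] at h2
  exact congrArg (coordForm u τ u) h2 |>.trans (coordForm_apply _ _ _ _)

omit [T2Space V] hD in
/-- The effective source as a bilinear form. -/
lemma exists_effectiveSource_form (κ : ℝ) (b T : BilinField V) (u : Cotangent V) :
    ∃ B : PhaseTangent u →ₗ[ℝ] PhaseTangent u →ₗ[ℝ] ℝ,
      ∀ y z, B y z = effectiveSource κ b T u y z :=
  ⟨LinearMap.mk₂ ℝ (effectiveSource κ b T u)
    (fun y y' z => by
      simp only [effectiveSource, (T u).map_add, (b u).map_add, add_apply]; ring)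
    (fun r y z => by
      simp only [effectiveSource, (T u).map_smul, (b u).map_smul, smul_apply, smul_eq_mul]; ring)
    (fun y z z' => by
      simp only [effectiveSource, (T u y).map_add, (b u y).map_add]; ring)
    (fun r y z => by
      simp only [effectiveSource, (T u y).map_smul, (b u y).map_smul, smul_eq_mul]; ring),
    fun _ _ => rfl⟩

/-- In the Ricci tensor of a d-connection only the horizontal directions contribute if the first
argument is horizontal. -/
lemma ricci_frame_inl (hDN : D.IsDConnection N) (hu : u ∈ coordDomain u₀) (j : Fin 4)
    (β : PhaseIndex) :
    D.ricci u (N.frame u₀ (Sum.inl j) u) (N.frame u₀ β u)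
      = ∑ i, N.coframe u₀ (Sum.inl i)
        (D.curv (N.frame u₀ (Sum.inl i)) (N.frame u₀ β) (N.frame u₀ (Sum.inl j)) u) := by
  rw [ricci_eq_sum_frame hD N hu, Fintype.sum_sum_type]
  simp only [curvatureAt_frame hD hu, ← frameForm_apply]
  refine add_eq_left.2 (Finset.sum_eq_zero fun a _ => ?_)
  have h1 := map_curvature_of_parallel hD (fun hY hYh v => IsDConnection.hor hDN hY hYh v)
    ((isFrame_frame N u₀).smooth (Sum.inr a) hu) ((isFrame_frame N u₀).smooth β hu)
    ((isFrame_frame N u₀).smooth (Sum.inl j) hu) (eventually_hor_frame_inl hu j)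
  rw [curv_eq, ← h1, frameForm_inr_hor N hu]

/-- In the Ricci tensor of a d-connection only the covertical directions contribute if the first
argument is covertical. -/
lemma ricci_frame_inr (hDN : D.IsDConnection N) (hu : u ∈ coordDomain u₀) (b : Fin 4)
    (β : PhaseIndex) :
    D.ricci u (N.frame u₀ (Sum.inr b) u) (N.frame u₀ β u)
      = ∑ a, N.coframe u₀ (Sum.inr a)
        (D.curv (N.frame u₀ (Sum.inr a)) (N.frame u₀ β) (N.frame u₀ (Sum.inr b)) u) := by
  rw [ricci_eq_sum_frame hD N hu, Fintype.sum_sum_type]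
  simp only [curvatureAt_frame hD hu, ← frameForm_apply]
  refine add_eq_right.2 (Finset.sum_eq_zero fun i _ => ?_)
  have h1 := map_curvature_of_parallel hD (fun hY hYh v => IsDConnection.ver hDN hY hYh v)
    ((isFrame_frame N u₀).smooth (Sum.inl i) hu) ((isFrame_frame N u₀).smooth β hu)
    ((isFrame_frame N u₀).smooth (Sum.inr b) hu)
    ((eventually_hor_frame_inr hu b).mono fun w hw => by rw [ver_apply, hw, sub_zero])
  rw [curv_eq, ← h1, ver_apply, map_sub, frameForm_inl_hor N hu, sub_self]

/-- The equations `R_{αβ} = Υ_{αβ}` in N-adapted frames. -/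
lemma modifiedEinstein_iff_nAdaptedEinstein (hDN : D.IsDConnection N)
    {Υ : (u : Cotangent V) → PhaseTangent u → PhaseTangent u → ℝ}
    (hΥ : ∀ u, ∃ B : PhaseTangent u →ₗ[ℝ] PhaseTangent u →ₗ[ℝ] ℝ, ∀ y z, B y z = Υ u y z) :
    ModifiedEinstein D Υ ↔ NAdaptedEinstein N D Υ := by
  have hcoeff : ∀ {u₀ u : Cotangent V}, u ∈ coordDomain u₀ →
      (∀ h j : Fin 4, ∑ i : Fin 4, D.curvCoeff N u₀ u (.inl i) (.inl h) (.inl j) (.inl i)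
        = D.ricci u (N.frame u₀ (.inl h) u) (N.frame u₀ (.inl j) u)) ∧
      (∀ j a : Fin 4, -∑ i : Fin 4, D.curvCoeff N u₀ u (.inl i) (.inl j) (.inl i) (.inr a)
        = D.ricci u (N.frame u₀ (.inl j) u) (N.frame u₀ (.inr a) u)) ∧
      (∀ b k : Fin 4, ∑ a : Fin 4, D.curvCoeff N u₀ u (.inr a) (.inr b) (.inl k) (.inr a)
        = D.ricci u (N.frame u₀ (.inr b) u) (N.frame u₀ (.inl k) u)) ∧
      (∀ b c : Fin 4, ∑ a : Fin 4, D.curvCoeff N u₀ u (.inr a) (.inr b) (.inr c) (.inr a)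
        = D.ricci u (N.frame u₀ (.inr b) u) (N.frame u₀ (.inr c) u)) := by
    intro u₀ u hu
    refine ⟨fun h j => (ricci_frame_inl hD hDN hu h _).symm, fun j a => ?_,
      fun b k => (ricci_frame_inr hD hDN hu b _).symm,
      fun b c => (ricci_frame_inr hD hDN hu b _).symm⟩
    rw [ricci_frame_inl hD hDN hu, ← Finset.sum_neg_distrib]
    refine Finset.sum_congr rfl fun i _ => ?_
    rw [PhaseConnection.curvCoeff, ← frameForm_apply, ← frameForm_apply, ← map_neg]
    exact congrArg _ curvature_swap.symm
  constructor
  · intro h u₀ u hu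
    obtain ⟨h1, h2, h3, h4⟩ := hcoeff hu
    exact ⟨fun i j => (h1 i j).trans (h _ _ _), fun i j => (h2 i j).trans (h _ _ _),
      fun i j => (h3 i j).trans (h _ _ _), fun i j => (h4 i j).trans (h _ _ _)⟩
  · intro h u y z
    have hu := mem_coordDomain_self u
    obtain ⟨h1, h2, h3, h4⟩ := hcoeff hu
    obtain ⟨h1', h2', h3', h4'⟩ := h u u hu
    obtain ⟨B, hB⟩ := hΥ u
    have key : ∀ α β, ricciForm hD u (N.frame u α u) (N.frame u β u)
        = B (N.frame u α u) (N.frame u β u) := by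
      intro α β
      rw [ricciForm_apply, hB]
      rcases α with i | a <;> rcases β with j | b
      · rw [← h1, h1']
      · rw [← h2, h2']
      · rw [← h3, h3']
      · rw [← h4, h4']
    rw [← ricciForm_apply hD, ← hB, (isFrame_frame N u).expand hu y,
      (isFrame_frame N u).expand hu z]
    simp only [map_sum, map_smul, LinearMap.sum_apply, LinearMap.smul_apply, key]

end FieldEquations

section Extraction

variable {V : Type*} [TopologicalSpace V] [ChartedSpace BaseModel V] [IsManifold (𝓡 4) ∞ V]
  {N : NConnection V} {g : DMetric N} {D : PhaseConnection V} {u₀ u : Cotangent V}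

lemma torsion_frame (D : PhaseConnection V) (hu : u ∈ coordDomain u₀) (α β : PhaseIndex) :
    CovariantDerivative.torsion D u (N.frame u₀ α u) (N.frame u₀ β u)
      = D (N.frame u₀ β) u (N.frame u₀ α u) - D (N.frame u₀ α) u (N.frame u₀ β u)
        - mlieBracket PhaseI (N.frame u₀ α) (N.frame u₀ β) u :=
  torsion_apply_field D (frame_vecDiffAt hu α) (frame_vecDiffAt hu β)

/-- The mixed torsion of the canonical d-connection. -/
lemma IsCanonical.torsion_inl_inr (hD : g.IsCanonical D) (hu : u ∈ coordDomain u₀) (k b : Fin 4) :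
    CovariantDerivative.torsion D u (N.frame u₀ (.inl k) u) (N.frame u₀ (.inr b) u)
      = ∑ a, (g.Lv u₀ a b k u - dirDeriv (N.coeff u₀ k a) (N.frame u₀ (.inr b) u))
          • N.frame u₀ (.inr a) u
        - ∑ i, g.Ch u₀ i k b u • N.frame u₀ (.inl i) u := by
  obtain ⟨-, h2, h3, -⟩ := hD u₀ u hu
  rw [torsion_frame D hu, h2, h3, mlieBracket_frame_inl_inr N hu]
  simp only [sub_smul, Finset.sum_sub_distrib]
  abel

/-- The torsion of the canonical d-connection on horizontal vectors is the curvature of the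
N-connection. -/
lemma IsCanonical.torsion_inl_inl (hD : g.IsCanonical D) (hDh : D.HorTorsionFree N)
    (hu : u ∈ coordDomain u₀) (i j : Fin 4) :
    CovariantDerivative.torsion D u (N.frame u₀ (.inl i) u) (N.frame u₀ (.inl j) u)
      = -∑ a, N.omega u₀ i j a u • N.frame u₀ (.inr a) u := by
  obtain ⟨h1, -, -, -⟩ := hD u₀ u hu
  have h0 := hDh u (N.frame u₀ (.inl i) u) (N.frame u₀ (.inl j) u)
  rw [hor_frame_inl N hu, hor_frame_inl N hu] at h0
  have hh : ∀ f : Fin 4 → ℝ, N.hor u (∑ a, f a • N.frame u₀ (Sum.inl a) u)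
      = ∑ a, f a • N.frame u₀ (Sum.inl a) u := by
    intro f
    rw [clm_sum_smul]
    simp only [hor_frame_inl N hu]
  rw [torsion_frame D hu, h1, h1, mlieBracket_frame_inl_inl N hu] at h0 ⊢
  rw [(N.hor u).map_sub, hor_sum_frame_inr hu, (N.hor u).map_sub, hh, hh, sub_zero] at h0
  rw [h0, zero_sub]

lemma IsCanonical.torsion_inr_inr (hD : g.IsCanonical D) (hDv : D.VerTorsionFree N)
    (hu : u ∈ coordDomain u₀) (a b : Fin 4) :
    CovariantDerivative.torsion D u (N.frame u₀ (.inr a) u) (N.frame u₀ (.inr b) u) = 0 := by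
  obtain ⟨-, -, -, h4⟩ := hD u₀ u hu
  have h0 := hDv u (N.frame u₀ (.inr a) u) (N.frame u₀ (.inr b) u)
  simp only [ver_apply, hor_frame_inr N hu, sub_zero] at h0
  rw [torsion_frame D hu, h4, h4, mlieBracket_frame_inr_inr N hu, sub_zero] at h0 ⊢
  rwa [(N.hor u).map_sub, hor_sum_frame_inr hu, hor_sum_frame_inr hu, sub_zero, sub_zero] at h0

/-- The zero torsion constraints for the canonical d-connection. -/
lemma IsCanonical.torsion_eq_zero_iff (hD : g.IsCanonical D) (hDh : D.HorTorsionFree N)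
    (hDv : D.VerTorsionFree N) :
    CovariantDerivative.torsion D = 0 ↔ g.LCConditions := by
  constructor
  · intro h u₀ u hu
    have hf := isFrame_frame N u₀
    have h0 : ∀ x y : PhaseTangent u, CovariantDerivative.torsion D u x y = 0 := fun x y =>
      congrArg (fun A : DistField V => A u x y) h
    have hmix : ∀ k b, (∀ c : Fin 4,
        g.Lv u₀ c b k u - dirDeriv (N.coeff u₀ k c) (N.frame u₀ (.inr b) u) = 0)
        ∧ ∀ i, g.Ch u₀ i k b u = 0 := by
      intro k b
      have h1 := (IsCanonical.torsion_inl_inr hD hu k b).symm.trans (h0 _ _)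
      refine ⟨fun c => ?_, fun i => ?_⟩
      · have h2 := congrArg (frameForm N u₀ (Sum.inr c) u) h1
        rwa [map_sub, map_zero, hf.coeff_sum hu Sum.inr_injective,
          hf.coeff_sum_of_ne hu (fun _ => Sum.inr_ne_inl), sub_zero] at h2
      · have h2 := congrArg (frameForm N u₀ (Sum.inl i) u) h1
        rwa [map_sub, map_zero, hf.coeff_sum hu Sum.inl_injective,
          hf.coeff_sum_of_ne hu (fun _ => Sum.inl_ne_inr), zero_sub, neg_eq_zero] at h2
    refine ⟨fun i j b => (hmix j b).2 i, fun i j a => ?_, fun c a j => sub_eq_zero.1 ((hmix j a).1 c)⟩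
    have h1 := (IsCanonical.torsion_inl_inl hD hDh hu i j).symm.trans (h0 _ _)
    have h2 := congrArg (frameForm N u₀ (Sum.inr a) u) h1
    rwa [map_neg, map_zero, hf.coeff_sum hu Sum.inr_injective, neg_eq_zero] at h2
  · intro h
    ext u x y
    have hu := mem_coordDomain_self u
    obtain ⟨hC, hΩ, hL⟩ := h u u hu
    have hf := isFrame_frame N u
    have hmix : ∀ k b, CovariantDerivative.torsion D u (N.frame u (.inl k) u)
        (N.frame u (.inr b) u) = 0 := by
      intro k b
      rw [IsCanonical.torsion_inl_inr hD hu]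
      simp only [hL, hC, sub_self, zero_smul, Finset.sum_const_zero]
    have key : ∀ α β, CovariantDerivative.torsion D u (N.frame u α u) (N.frame u β u) = 0 := by
      intro α β
      rcases α with i | a <;> rcases β with j | b
      · rw [IsCanonical.torsion_inl_inl hD hDh hu]
        simp only [hΩ, zero_smul, Finset.sum_const_zero, neg_zero]
      · exact hmix i b
      · rw [D.torsion_antisymm, hmix, neg_zero]
      · exact IsCanonical.torsion_inr_inr hD hDv hu a b
    rw [hf.expand hu x, bilin_sum_smul]
    refine Finset.sum_eq_zero fun α _ => ?_
    rw [hf.expand hu y, clm_sum_smul]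
    simp only [key, smul_zero, Finset.sum_const_zero]

lemma IsDistortion.eq_zero_iff {D' : PhaseConnection V} {Z : DistField V}
    (hZ : PhaseConnection.IsDistortion D D' Z) : Z = 0 ↔ D'.Agree D := by
  have h0 : ∀ (u : Cotangent V) (y x : PhaseTangent u), (0 : DistField V) u y x = 0 :=
    fun _ _ _ => rfl
  constructor
  · rintro rfl Y u hY
    ext x
    rw [hZ Y u hY x, h0, add_zero]
  · intro h
    refine IsDistortion.unique (Z := (0 : DistField V)) (fun Y u hY x => ?_) hZ
    rw [h Y u hY, h0, add_zero]

/-- Among the metric connections exactly the Levi-Civita connection is torsion-free. -/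
lemma torsion_eq_zero_iff_agree {LC : PhaseConnection V} (hD : D.IsMetric g.val)
    (hLC : LC.IsLeviCivita g.val) : CovariantDerivative.torsion D = 0 ↔ D.Agree LC := by
  refine ⟨fun h Y u hY => ?_, fun h => (Agree.torsion_eq h).trans hLC.2⟩
  rw [agree_leviCivita g ⟨hD, h⟩ Y u hY, agree_leviCivita g hLC Y u hY]

/-- Adding the same term to both sides of the field equations. -/
lemma modifiedEinstein_add_iff {D D' : PhaseConnection V}
    {Υ Ξ : (u : Cotangent V) → PhaseTangent u → PhaseTangent u → ℝ}
    (h : ∀ u y z, D'.ricci u y z = D.ricci u y z + Ξ u y z) :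
    ModifiedEinstein D Υ ↔ ModifiedEinstein D' (fun u y z => Υ u y z + Ξ u y z) :=
  forall_congr' fun u => forall_congr' fun y => forall_congr' fun z => by
    rw [h, add_left_inj]

end Extraction

end PhaseGeometry

end

theorem mainTheorem8
    {V : Type*} [TopologicalSpace V] [ChartedSpace BaseModel V] [IsManifold (𝓡 4) ∞ V]
    [T2Space V] [SigmaCompactSpace V]
    (N : NConnection V) (g : DMetric N)
    (D : PhaseConnection V) (hD : D.Smooth) (hDN : D.IsDConnection N) (hDg : D.IsMetric g.val)
    {ι : Type*} [Fintype ι] (T : ι → BilinField V) (κ : ℝ)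
    (Υ : (u : Cotangent V) → PhaseTangent u → PhaseTangent u → ℝ)
    (hΥ : Υ = effectiveSource κ g.val (fun u => ∑ s, T s u)) :
    -- the field equations and their N-adapted form
    (ModifiedEinstein D Υ ↔ NAdaptedEinstein N D Υ) ∧
    -- the canonical Hamilton d-connection exists, is unique and has its defining properties
    (∃ Dhat : PhaseConnection V, g.IsCanonical Dhat ∧
      ∀ D' : PhaseConnection V, g.IsCanonical D' → D'.Agree Dhat) ∧
    (∀ Dhat : PhaseConnection V, g.IsCanonical Dhat →
      Dhat.Smooth ∧ Dhat.IsDConnection N ∧ Dhat.IsMetric g.val ∧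
        Dhat.HorTorsionFree N ∧ Dhat.VerTorsionFree N) ∧
    -- the Levi-Civita connection exists and is unique
    (∃ LC : PhaseConnection V, LC.Smooth ∧ LC.IsLeviCivita g.val ∧
      ∀ D' : PhaseConnection V, D'.IsLeviCivita g.val → D'.Agree LC) ∧
    ∀ Dhat LC : PhaseConnection V, g.IsCanonical Dhat → LC.IsLeviCivita g.val →
      ∃ Z Zhat : DistField V,
        -- unique distortions `Dhat = D + Z` and `Dhat = LC + Zhat`
        (Z.Smooth ∧ PhaseConnection.IsDistortion D Dhat Z ∧
          ∀ Z', PhaseConnection.IsDistortion D Dhat Z' → Z' = Z) ∧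
        (Zhat.Smooth ∧ PhaseConnection.IsDistortion LC Dhat Zhat ∧
          ∀ Z', PhaseConnection.IsDistortion LC Dhat Z' → Z' = Zhat) ∧
        -- distortions of the Ricci d-tensors
        (∀ u y z, Dhat.ricci u y z = D.ricci u y z + D.ricciDistortion Z u y z) ∧
        (∀ u y z, Dhat.ricci u y z = LC.ricci u y z + LC.ricciDistortion Zhat u y z) ∧
        -- canonical form of the field equations, with the redefined source
        (ModifiedEinstein D Υ ↔
          ModifiedEinstein Dhat (fun u y z => Υ u y z + D.ricciDistortion Z u y z)) ∧
        -- extraction of Levi-Civita configurations by the zero-torsion constraints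
        (CovariantDerivative.torsion Dhat = 0 ↔ g.LCConditions) ∧
        (CovariantDerivative.torsion Dhat = 0 ↔ Zhat = 0) ∧
        (CovariantDerivative.torsion Dhat = 0 ↔ Dhat.Agree LC) ∧
        (CovariantDerivative.torsion Dhat = 0 →
          (ModifiedEinstein D Υ ↔
            ModifiedEinstein LC (fun u y z => Υ u y z + D.ricciDistortion Z u y z))) := by
  have hcan := PhaseGeometry.isCanonical_canonicalConnection g
  refine ⟨PhaseGeometry.modifiedEinstein_iff_nAdaptedEinstein hD hDN fun u => by
      rw [hΥ]
      exact PhaseGeometry.exists_effectiveSource_form κ g.val _ u,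
    ⟨_, hcan, fun D' hD' => PhaseGeometry.IsCanonical.agree hD' hcan⟩,
    fun Dhat hDhat => PhaseGeometry.IsCanonical.properties g hDhat,
    ⟨_, PhaseGeometry.leviCivita_smooth g, PhaseGeometry.isLeviCivita_leviCivita g,
      fun D' hD' => PhaseGeometry.agree_leviCivita g hD'⟩, fun Dhat LC hDhat hLC => ?_⟩
  obtain ⟨hs, -, hm, hh, hv⟩ := PhaseGeometry.IsCanonical.properties g hDhat
  have hLCs := PhaseGeometry.Agree.smooth (PhaseGeometry.agree_leviCivita g hLC)
    (PhaseGeometry.leviCivita_smooth g)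
  have hZ := PhaseGeometry.isDistortion_distortion D Dhat
  have hZhat := PhaseGeometry.isDistortion_distortion LC Dhat
  have hric := fun u => PhaseGeometry.IsDistortion.ricci_eq (u := u) hZ hD hs
  have hagree := PhaseGeometry.torsion_eq_zero_iff_agree hm hLC
  have hcanon := PhaseGeometry.modifiedEinstein_add_iff (Υ := Υ) hric
  refine ⟨_, _, ⟨PhaseGeometry.IsDistortion.smooth hZ hD hs, hZ,
      fun Z' => PhaseGeometry.IsDistortion.unique hZ⟩,
    ⟨PhaseGeometry.IsDistortion.smooth hZhat hLCs hs, hZhat,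
      fun Z' => PhaseGeometry.IsDistortion.unique hZhat⟩, hric,
    fun u => PhaseGeometry.IsDistortion.ricci_eq hZhat hLCs hs, hcanon,
    PhaseGeometry.IsCanonical.torsion_eq_zero_iff hDhat hh hv,
    hagree.trans (PhaseGeometry.IsDistortion.eq_zero_iff hZhat).symm, hagree, fun h => ?_⟩
  rw [hcanon]
  exact forall_congr' fun u => forall_congr' fun y => forall_congr' fun z => by
    rw [PhaseGeometry.Agree.ricci_eq (hagree.1 h) hLCs]
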